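/- Let $A$ be an infinite set. Let $\Omega_A=\{-1,1\}^A$ be the compact abelian group with coordinatewise multiplication, identity element $\omega_0$, the product topology and the $\sigma$-field generated by the cylinder sets, and let $\mathbb P_A$ be the uniform product probability measure on it. Let $W_A$ be the set of Walsh characters $w_F(\omega)=\prod_{\alpha\in F}\omega(\alpha)$, $F\subset A$ finite. For a (regular) complex measure $\mu\in M(\Omega_A)$ with total variation norm $\|\mu\|_M$, put $\hat\mu(w)=\int_{\Omega_A} w\,d\mu$ for $w\in W_A$, and for $f\in L^\infty(\Omega_A,\mathbb P_A)$ put $\hat f=\widehat{f\,d\mathbb P_A}$. All scalars are complex, $l^p(A)$ is the usual space of scalar functions on $A$, and $B_{l^p(A)}$ is its closed unit ball. Define $$L^\infty_{(p)}=\{f\in L^\infty(\Omega_A,\mathbb P_A):\hat f\in l^p(W_A)\},\quad \|f\|_{L^\infty_{(p)}}=\max\{\|f\|_{L^\infty},\|\hat f\|_p\}\qquad(1\le p\le 2),$$ $$M_{(p)}=\{\mu\in M(\Omega_A):\hat\mu\in l^p(W_A)\},\quad \|\mu\|_{M_{(p)}}=\max\{\|\mu\|_M,\|\hat\mu\|_p\}\qquad(2<p\le\infty).$$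 For $f\in L^\infty_{(p)}$ and $\mu\in M_{(q)}$ with $1\le p<2<q\le\infty$ and $\frac1p+\frac1q=1$, the integral $\int_{\Omega_A} f\,d\mu$ denotes the value at $\omega_0$ of the continuous version of the convolution $(f\star\mu)(\omega)=\int_{\Omega_A} f(\omega\omega'^{-1})\,\mu(d\omega')$, which is defined for $\mathbb P_A$-almost every $\omega$. Let $\delta=\sqrt{\sinh 1-1}$. **Theorem.** There exist one-one maps $\Phi^{(p)}:B_{l^p(A)}\to L^\infty_{(p)}$ for $1\le p\le2$, and $\Phi^{(p)}:B_{l^p(A)}\to M_{(p)}$ for $2<p\le\infty$, such that the following hold. 1. For all $\mathbf x\in B_{l^p(A)}$, $$\|\Phi^{(p)}(\mathbf x)\|_{L^\infty_{(p)}}\le\frac{2\sqrt e}{1-\delta^{2/p}}\quad(1\le p\le2),\qquad \|\Phi^{(p)}(\mathbf x)\|_{M_{(p)}}\le4\Big(\frac{1+\delta^2}{1-\delta^2}\Big)^{1/p}\quad(2<p\le\infty),$$ where $1/p=0$ for $p=\infty$. 2. $\Phi^{(p)}(-\mathbf x)=-\Phi^{(p)}(\mathbf x)$ for all $\mathbf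 x\in B_{l^p(A)}$ and $1\le p\le\infty$. 3. For all $1\le p\le2\le q\le\infty$ with $\frac1p+\frac1q=1$, all $\mathbf x\in B_{l^p(A)}$ and all $\mathbf y\in B_{l^q(A)}$, $$\sum_{\alpha\in A}\mathbf x(\alpha)\overline{\mathbf y(\alpha)}=\int_{\Omega_A}\Phi^{(p)}(\mathbf x)\,d\Phi^{(q)}(\overline{\mathbf y})=\sum_{w\in W_A}\widehat{\Phi^{(p)}(\mathbf x)}(w)\,\widehat{\Phi^{(q)}(\overline{\mathbf y})}(w),$$ where both sums converge absolutely, the continuous version of $\Phi^{(p)}(\mathbf x)\star\Phi^{(q)}(\overline{\mathbf y})$ exists when $q>2$, and $d\Phi^{(2)}(\overline{\mathbf y}):=\Phi^{(2)}(\overline{\mathbf y})\,d\mathbb P_A$ when $p=q=2$. 4. For every $p\in[1,\infty]$, $\Phi^{(p)}$ is continuous from $B_{l^p(A)}$ with the weak topology of $l^p(A)$ to $L^\infty_{(p)}$, respectively $M_{(p)}$, with the weak* topology that comes from $L^\infty(\Omega_A,\mathbb P_A)=L^1(\Omega_A,\mathbb P_A)^*$, respectively $M(\Omega_A)=C(\Omega_A)^*$;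 and $\mathbf x\mapsto\widehat{\Phi^{(p)}(\mathbf x)}$ is continuous from $B_{l^p(A)}$ with the $l^p$-norm to $l^p(W_A)$ with its norm. -/

import Mathlib

open MeasureTheory Set Topology
open scoped ENNReal

noncomputable section

namespace WalshParseval

/-- The dyadic group `Ω_A = {-1, 1}^A`, with coordinatewise multiplication, the product topology,
and the σ-field generated by the cylinder sets. -/
abbrev Omega (A : Type*) : Type _ := A → ℤˣ

/-- The uniform product probability measure `ℙ_A` on `Ω_A`. -/
def haarP (A : Type*) : Measure (Omega A) :=
  Measure.infinitePi fun _ : A => (PMF.uniformOfFintype ℤˣ).toMeasure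

instance (A : Type*) : IsProbabilityMeasure (haarP A) := by
  unfold haarP; infer_instance

instance : MeasurableSingletonClass ℤˣ :=
  ⟨fun a => ⟨{(a : ℤ)}, measurableSet_singleton _, by ext b; simp [Units.ext_iff]⟩⟩

/-- The measure of a cylinder set is `2 ^ (-|F|)`. -/
theorem haarP_cylinder {A : Type*} (F : Finset A) (η : A → ℤˣ) :
    haarP A (Set.pi F fun α => {η α}) = (2⁻¹ : ℝ≥0∞) ^ F.card := by
  have h (a : ℤˣ) : (PMF.uniformOfFintype ℤˣ).toMeasure {a} = (2⁻¹ : ℝ≥0∞) := by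
    rw [PMF.toMeasure_apply_singleton _ _ (measurableSet_singleton a)]
    simp
  unfold haarP
  rw [Measure.infinitePi_pi _ (fun i _ => measurableSet_singleton _)]
  simp only [h, Finset.prod_const]

/-- The Walsh character `w_F = ∏_{α ∈ F} r_α`, where `r_α ω = ω α`. As `F` runs over the finite
subsets of `A`, this enumerates the character group `W_A` of `Ω_A` without repetition, so that
`W_A` is identified with `Finset A` throughout. -/
def walshChar {A : Type*} (F : Finset A) (ω : Omega A) : ℂ :=
  ∏ α ∈ F, (((ω α : ℤˣ) : ℤ) : ℂ)

/-- The integral `∫ f dμ` of a complex function against a complex measure on `Ω_A`. -/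
def cintegral {A : Type*} (f : Omega A → ℂ) (μ : ComplexMeasure (Omega A)) : ℂ :=
  VectorMeasure.integral μ f (ContinuousLinearMap.mul ℝ ℂ)

/-- The Walsh transform of an element of `L^∞(Ω_A, ℙ_A)`. -/
def walshL {A : Type*} (f : Lp ℂ ∞ (haarP A)) (F : Finset A) : ℂ :=
  ∫ ω, walshChar F ω * f ω ∂(haarP A)

/-- The Walsh transform of a complex measure. -/
def walshM {A : Type*} (μ : ComplexMeasure (Omega A)) (F : Finset A) : ℂ :=
  cintegral (walshChar F) μ

/-- Regularity of a complex measure: every set of the σ-field is approximated in total variation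
by compact sets from inside and by open sets from outside (all belonging to the σ-field). -/
def IsRegular {A : Type*} (μ : ComplexMeasure (Omega A)) : Prop :=
  ∀ E : Set (Omega A), MeasurableSet E → ∀ ε : ℝ≥0∞, 0 < ε →
    ∃ K U : Set (Omega A), IsCompact K ∧ MeasurableSet K ∧ IsOpen U ∧ MeasurableSet U ∧
      K ⊆ E ∧ E ⊆ U ∧ μ.variation (U \ K) < ε

/-- The space `L^∞_(p)(Ω_A, ℙ_A)` of bounded functions with `p`-summable Walsh transform. -/
abbrev LinfP (A : Type*) (p : ℝ≥0∞) : Type _ :=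
  {f : Lp ℂ ∞ (haarP A) // Memℓp (walshL f) p}

/-- The space `M_(p)(Ω_A)` of regular complex measures with `p`-summable Walsh transform. -/
abbrev MeasP (A : Type*) (p : ℝ≥0∞) : Type _ :=
  {μ : ComplexMeasure (Omega A) // IsRegular μ ∧ Memℓp (walshM μ) p}

/-- The Walsh transform `L^∞_(p)(Ω_A, ℙ_A) → l^p(W_A)`. -/
def LinfP.hat {A : Type*} {p : ℝ≥0∞} (f : LinfP A p) : lp (fun _ : Finset A => ℂ) p :=
  ⟨walshL f.1, f.2⟩

/-- The Walsh transform `M_(p)(Ω_A) → l^p(W_A)`. -/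
def MeasP.hat {A : Type*} {p : ℝ≥0∞} (μ : MeasP A p) : lp (fun _ : Finset A => ℂ) p :=
  ⟨walshM μ.1, μ.2.2⟩

/-- The norm of `L^∞_(p)(Ω_A, ℙ_A)`. -/
def LinfP.nrm {A : Type*} {p : ℝ≥0∞} (f : LinfP A p) : ℝ :=
  max ‖f.1‖ ‖f.hat‖

/-- The norm of `M_(p)(Ω_A)`, the maximum of the total variation of the measure and the `l^p`-norm
of its Walsh transform, as an extended nonnegative real. -/
def MeasP.nrm {A : Type*} {p : ℝ≥0∞} (μ : MeasP A p) : ℝ≥0∞ :=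
  max (μ.1.variation univ) (ENNReal.ofReal ‖μ.hat‖)

/-- The weak* topology on `L^∞_(p)(Ω_A, ℙ_A) ⊆ L^∞ = (L^1)*`. -/
abbrev LinfP.weakStar (A : Type*) (p : ℝ≥0∞) : TopologicalSpace (LinfP A p) :=
  ⨅ g : Lp ℂ 1 (haarP A),
    TopologicalSpace.induced (fun f : LinfP A p => ∫ ω, f.1 ω * g ω ∂(haarP A)) inferInstance

/-- The weak* topology on `M_(p)(Ω_A) ⊆ M(Ω_A) = C(Ω_A)*`. -/
abbrev MeasP.weakStar (A : Type*) (p : ℝ≥0∞) : TopologicalSpace (MeasP A p) :=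
  ⨅ g : C(Omega A, ℂ),
    TopologicalSpace.induced (fun μ : MeasP A p => cintegral g μ.1) inferInstance

/-- The closed unit ball of `l^p(A)`. -/
abbrev Ball (A : Type*) (p : ℝ≥0∞) [Fact (1 ≤ p)] : Type _ :=
  Metric.closedBall (0 : lp (fun _ : A => ℂ) p) 1

/-- The weak topology of `l^p(A)`, restricted to the closed unit ball. -/
abbrev Ball.weak (A : Type*) (p : ℝ≥0∞) [Fact (1 ≤ p)] : TopologicalSpace (Ball A p) :=
  TopologicalSpace.induced
    (fun x : Ball A p => toWeakSpace ℂ (lp (fun _ : A => ℂ) p) x.1) inferInstance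

/-- Complex conjugation on the closed unit ball of `l^p(A)`. -/
def Ball.conj {A : Type*} {p : ℝ≥0∞} [Fact (1 ≤ p)] (x : Ball A p) : Ball A p :=
  ⟨star x.1, mem_closedBall_zero_iff.2 (by
    rw [norm_star]; exact mem_closedBall_zero_iff.1 x.2)⟩

/-- The convolution `(f ⋆ μ)(ω) = ∫ f(ω ω'⁻¹) μ(dω')`. -/
def conv {A : Type*} (f : Omega A → ℂ) (μ : ComplexMeasure (Omega A)) (ω : Omega A) : ℂ :=
  cintegral (fun ω' => f (ω * ω'⁻¹)) μ

/-- `HasIntegral f μ c` means `∫ f dμ = c`. Since `f` is only a class modulo `ℙ_A`-null sets,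
whereas `μ` may be singular, this is understood as `(f ⋆ μ)(ω₀) = c`, where `ω₀` is the identity
of `Ω_A` and `f ⋆ μ`, an a.e. defined function, is required to have a continuous version, which
is evaluated at `ω₀`. -/
def HasIntegral {A : Type*} (f : Lp ℂ ∞ (haarP A)) (μ : ComplexMeasure (Omega A)) (c : ℂ) : Prop :=
  ∃ g : C(Omega A, ℂ), (∀ᵐ ω ∂(haarP A), g ω = conv f μ ω) ∧ g 1 = c

/-- The value of the integral is unique, since `ℙ_A` charges nonempty open sets. -/
theorem HasIntegral.unique {A : Type*} {f : Lp ℂ ∞ (haarP A)} {μ : ComplexMeasure (Omega A)}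
    {c d : ℂ} (hc : HasIntegral f μ c) (hd : HasIntegral f μ d) : c = d := by
  obtain ⟨g, hg, rfl⟩ := hc
  obtain ⟨h, hh, rfl⟩ := hd
  by_contra hne
  have hO : IsOpen {ω : Omega A | g ω ≠ h ω} := isOpen_ne_fun g.continuous h.continuous
  obtain ⟨F, u, hu, hsub⟩ := isOpen_pi_iff.1 hO 1 hne
  have h0 : haarP A {ω : Omega A | g ω ≠ h ω} = 0 := by
    have : ∀ᵐ ω ∂(haarP A), g ω = h ω := by
      filter_upwards [hg, hh] with ω h1 h2 using h1.trans h2.symm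
    exact this
  have h1 : haarP A (Set.pi F fun α => {(1 : Omega A) α}) = 0 := by
    refine measure_mono_null (fun ω hω => hsub fun α hα => ?_) h0
    rw [mem_singleton_iff.1 (hω α hα)]
    exact (hu α hα).2
  rw [haarP_cylinder] at h1
  simp at h1

/-- The constant `δ = √(sinh 1 - 1)`. -/
def delta : ℝ := Real.sqrt (Real.sinh 1 - 1)

end WalshParseval

end

/-! Treat a real sequence `x` in the unit ball first. For p ≤ 2 the function Im ∏(1 + i x(α) r_α) is
bounded by √e, since |1 + it|² = 1 + t² ≤ exp(t²), and its Walsh coefficient at F is Im(i^|F|)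
∏_{α∈F} x(α). For q > 2 the difference of the Riesz products with parameters ±y/2 is a measure of
mass at most 2 with coefficients 2 ∏_{α∈F} y(α)/2 at odd F and 0 at even F. Paired with each other,
the singletons give Σ x(α)y(α), and the sets of odd size at least 3 give an error.

The error is again an inner product, of two sequences indexed by finite subsets of A. As A is
infinite, these subsets are re-indexed by A through `finsetEmb`, and the error becomes -ρ⟨Tx, Sy⟩
with T, S = `fnStep`, `measStep`. The l^p-mass of the nonlinear part is at most sinh 1 - 1 = δ², so
ρ = δ^(2/p) keeps Tx in the unit ball, and Sy has at most half the norm of y. The construction is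
repeated on T^j x and S^j y in disjoint copies of A (`layerEmb j`), the j-th function being weighted
by ρ^j. The total pairing telescopes: Σ ρ^j (D_j - ρ D_{j+1}) = D_0 = Σ x(α)y(α), where D_j = ⟨T^j
x, S^j y⟩ (`hasSum_telescope`, `lpPair_fnHat_measHat`). On the measure side all layers sit in one
Riesz product; its coefficients at sets that mix layers do no harm, because the function has none
there.

For p = q = 2 the function construction is used on both sides. The signs Im(i^|F|) then square to 1
and the error is +ρ²⟨Tx, Ty⟩, so the j-th layer is weighted by (iρ)^j to make the sum telescope
(`lpPair_fnHat_fnHat`). Complex sequences are split into real and imaginary parts, and bilinearity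
of the pairing does the rest (`lpPair_complex`).

Norm continuity comes from Lipschitz bounds for the monomial maps and uniformly convergent series.
Weak-to-weak* continuity holds because each Walsh coefficient is a uniform limit of functions of
finitely many coordinates, and boundedness plus density handle general test functions. Injectivity
is read off from the singletons of layer 0. The convolution has a continuous version because Σ f̂ μ̂
w converges absolutely in C(Ω) (`hasIntegral_of_hasSum`). -/

noncomputable section

namespace WalshParseval

/-! ### Inequalities for products over finite sets. -/

section FiniteProducts

variable {ι : Type*}

/-- Both bounds must be proved together: adjoining an index exchanges odd and even subsets, and the
addition formulas with a ≤ sinh a and 1 ≤ cosh a close the induction. -/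
theorem sum_powerset_odd_le_sinh_and_even_le_cosh [DecidableEq ι] {a : ι → ℝ} (ha : ∀ i, 0 ≤ a i)
    (S : Finset ι) :
    (∑ F ∈ S.powerset, if Odd F.card then ∏ i ∈ F, a i else 0) ≤ Real.sinh (∑ i ∈ S, a i) ∧
    (∑ F ∈ S.powerset, if Odd F.card then 0 else ∏ i ∈ F, a i) ≤ Real.cosh (∑ i ∈ S, a i) := by
  induction S using Finset.induction_on with
  | empty => simp
  | insert j S hj ih =>
    have hsum : (0 : ℝ) ≤ ∑ i ∈ S, a i := Finset.sum_nonneg fun i _ => ha i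
    have key (F : Finset ι) (hF : F ∈ S.powerset) : (insert j F).card = F.card + 1 ∧
        ∏ i ∈ insert j F, a i = a j * ∏ i ∈ F, a i := by
      have : j ∉ F := fun h => hj (Finset.mem_powerset.1 hF h)
      exact ⟨Finset.card_insert_of_notMem this, Finset.prod_insert this⟩
    have h1 : (∑ F ∈ S.powerset, if Odd (insert j F).card then ∏ i ∈ insert j F, a i else 0) =
        a j * ∑ F ∈ S.powerset, if Odd F.card then 0 else ∏ i ∈ F, a i := by
      rw [Finset.mul_sum]
      refine Finset.sum_congr rfl fun F hF => ?_
      rw [(key F hF).1, (key F hF).2]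
      by_cases h : Odd F.card <;> simp [h, Nat.odd_add_one]
    have h2 : (∑ F ∈ S.powerset, if Odd (insert j F).card then 0 else ∏ i ∈ insert j F, a i) =
        a j * ∑ F ∈ S.powerset, if Odd F.card then ∏ i ∈ F, a i else 0 := by
      rw [Finset.mul_sum]
      refine Finset.sum_congr rfl fun F hF => ?_
      rw [(key F hF).1, (key F hF).2]
      by_cases h : Odd F.card <;> simp [h, Nat.odd_add_one]
    rw [Finset.sum_powerset_insert hj, Finset.sum_powerset_insert hj, h1, h2,
      Finset.sum_insert hj, add_comm (a j), Real.sinh_add, Real.cosh_add]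
    have c1 := Real.one_le_cosh (a j)
    have s1 := Real.self_le_sinh_iff.2 (ha j)
    have s2 := Real.sinh_nonneg_iff.2 hsum
    have c2 := (Real.cosh_pos (∑ i ∈ S, a i)).le
    have haj := ha j
    constructor
    · have e1 := mul_le_mul_of_nonneg_left ih.2 haj
      have e2 := mul_le_mul_of_nonneg_left s1 c2
      have e3 := mul_le_mul_of_nonneg_left c1 s2
      linarith [ih.1, mul_comm (a j) (Real.cosh (∑ i ∈ S, a i))]
    · have e1 := mul_le_mul_of_nonneg_left ih.1 haj
      have e2 := mul_le_mul_of_nonneg_left s1 s2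
      have e3 := mul_le_mul_of_nonneg_left c1 c2
      linarith [ih.2, mul_comm (a j) (Real.sinh (∑ i ∈ S, a i))]

theorem sum_powerset_odd_ne_one_le [DecidableEq ι] {a : ι → ℝ} (ha : ∀ i, 0 ≤ a i) (S : Finset ι) :
    (∑ F ∈ S.powerset, if Odd F.card ∧ F.card ≠ 1 then ∏ i ∈ F, a i else 0) ≤
      Real.sinh (∑ i ∈ S, a i) - ∑ i ∈ S, a i := by
  have h : (∑ F ∈ S.powerset, if F.card = 1 then ∏ i ∈ F, a i else 0) = ∑ i ∈ S, a i := by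
    rw [← Finset.sum_filter]
    have : S.powerset.filter (fun F => F.card = 1) = S.map ⟨singleton, Finset.singleton_injective⟩ := by
      ext F
      simp only [Finset.mem_filter, Finset.mem_powerset, Finset.mem_map,
        Function.Embedding.coeFn_mk, Finset.card_eq_one]
      constructor
      · rintro ⟨h1, i, rfl⟩
        exact ⟨i, by simpa using h1, rfl⟩
      · rintro ⟨i, hi, rfl⟩
        exact ⟨by simpa using hi, i, rfl⟩
    rw [this, Finset.sum_map]
    simp
  rw [le_sub_iff_add_le, ← h, ← Finset.sum_add_distrib]
  refine le_trans (Finset.sum_le_sum fun F _ => ?_)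
    (h ▸ (sum_powerset_odd_le_sinh_and_even_le_cosh ha S).1)
  by_cases h1 : F.card = 1
  · simp [h1]
  · simp [h1]

theorem norm_prod_sub_prod_le [DecidableEq ι] {x y : ι → ℂ} {M : ι → ℝ} (hx : ∀ i, ‖x i‖ ≤ M i)
    (hy : ∀ i, ‖y i‖ ≤ M i) (F : Finset ι) :
    ‖∏ i ∈ F, x i - ∏ i ∈ F, y i‖ ≤ ∑ i ∈ F, ‖x i - y i‖ * ∏ j ∈ F.erase i, M j := by
  have hM (i : ι) : 0 ≤ M i := (norm_nonneg _).trans (hx i)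
  induction F using Finset.induction_on with
  | empty => simp
  | insert j F hj ih =>
    rw [Finset.prod_insert hj, Finset.prod_insert hj, Finset.sum_insert hj, Finset.erase_insert hj]
    have e : x j * ∏ i ∈ F, x i - y j * ∏ i ∈ F, y i =
        (x j - y j) * ∏ i ∈ F, x i + y j * (∏ i ∈ F, x i - ∏ i ∈ F, y i) := by ring
    rw [e]
    refine (norm_add_le _ _).trans (add_le_add ?_ ?_)
    · rw [norm_mul, norm_prod]
      gcongr with i _
      exact hx i
    · rw [norm_mul]
      refine (mul_le_mul (hy j) ih (norm_nonneg _) (hM j)).trans_eq ?_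
      rw [Finset.mul_sum]
      refine Finset.sum_congr rfl fun i hi => ?_
      have hij : j ≠ i := fun h => hj (h ▸ hi)
      rw [Finset.erase_insert_of_ne hij, Finset.prod_insert
        (fun h => hj (Finset.mem_of_mem_erase h))]
      ring

/-- After exchanging the sums, for fixed i the sets F \ {i} are distinct subsets of S, and all
subsets together contribute ∏(1 + N_j) ≤ exp ΣN_j. -/
theorem sum_powerset_sum_erase_le [DecidableEq ι] {d N : ι → ℝ} (hd : ∀ i, 0 ≤ d i)
    (hN : ∀ i, 0 ≤ N i) (S : Finset ι) :
    ∑ F ∈ S.powerset, ∑ i ∈ F, d i * ∏ j ∈ F.erase i, N j ≤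
      (∑ i ∈ S, d i) * Real.exp (∑ i ∈ S, N i) := by
  have hexp : ∑ G ∈ S.powerset, ∏ j ∈ G, N j ≤ Real.exp (∑ i ∈ S, N i) := by
    rw [← Finset.prod_one_add]
    exact Real.prod_one_add_le_exp_sum S hN
  have hswap : ∑ F ∈ S.powerset, ∑ i ∈ F, d i * ∏ j ∈ F.erase i, N j =
      ∑ i ∈ S, ∑ F ∈ S.powerset.filter (i ∈ ·), d i * ∏ j ∈ F.erase i, N j := by
    refine Finset.sum_comm' fun F i => ?_
    simp only [Finset.mem_powerset, Finset.mem_filter]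
    exact ⟨fun h => ⟨h, h.1 h.2⟩, fun h => h.1⟩
  rw [hswap, Finset.sum_mul]
  refine Finset.sum_le_sum fun i _ => ?_
  rw [← Finset.mul_sum]
  refine mul_le_mul_of_nonneg_left (le_trans ?_ hexp) (hd i)
  have hinj : Set.InjOn (fun F : Finset ι => F.erase i) (S.powerset.filter (i ∈ ·)) :=
    fun F hF G hG h => Finset.erase_injOn' i (Finset.mem_filter.1 hF).2 (Finset.mem_filter.1 hG).2 h
  rw [← Finset.sum_image (f := fun G : Finset ι => ∏ j ∈ G, N j) hinj]
  refine Finset.sum_le_sum_of_subset_of_nonneg (fun G hG => ?_)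
    fun G _ _ => Finset.prod_nonneg fun j _ => hN j
  obtain ⟨F, hF, rfl⟩ := Finset.mem_image.1 hG
  exact Finset.mem_powerset.2 ((Finset.erase_subset _ _).trans
    (Finset.mem_powerset.1 (Finset.mem_filter.1 hF).1))

/-- Convexity of t^r costs a factor |F|^(r-1). As n ≤ 2^(n-1), it can be distributed as one factor
2^(r-1) to each of the n - 1 remaining indices. -/
theorem rpow_norm_prod_sub_prod_le [DecidableEq ι] {r : ℝ} (hr : 1 ≤ r) {x y : ι → ℂ} {M : ι → ℝ}
    (hx : ∀ i, ‖x i‖ ≤ M i) (hy : ∀ i, ‖y i‖ ≤ M i) (F : Finset ι) :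
    ‖∏ i ∈ F, x i - ∏ i ∈ F, y i‖ ^ r ≤
      ∑ i ∈ F, ‖x i - y i‖ ^ r * ∏ j ∈ F.erase i, (2 ^ (r - 1) * M j ^ r) := by
  have hM (i : ι) : 0 ≤ M i := (norm_nonneg _).trans (hx i)
  have h0 (i : ι) : 0 ≤ ‖x i - y i‖ * ∏ j ∈ F.erase i, M j :=
    mul_nonneg (norm_nonneg _) (Finset.prod_nonneg fun j _ => hM j)
  refine (Real.rpow_le_rpow (norm_nonneg _) (norm_prod_sub_prod_le hx hy F) (by linarith)).trans ?_
  refine (Real.rpow_sum_le_const_mul_sum_rpow_of_nonneg F hr fun i _ => h0 i).trans ?_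
  rw [Finset.mul_sum]
  refine Finset.sum_le_sum fun i hi => ?_
  rw [Real.mul_rpow (norm_nonneg _) (Finset.prod_nonneg fun j _ => hM j), Finset.prod_mul_distrib,
    Finset.prod_const, Real.finsetProd_rpow _ _ (fun j _ => hM j), Finset.card_erase_of_mem hi]
  have hc : (F.card : ℝ) ^ (r - 1) ≤ (2 ^ (r - 1)) ^ (F.card - 1) := by
    rw [← Real.rpow_natCast, ← Real.rpow_mul (by norm_num), mul_comm, Real.rpow_mul (by norm_num)]
    refine Real.rpow_le_rpow (by positivity) ?_ (by linarith)
    have : F.card ≤ 2 ^ (F.card - 1) := by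
      have h1 := Nat.lt_two_pow_self (n := F.card - 1)
      have h2 := Finset.card_pos.2 ⟨i, hi⟩
      omega
    rw [Real.rpow_natCast]
    exact_mod_cast this
  have h1 : 0 ≤ ‖x i - y i‖ ^ r * (∏ j ∈ F.erase i, M j) ^ r := by
    have := Finset.prod_nonneg (s := F.erase i) fun j _ => hM j
    positivity
  nlinarith [mul_le_mul_of_nonneg_right hc h1]

theorem sum_powerset_rpow_norm_prod_sub_prod_le [DecidableEq ι] {r : ℝ} (hr : 1 ≤ r) (x y : ι → ℂ)
    (S : Finset ι) :
    ∑ F ∈ S.powerset, ‖∏ i ∈ F, x i - ∏ i ∈ F, y i‖ ^ r ≤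
      (∑ i ∈ S, ‖x i - y i‖ ^ r) *
        Real.exp (2 ^ (r - 1) * (∑ i ∈ S, ‖x i‖ ^ r + ∑ i ∈ S, ‖y i‖ ^ r)) := by
  have hr0 : 0 ≤ r := by linarith
  have hM (i : ι) : 0 ≤ max ‖x i‖ ‖y i‖ := (norm_nonneg _).trans (le_max_left _ _)
  refine (Finset.sum_le_sum fun F _ => rpow_norm_prod_sub_prod_le hr (M := fun i => max ‖x i‖ ‖y i‖)
    (fun i => le_max_left _ _) (fun i => le_max_right _ _) F).trans ?_
  refine (sum_powerset_sum_erase_le (fun i => by positivity) (fun i => by positivity) S).trans ?_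
  refine mul_le_mul_of_nonneg_left (Real.exp_le_exp.2 ?_)
    (Finset.sum_nonneg fun i _ => by positivity)
  rw [← Finset.sum_add_distrib, Finset.mul_sum]
  refine Finset.sum_le_sum fun i _ => mul_le_mul_of_nonneg_left ?_ (by positivity)
  rcases max_choice ‖x i‖ ‖y i‖ with h | h <;> rw [h]
  · linarith [Real.rpow_nonneg (norm_nonneg (y i)) r]
  · linarith [Real.rpow_nonneg (norm_nonneg (x i)) r]

theorem norm_prod_le_half_pow {x : ι → ℂ} (hx : ∀ i, ‖x i‖ ≤ 1 / 2) (F : Finset ι) :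
    ‖∏ i ∈ F, x i‖ ≤ (1 / 2) ^ F.card := by
  rw [norm_prod]
  calc ∏ i ∈ F, ‖x i‖ ≤ ∏ i ∈ F, (1 / 2 : ℝ) :=
        Finset.prod_le_prod (fun i _ => norm_nonneg _) fun i _ => hx i
    _ = (1 / 2) ^ F.card := Finset.prod_const _

/-- Replacing factors one at a time gives n terms of size at most D·2^(1-n), and n ≤ 2^(n-1). This
is what the radius 1/2 buys when p = ∞. -/
theorem norm_prod_sub_prod_le_of_le_half {x y : ι → ℂ} (hx : ∀ i, ‖x i‖ ≤ 1 / 2)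
    (hy : ∀ i, ‖y i‖ ≤ 1 / 2) {D : ℝ} (hD : ∀ i, ‖x i - y i‖ ≤ D) (hD0 : 0 ≤ D) (F : Finset ι) :
    ‖∏ i ∈ F, x i - ∏ i ∈ F, y i‖ ≤ D := by
  classical
  refine (norm_prod_sub_prod_le hx hy F).trans ?_
  have h1 : ∑ i ∈ F, ‖x i - y i‖ * ∏ j ∈ F.erase i, (1 / 2 : ℝ) ≤
      ∑ i ∈ F, D * (1 / 2) ^ (F.card - 1) := by
    refine Finset.sum_le_sum fun i hi => ?_
    rw [Finset.prod_const, Finset.card_erase_of_mem hi]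
    gcongr
    exact hD i
  refine h1.trans ?_
  rw [Finset.sum_const, nsmul_eq_mul]
  have h2 : (F.card : ℝ) * (1 / 2) ^ (F.card - 1) ≤ 1 := by
    have : F.card ≤ 2 ^ (F.card - 1) := by
      have h1 := Nat.lt_two_pow_self (n := F.card - 1)
      omega
    have h3 : (F.card : ℝ) ≤ 2 ^ (F.card - 1) := by exact_mod_cast this
    rw [one_div, inv_pow, ← div_eq_mul_inv]
    exact div_le_one_of_le₀ h3 (by positivity)
  nlinarith

end FiniteProducts

/-! ### Nonlinear monomial maps between l^p spaces. -/

section Monomials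

variable {ι : Type*} {p : ℝ≥0∞} [Fact (1 ≤ p)]

/-- The weighted monomials `F ↦ w(|F|) ∏_{i ∈ F} z(i)`. -/
def monom (w : ℕ → ℂ) (z : ι → ℂ) (F : Finset ι) : ℂ := w F.card * ∏ i ∈ F, z i

/-- Weights bounded by `1` and vanishing at even integers. -/
structure IsOddWeight (w : ℕ → ℂ) : Prop where
  norm_le : ∀ k, ‖w k‖ ≤ 1
  eq_zero : ∀ k, ¬ Odd k → w k = 0

open Classical in
/-- The map `z ↦ (w(|F|) ∏_{i ∈ F} z(i))_F` between `l^p` spaces. -/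
def lpMonom (p : ℝ≥0∞) (w : ℕ → ℂ) (z : lp (fun _ : ι => ℂ) p) :
    lp (fun _ : Finset ι => ℂ) p :=
  if h : Memℓp (monom w z) p then ⟨monom w z, h⟩ else 0

/-- The domain of `lpMonom`: the unit ball for `p < ∞`, the ball of radius `1/2` for `p = ∞`. -/
def InDom (z : lp (fun _ : ι => ℂ) p) : Prop := ‖z‖ ≤ 1 ∧ (p = ∞ → ‖z‖ ≤ 1 / 2)

theorem one_le_toReal (hp : p ≠ ∞) : 1 ≤ p.toReal := by
  have := ENNReal.toReal_mono hp (Fact.out : 1 ≤ p)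
  simpa using this

variable {w : ℕ → ℂ}

theorem norm_monom_rpow_le (hw : IsOddWeight w) {r : ℝ} (hr : 1 ≤ r) (z : ι → ℂ) (F : Finset ι) :
    ‖monom w z F‖ ^ r ≤ if Odd F.card then ∏ i ∈ F, ‖z i‖ ^ r else 0 := by
  unfold monom
  split_ifs with h
  · rw [Real.finsetProd_rpow _ _ fun i _ => norm_nonneg _, norm_mul, norm_prod]
    refine Real.rpow_le_rpow (by positivity) ?_ (by linarith)
    exact mul_le_of_le_one_left (Finset.prod_nonneg fun i _ => norm_nonneg _) (hw.norm_le _)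
  · rw [hw.eq_zero _ h, zero_mul, norm_zero, Real.zero_rpow (by linarith)]

theorem sum_norm_monom_rpow_le (hp : p ≠ ∞) (hw : IsOddWeight w) (z : lp (fun _ : ι => ℂ) p)
    (T : Finset (Finset ι)) :
    ∑ F ∈ T, ‖monom w z F‖ ^ p.toReal ≤ Real.sinh (‖z‖ ^ p.toReal) := by
  classical
  have hr := one_le_toReal hp
  -- Finitely many finite sets are all subsets of their union, so powerset sums dominate all partial
  -- sums.
  have hsub : T ⊆ (T.biUnion id).powerset := fun F hF =>
    Finset.mem_powerset.2 (Finset.subset_biUnion_of_mem id hF)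
  refine (Finset.sum_le_sum_of_subset_of_nonneg hsub fun F _ _ => by positivity).trans ?_
  refine (Finset.sum_le_sum fun F _ => norm_monom_rpow_le hw hr z F).trans ?_
  refine (sum_powerset_odd_le_sinh_and_even_le_cosh (fun i => by positivity) _).1.trans ?_
  exact Real.sinh_le_sinh.2 (lp.sum_rpow_le_norm_rpow (by linarith) z _)

theorem sum_norm_monom_rpow_le_sub (hp : p ≠ ∞) (hw : IsOddWeight w) (hw1 : w 1 = 0)
    (z : lp (fun _ : ι => ℂ) p) (T : Finset (Finset ι)) :
    ∑ F ∈ T, ‖monom w z F‖ ^ p.toReal ≤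
      Real.sinh (‖z‖ ^ p.toReal) - ‖z‖ ^ p.toReal := by
  classical
  have hr := one_le_toReal hp
  have hsub : T ⊆ (T.biUnion id).powerset := fun F hF =>
    Finset.mem_powerset.2 (Finset.subset_biUnion_of_mem id hF)
  refine (Finset.sum_le_sum_of_subset_of_nonneg hsub fun F _ _ => by positivity).trans ?_
  have h (F : Finset ι) : ‖monom w z F‖ ^ p.toReal ≤
      if Odd F.card ∧ F.card ≠ 1 then ∏ i ∈ F, ‖z i‖ ^ p.toReal else 0 := by
    by_cases h1 : F.card = 1
    · simp [monom, h1, hw1, Real.zero_rpow (show p.toReal ≠ 0 by linarith)]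
    · simpa [h1] using norm_monom_rpow_le hw hr z F
  refine (Finset.sum_le_sum fun F _ => h F).trans ?_
  refine (sum_powerset_odd_ne_one_le (fun i => by positivity) _).trans ?_
  exact Real.sinh_sub_id_strictMono.monotone (lp.sum_rpow_le_norm_rpow (by linarith) z _)

theorem norm_apply_le (z : lp (fun _ : ι => ℂ) p) (i : ι) : ‖z i‖ ≤ ‖z‖ :=
  lp.norm_apply_le_norm (zero_lt_one.trans_le (Fact.out : 1 ≤ p)).ne' z i

theorem norm_monom_le_half (hw : IsOddWeight w) {z : ι → ℂ} (hz : ∀ i, ‖z i‖ ≤ 1 / 2)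
    (F : Finset ι) : ‖monom w z F‖ ≤ 1 / 2 := by
  unfold monom
  by_cases h : Odd F.card
  · rw [norm_mul]
    have h1 := norm_prod_le_half_pow hz F
    have h2 : (1 / 2 : ℝ) ^ F.card ≤ (1 / 2) ^ 1 :=
      pow_le_pow_of_le_one (by norm_num) (by norm_num) h.pos
    have := mul_le_mul (hw.norm_le F.card) (h1.trans h2) (norm_nonneg _) zero_le_one
    linarith
  · simp [hw.eq_zero _ h]

/-- Only sets with at least three elements survive: one factor is bounded by C, and the product of
the others by 1/2. -/
theorem norm_monom_le_half_mul (hw : IsOddWeight w) (hw1 : w 1 = 0) {z : ι → ℂ}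
    (hz : ∀ i, ‖z i‖ ≤ 1 / 2) {C : ℝ} (hC : ∀ i, ‖z i‖ ≤ C) (hC0 : 0 ≤ C) (F : Finset ι) :
    ‖monom w z F‖ ≤ 1 / 2 * C := by
  classical
  unfold monom
  by_cases h : Odd F.card ∧ F.card ≠ 1
  · obtain ⟨i, hi⟩ := Finset.card_pos.1 h.1.pos
    rw [norm_mul, ← Finset.mul_prod_erase F _ hi, norm_mul]
    have h1 := norm_prod_le_half_pow hz (F.erase i)
    have hc : 1 ≤ (F.erase i).card := by
      rw [Finset.card_erase_of_mem hi]
      have := h.1.pos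
      omega
    have h2 : (1 / 2 : ℝ) ^ (F.erase i).card ≤ (1 / 2) ^ 1 :=
      pow_le_pow_of_le_one (by norm_num) (by norm_num) hc
    have h3 := mul_le_mul (hC i) (h1.trans h2) (norm_nonneg _) hC0
    have := mul_le_mul (hw.norm_le F.card) h3 (by positivity) zero_le_one
    linarith
  · have : w F.card = 0 := by
      by_cases h1 : F.card = 1
      · rw [h1, hw1]
      · exact hw.eq_zero _ fun h2 => h ⟨h2, h1⟩
    rw [this, zero_mul, norm_zero]
    positivity

theorem memℓp_monom (hw : IsOddWeight w) {z : lp (fun _ : ι => ℂ) p} (hz : InDom z) :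
    Memℓp (monom w z) p := by
  by_cases hp : p = ∞
  · subst hp
    refine memℓp_infty ⟨1 / 2, ?_⟩
    rintro _ ⟨F, rfl⟩
    exact norm_monom_le_half hw (fun i => (norm_apply_le z i).trans (hz.2 rfl)) F
  · exact memℓp_gen' (sum_norm_monom_rpow_le hp hw z)

theorem lpMonom_apply (hw : IsOddWeight w) {z : lp (fun _ : ι => ℂ) p} (hz : InDom z)
    (F : Finset ι) : lpMonom p w z F = monom w z F := by
  rw [lpMonom, dif_pos (memℓp_monom hw hz)]

theorem norm_lpMonom_rpow_le (hp : p ≠ ∞) (hw : IsOddWeight w) {z : lp (fun _ : ι => ℂ) p}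
    (hz : InDom z) : ‖lpMonom p w z‖ ^ p.toReal ≤ Real.sinh (‖z‖ ^ p.toReal) := by
  have hr := one_le_toReal hp
  rw [lp.norm_rpow_eq_tsum (by linarith)]
  refine (lp.memℓp (lpMonom p w z)).summable (by linarith) |>.tsum_le_of_sum_le fun T => ?_
  simp only [lpMonom_apply hw hz]
  exact sum_norm_monom_rpow_le hp hw z T

theorem norm_lpMonom_rpow_le_sub (hp : p ≠ ∞) (hw : IsOddWeight w) (hw1 : w 1 = 0)
    {z : lp (fun _ : ι => ℂ) p} (hz : InDom z) :
    ‖lpMonom p w z‖ ^ p.toReal ≤ Real.sinh (‖z‖ ^ p.toReal) - ‖z‖ ^ p.toReal := by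
  have hr := one_le_toReal hp
  rw [lp.norm_rpow_eq_tsum (by linarith)]
  refine (lp.memℓp (lpMonom p w z)).summable (by linarith) |>.tsum_le_of_sum_le fun T => ?_
  simp only [lpMonom_apply hw hz]
  exact sum_norm_monom_rpow_le_sub hp hw hw1 z T

theorem norm_lpMonom_le_half_mul (hw : IsOddWeight w) (hw1 : w 1 = 0)
    {z : lp (fun _ : ι => ℂ) p} (hz : ‖z‖ ≤ 1 / 2) : ‖lpMonom p w z‖ ≤ 1 / 2 * ‖z‖ := by
  have hD : InDom z := ⟨by linarith, fun _ => hz⟩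
  by_cases hp : p = ∞
  · subst hp
    refine lp.norm_le_of_forall_le (by positivity) fun F => ?_
    rw [lpMonom_apply hw hD]
    exact norm_monom_le_half_mul hw hw1 (fun i => (norm_apply_le z i).trans hz)
      (norm_apply_le z) (norm_nonneg _) F
  · have hr := one_le_toReal hp
    have h := norm_lpMonom_rpow_le_sub hp hw hw1 hD
    rw [← Real.rpow_le_rpow_iff (norm_nonneg _) (by positivity) (show 0 < p.toReal by linarith),
      Real.mul_rpow (by norm_num) (norm_nonneg _)]
    set t := ‖z‖ ^ p.toReal with ht
    have ht0 : 0 ≤ t := by positivity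
    have ht1 : t ≤ (1 / 2) ^ p.toReal := Real.rpow_le_rpow (norm_nonneg _) hz (by linarith)
    have ht2 : t ≤ 1 := ht1.trans (Real.rpow_le_one (by norm_num) (by norm_num) (by linarith))
    have e1 := Real.abs_exp_sub_one_sub_id_le (x := t) (by rwa [abs_of_nonneg ht0])
    have e2 := Real.abs_exp_sub_one_sub_id_le (x := -t) (by rwa [abs_neg, abs_of_nonneg ht0])
    -- The quadratic Taylor errors of exp at t and -t give t². Then t ≤ 2^(-p) trades one factor t
    -- for 2^(-p), which is the contraction by 1/2 after p-th roots.
    have e3 : Real.sinh t - t ≤ t ^ 2 := by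
      rw [Real.sinh_eq]
      have := (abs_le.1 e1).2
      have := (abs_le.1 e2).1
      nlinarith
    nlinarith [mul_le_mul_of_nonneg_right ht1 ht0]

theorem norm_monom_sub_le (hw : IsOddWeight w) (x y : ι → ℂ) (F : Finset ι) :
    ‖monom w x F - monom w y F‖ ≤ ‖∏ i ∈ F, x i - ∏ i ∈ F, y i‖ := by
  unfold monom
  rw [← mul_sub, norm_mul]
  exact mul_le_of_le_one_left (norm_nonneg _) (hw.norm_le _)

/-- A single Lipschitz constant serves the whole domain. The norm continuity of the Walsh transforms
rests on this bound. -/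
theorem exists_norm_lpMonom_sub_le (hw : IsOddWeight w) : ∃ L : ℝ, 0 ≤ L ∧
    ∀ x y : lp (fun _ : ι => ℂ) p, InDom x → InDom y →
      ‖lpMonom p w x - lpMonom p w y‖ ≤ L * ‖x - y‖ := by
  classical
  by_cases hp : p = ∞
  · subst hp
    refine ⟨1, zero_le_one, fun x y hx hy => ?_⟩
    rw [one_mul]
    refine lp.norm_le_of_forall_le (norm_nonneg _) fun F => ?_
    rw [lp.coeFn_sub, Pi.sub_apply, lpMonom_apply hw hx, lpMonom_apply hw hy]
    exact (norm_monom_sub_le hw x y F).trans (norm_prod_sub_prod_le_of_le_half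
      (fun i => (norm_apply_le x i).trans (hx.2 rfl)) (fun i => (norm_apply_le y i).trans (hy.2 rfl))
      (fun i => norm_apply_le (x - y) i) (norm_nonneg _) F)
  · have hr := one_le_toReal hp
    have hr0 : 0 < p.toReal := by linarith
    set K := Real.exp (2 ^ (p.toReal - 1) * (1 + 1)) with hK
    refine ⟨K ^ (1 / p.toReal), by positivity, fun x y hx hy => ?_⟩
    refine lp.norm_le_of_forall_sum_le hr0 (by positivity) fun T => ?_
    rw [Real.mul_rpow (by positivity) (norm_nonneg _), ← Real.rpow_mul (Real.exp_nonneg _),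
      one_div_mul_cancel hr0.ne', Real.rpow_one]
    have hsub : T ⊆ (T.biUnion id).powerset := fun F hF =>
      Finset.mem_powerset.2 (Finset.subset_biUnion_of_mem id hF)
    have hone {z : lp (fun _ : ι => ℂ) p} (hz : InDom z) (S : Finset ι) :
        ∑ i ∈ S, ‖z i‖ ^ p.toReal ≤ 1 :=
      (lp.sum_rpow_le_norm_rpow hr0 z S).trans (Real.rpow_le_one (norm_nonneg _) hz.1 hr0.le)
    calc ∑ F ∈ T, ‖(lpMonom p w x - lpMonom p w y) F‖ ^ p.toReal
        ≤ ∑ F ∈ T, ‖∏ i ∈ F, x i - ∏ i ∈ F, y i‖ ^ p.toReal := by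
          refine Finset.sum_le_sum fun F _ => ?_
          rw [lp.coeFn_sub, Pi.sub_apply, lpMonom_apply hw hx, lpMonom_apply hw hy]
          exact Real.rpow_le_rpow (norm_nonneg _) (norm_monom_sub_le hw x y F) hr0.le
      _ ≤ ∑ F ∈ (T.biUnion id).powerset, ‖∏ i ∈ F, x i - ∏ i ∈ F, y i‖ ^ p.toReal :=
          Finset.sum_le_sum_of_subset_of_nonneg hsub fun F _ _ => by positivity
      _ ≤ _ := sum_powerset_rpow_norm_prod_sub_prod_le hr x y _
      _ ≤ ‖x - y‖ ^ p.toReal * K := by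
          refine mul_le_mul (lp.sum_rpow_le_norm_rpow hr0 (x - y) _) ?_ (Real.exp_nonneg _)
            (by positivity)
          refine Real.exp_le_exp.2 (mul_le_mul_of_nonneg_left ?_ (by positivity))
          exact add_le_add (hone hx _) (hone hy _)
      _ = _ := mul_comm _ _

theorem continuousOn_lpMonom (hw : IsOddWeight w) :
    ContinuousOn (lpMonom (ι := ι) p w) {z | InDom z} := by
  obtain ⟨L, hL0, hL⟩ := exists_norm_lpMonom_sub_le (ι := ι) (p := p) hw
  have : LipschitzOnWith ⟨L, hL0⟩ (lpMonom (ι := ι) p w) {z | InDom z} :=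
    LipschitzOnWith.of_dist_le_mul fun x hx y hy => by
      rw [dist_eq_norm, dist_eq_norm]
      exact hL x y hx hy
  exact this.continuousOn

theorem InDom.neg {z : lp (fun _ : ι => ℂ) p} (hz : InDom z) : InDom (-z) := by
  rwa [InDom, norm_neg]

theorem monom_neg (hw : IsOddWeight w) (z : ι → ℂ) (F : Finset ι) :
    monom w (-z) F = -monom w z F := by
  unfold monom
  by_cases h : Odd F.card
  · simp [Finset.prod_neg, h.neg_one_pow]
  · simp [hw.eq_zero _ h]

theorem lpMonom_neg (hw : IsOddWeight w) {z : lp (fun _ : ι => ℂ) p} (hz : InDom z) :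
    lpMonom p w (-z) = -lpMonom p w z := by
  ext F
  rw [lp.coeFn_neg, Pi.neg_apply, lpMonom_apply hw hz, lpMonom_apply hw hz.neg, lp.coeFn_neg,
    monom_neg hw]

end Monomials

/-! ### Isometric extension by zero. -/

section Extension

variable {ι κ : Type*} {p : ℝ≥0∞} [Fact (1 ≤ p)]

theorem extend_zero_eq_zero_or (e : ι ↪ κ) (f : ι → ℂ) (k : κ) :
    (∃ i, e i = k) ∧ (∀ i, e i = k → Function.extend e f (0 : κ → ℂ) k = f i) ∨
      Function.extend e f (0 : κ → ℂ) k = 0 := by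
  by_cases h : ∃ i, e i = k
  · refine Or.inl ⟨h, ?_⟩
    rintro i rfl
    exact e.injective.extend_apply f 0 i
  · exact Or.inr (Function.extend_apply' f _ k h)

theorem hasSum_comp_extend (e : ι ↪ κ) (f : ι → ℂ) {g : κ → ℂ → ℝ} (hg : ∀ k, g k 0 = 0) {s : ℝ}
    (h : HasSum (fun i => g (e i) (f i)) s) : HasSum (fun k => g k (Function.extend e f (0 : κ → ℂ) k)) s := by
  rw [← e.injective.hasSum_iff]
  · convert h using 2 with i
    simp [e.injective.extend_apply]
  · intro k hk
    rw [Function.extend_apply' f _ k hk]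
    exact hg k

theorem memℓp_extend (e : ι ↪ κ) {f : ι → ℂ} (hf : Memℓp f p) :
    Memℓp (Function.extend e f (0 : κ → ℂ)) p := by
  by_cases hp : p = ∞
  · subst hp
    obtain ⟨C, hC⟩ := hf.bddAbove
    refine memℓp_infty ⟨max C 0, ?_⟩
    rintro _ ⟨k, rfl⟩
    rcases extend_zero_eq_zero_or e f k with ⟨⟨i, hi⟩, h⟩ | h
    · simp only [h i hi]
      exact (hC ⟨i, rfl⟩).trans (le_max_left _ _)
    · simp [h]
  · have hr := one_le_toReal hp
    refine memℓp_gen ?_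
    have := (hf.summable (by linarith)).hasSum
    exact (hasSum_comp_extend e f (g := fun _ a => ‖a‖ ^ p.toReal)
      (fun _ => by simp [Real.zero_rpow (show p.toReal ≠ 0 by linarith)]) this).summable

/-- Extension by zero of a sequence along an embedding of index sets. -/
def lpExt (e : ι ↪ κ) : lp (fun _ : ι => ℂ) p →ₗᵢ[ℂ] lp (fun _ : κ => ℂ) p where
  toFun f := ⟨Function.extend e f (0 : κ → ℂ), memℓp_extend e (lp.memℓp f)⟩
  map_add' f g := by
    ext k
    simp only [lp.coeFn_add, Pi.add_apply]
    by_cases h : ∃ i, e i = k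
    · obtain ⟨i, rfl⟩ := h
      simp [e.injective.extend_apply]
    · simp [Function.extend_apply' _ _ k h]
  map_smul' c f := by
    ext k
    simp only [lp.coeFn_smul, Pi.smul_apply, RingHom.id_apply]
    by_cases h : ∃ i, e i = k
    · obtain ⟨i, rfl⟩ := h
      simp [e.injective.extend_apply]
    · simp [Function.extend_apply' _ _ k h]
  norm_map' f := by
    by_cases hp : p = ∞
    · subst hp
      apply le_antisymm
      · refine lp.norm_le_of_forall_le (norm_nonneg _) fun k => ?_
        change ‖Function.extend e f (0 : κ → ℂ) k‖ ≤ _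
        rcases extend_zero_eq_zero_or e f k with ⟨⟨i, hi⟩, h⟩ | h
        · rw [h i hi]
          exact norm_apply_le f i
        · simp [h]
      · refine lp.norm_le_of_forall_le (norm_nonneg _) fun i => ?_
        have := norm_apply_le (⟨Function.extend e f (0 : κ → ℂ), memℓp_extend e (lp.memℓp f)⟩ :
          lp (fun _ : κ => ℂ) ∞) (e i)
        rwa [show (⟨Function.extend e f (0 : κ → ℂ), memℓp_extend e (lp.memℓp f)⟩ :
          lp (fun _ : κ => ℂ) ∞) (e i) = f i from e.injective.extend_apply f 0 i] at this
    · have hr := one_le_toReal hp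
      rw [lp.norm_eq_tsum_rpow (by linarith), lp.norm_eq_tsum_rpow (by linarith)]
      congr 1
      have := ((lp.memℓp f).summable (by linarith)).hasSum
      exact (hasSum_comp_extend e f (g := fun _ a => ‖a‖ ^ p.toReal)
        (fun _ => by simp [Real.zero_rpow (show p.toReal ≠ 0 by linarith)]) this).tsum_eq

@[simp]
theorem lpExt_apply (e : ι ↪ κ) (f : lp (fun _ : ι => ℂ) p) (i : ι) : lpExt e f (e i) = f i :=
  e.injective.extend_apply f 0 i

theorem lpExt_apply_of_notMem (e : ι ↪ κ) (f : lp (fun _ : ι => ℂ) p) {k : κ}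
    (hk : ¬ ∃ i, e i = k) : lpExt e f k = 0 :=
  Function.extend_apply' f _ k hk

theorem tsum_lpExt_mul (e : ι ↪ κ) (f : lp (fun _ : ι => ℂ) p) (m : κ → ℂ) :
    ∑' k, lpExt e f k * m k = ∑' i, f i * m (e i) := by
  have : Function.support (fun k => lpExt e f k * m k) ⊆ Set.range e := by
    intro k hk
    by_contra h
    exact hk (by simp [lpExt_apply_of_notMem e f h])
  rw [← e.injective.tsum_eq this]
  simp

end Extension

/-! ### Weights depending on the size of a finite set. -/

section Weights

/-- The coefficients `Im (i ^ k)`. -/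
def imWeight (k : ℕ) : ℂ := ((Complex.I ^ k).im : ℝ)

/-- The indicator of the odd integers. -/
def oddWeight (k : ℕ) : ℂ := if Odd k then 1 else 0

/-- The indicator of the odd integers other than `1`. -/
def oddWeight' (k : ℕ) : ℂ := if Odd k ∧ k ≠ 1 then 1 else 0

/-- The coefficients `-Im (i ^ k)` for `k ≠ 1`. -/
def imWeight' (k : ℕ) : ℂ := if k = 1 then 0 else -imWeight k

theorem imWeight_of_not_odd {k : ℕ} (hk : ¬ Odd k) : imWeight k = 0 := by
  obtain ⟨m, rfl⟩ := (Nat.not_odd_iff_even.1 hk).two_dvd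
  rw [imWeight, pow_mul, Complex.I_sq]
  rcases neg_one_pow_eq_or ℂ m with h | h <;> simp [h]

theorem imWeight_sq {k : ℕ} (hk : Odd k) : imWeight k * imWeight k = 1 := by
  obtain ⟨m, rfl⟩ := hk
  rw [imWeight, pow_succ, pow_mul, Complex.I_sq]
  rcases neg_one_pow_eq_or ℂ m with h | h <;> simp [h]

theorem imWeight_one : imWeight 1 = 1 := by simp [imWeight]

theorem norm_imWeight_le (k : ℕ) : ‖imWeight k‖ ≤ 1 := by
  rw [imWeight, Complex.norm_real, Real.norm_eq_abs]
  exact (Complex.abs_im_le_norm _).trans (by simp)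

theorem isOddWeight_imWeight : IsOddWeight imWeight :=
  ⟨norm_imWeight_le, fun _ => imWeight_of_not_odd⟩

theorem isOddWeight_oddWeight : IsOddWeight oddWeight where
  norm_le k := by unfold oddWeight; split_ifs <;> simp
  eq_zero k hk := by simp [oddWeight, hk]

theorem isOddWeight_oddWeight' : IsOddWeight oddWeight' where
  norm_le k := by unfold oddWeight'; split_ifs <;> simp
  eq_zero k hk := by simp [oddWeight', hk]

theorem isOddWeight_imWeight' : IsOddWeight imWeight' where
  norm_le k := by
    unfold imWeight'
    split_ifs
    · simp
    · simpa using norm_imWeight_le k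
  eq_zero k hk := by simp [imWeight', imWeight_of_not_odd hk]

theorem im_oddWeight' (k : ℕ) : (oddWeight' k).im = 0 := by
  unfold oddWeight'; split_ifs <;> simp

theorem im_imWeight (k : ℕ) : (imWeight k).im = 0 := Complex.ofReal_im _

theorem im_imWeight' (k : ℕ) : (imWeight' k).im = 0 := by
  unfold imWeight'; split_ifs <;> simp [im_imWeight]

end Weights

/-! ### The constants δ and ρ = δ^(2/p). -/

section Constants

theorem sinh_one_bounds : 1 < Real.sinh 1 ∧ Real.sinh 1 < 6 / 5 := by
  refine ⟨Real.self_lt_sinh_iff.2 one_pos, ?_⟩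
  rw [Real.sinh_eq]
  have := Real.exp_one_lt_d9
  have := Real.exp_neg_one_gt_d9
  linarith

theorem delta_sq : delta ^ 2 = Real.sinh 1 - 1 := by
  rw [delta, Real.sq_sqrt]
  linarith [sinh_one_bounds.1]

theorem delta_pos : 0 < delta := Real.sqrt_pos.2 (by linarith [sinh_one_bounds.1])

theorem delta_lt_one : delta < 1 := by
  have h := delta_sq
  have := sinh_one_bounds.2
  have := delta_pos
  nlinarith

/-- Because of this inequality √e bounds the l^p-norm of a layer as well as its sup norm. -/
theorem sinh_one_le_sqrt_exp : Real.sinh 1 ≤ Real.sqrt (Real.exp 1) := by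
  refine Real.le_sqrt_of_sq_le ?_
  have := Real.exp_one_gt_d9
  nlinarith [sinh_one_bounds.1, sinh_one_bounds.2]

/-- The ratio `δ ^ (2 / p)`. -/
def ratio (p : ℝ≥0∞) : ℝ := delta ^ (2 / p).toReal

theorem ratio_pos (p : ℝ≥0∞) : 0 < ratio p := Real.rpow_pos_of_pos delta_pos _

variable {p : ℝ≥0∞} [Fact (1 ≤ p)]

theorem toReal_two_div (p : ℝ≥0∞) : (2 / p).toReal = 2 / p.toReal := by
  rw [ENNReal.toReal_div]; rfl

theorem ratio_lt_one (hp : p ≠ ∞) : ratio p < 1 := by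
  have := one_le_toReal hp
  refine Real.rpow_lt_one delta_pos.le delta_lt_one ?_
  rw [toReal_two_div]
  positivity

/-- This equation dictates the exponent 2/p: the p-th power of the ratio is the bound for the
l^p-mass of the nonlinear part, so dividing by the ratio returns to the unit ball. -/
theorem ratio_rpow (hp : p ≠ ∞) : ratio p ^ p.toReal = Real.sinh 1 - 1 := by
  have := one_le_toReal hp
  rw [ratio, ← Real.rpow_mul delta_pos.le, toReal_two_div, div_mul_cancel₀ _ (by linarith),
    ← delta_sq]
  exact Real.rpow_natCast delta 2

end Constants

/-! ### One step of the iteration and its iterates. -/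

section Layers

variable {ι : Type*} {p : ℝ≥0∞} [Fact (1 ≤ p)]

/-- Reality of a sequence of complex numbers. -/
def IsRealSeq (z : ι → ℂ) : Prop := ∀ i, (z i).im = 0

theorem monom_im {w : ℕ → ℂ} (hw : ∀ k, (w k).im = 0) {z : ι → ℂ} (hz : IsRealSeq z)
    (F : Finset ι) : (monom w z F).im = 0 := by
  have h (i : ι) : z i = ((z i).re : ℂ) := Complex.ext rfl (by simp [hz i])
  have hwF : w F.card = ((w F.card).re : ℂ) := Complex.ext rfl (by simp [hw])
  rw [monom, hwF, Finset.prod_congr rfl fun i _ => h i, ← Complex.ofReal_prod, ← Complex.ofReal_mul]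
  exact Complex.ofReal_im _

/-- The map `z ↦ (a · w(|F|) ∏_{i ∈ F} b z(i))_F`, transported to the index set of `z`. -/
def layer (p : ℝ≥0∞) [Fact (1 ≤ p)] (e : Finset ι ↪ ι) (w : ℕ → ℂ) (a b : ℝ)
    (z : lp (fun _ : ι => ℂ) p) : lp (fun _ : ι => ℂ) p :=
  (a : ℂ) • lpExt e (lpMonom p w ((b : ℂ) • z))

theorem layer_apply {e : Finset ι ↪ ι} {w : ℕ → ℂ} {a b : ℝ} (hw : IsOddWeight w)
    {z : lp (fun _ : ι => ℂ) p} (hD : InDom ((b : ℂ) • z)) (F : Finset ι) :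
    layer p e w a b z (e F) = a * (w F.card * ∏ i ∈ F, (b : ℂ) * z i) := by
  rw [layer, lp.coeFn_smul, Pi.smul_apply, lpExt_apply, lpMonom_apply hw hD, smul_eq_mul, monom]
  rfl

theorem layer_apply_of_notMem {e : Finset ι ↪ ι} {w : ℕ → ℂ} {a b : ℝ}
    (z : lp (fun _ : ι => ℂ) p) {i : ι} (h : ¬ ∃ F, e F = i) : layer p e w a b z i = 0 := by
  rw [layer, lp.coeFn_smul, Pi.smul_apply, lpExt_apply_of_notMem e _ h, smul_zero]

/-- The properties of a transformation of the unit ball which is iterated. -/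
structure IsStep (T : lp (fun _ : ι => ℂ) p → lp (fun _ : ι => ℂ) p) : Prop where
  norm_le : ∀ z, ‖z‖ ≤ 1 → ‖T z‖ ≤ 1
  continuousOn : ContinuousOn T {z | ‖z‖ ≤ 1}
  neg : ∀ z, ‖z‖ ≤ 1 → T (-z) = -T z
  real : ∀ z : lp (fun _ : ι => ℂ) p, ‖z‖ ≤ 1 → IsRealSeq z → IsRealSeq (T z)
  apply : ∀ i, (∀ z, T z i = 0) ∨ ∃ (c b : ℂ) (F : Finset ι), ∀ z, ‖z‖ ≤ 1 →
    T z i = c * ∏ j ∈ F, b * z j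

theorem isStep_layer {e : Finset ι ↪ ι} {w : ℕ → ℂ} {a b : ℝ} (hw : IsOddWeight w)
    (hw' : ∀ k, (w k).im = 0)
    (hD : ∀ z : lp (fun _ : ι => ℂ) p, ‖z‖ ≤ 1 → InDom ((b : ℂ) • z))
    (hT : ∀ z, ‖z‖ ≤ 1 → ‖layer p e w a b z‖ ≤ 1) : IsStep (layer p e w a b) where
  norm_le := hT
  continuousOn := by
    refine ContinuousOn.const_smul ?_ (a : ℂ)
    refine (lpExt (p := p) e).continuous.comp_continuousOn ?_
    exact (continuousOn_lpMonom hw).comp (continuous_const_smul (b : ℂ)).continuousOn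
      fun z hz => hD z hz
  neg z hz := by
    simp only [layer, smul_neg, lpMonom_neg hw (hD z hz), map_neg]
  real z hz hr i := by
    by_cases h : ∃ F, e F = i
    · obtain ⟨F, rfl⟩ := h
      have := monom_im hw' (z := fun i => (b : ℂ) * z i) (fun i => by simp [hr i]) F
      rw [layer_apply hw (hD z hz), Complex.im_ofReal_mul]
      exact mul_eq_zero_of_right _ this
    · rw [layer_apply_of_notMem z h, Complex.zero_im]
  apply i := by
    by_cases h : ∃ F, e F = i
    · obtain ⟨F, rfl⟩ := h
      refine Or.inr ⟨a * w F.card, b, F, fun z hz => ?_⟩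
      rw [layer_apply hw (hD z hz), mul_assoc]
    · exact Or.inl fun z => layer_apply_of_notMem z h

omit [Fact (1 ≤ p)] in
theorem inDom_of_ne_top (hp : p ≠ ∞) {z : lp (fun _ : ι => ℂ) p} (hz : ‖z‖ ≤ 1) : InDom z :=
  ⟨hz, fun h => absurd h hp⟩

theorem norm_layer_le_one (hp : p ≠ ∞) (e : Finset ι ↪ ι) {z : lp (fun _ : ι => ℂ) p}
    (hz : ‖z‖ ≤ 1) : ‖layer p e oddWeight' (ratio p)⁻¹ 1 z‖ ≤ 1 := by
  have hr := one_le_toReal hp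
  have h := norm_lpMonom_rpow_le_sub hp isOddWeight_oddWeight' (by simp [oddWeight'])
    (inDom_of_ne_top hp hz)
  have h1 : ‖z‖ ^ p.toReal ≤ 1 := Real.rpow_le_one (norm_nonneg _) hz (by linarith)
  have h2 := h.trans (Real.sinh_sub_id_strictMono.monotone h1)
  rw [← ratio_rpow hp, Real.rpow_le_rpow_iff (norm_nonneg _) (ratio_pos p).le (by linarith)] at h2
  rw [layer, Complex.ofReal_one, one_smul, norm_smul, LinearIsometry.norm_map, Complex.norm_real,
    Real.norm_eq_abs, abs_of_pos (inv_pos.2 (ratio_pos p)), inv_mul_le_one₀ (ratio_pos p)]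
  exact h2

theorem isStep_layer_odd (hp : p ≠ ∞) (e : Finset ι ↪ ι) :
    IsStep (layer p e oddWeight' (ratio p)⁻¹ 1) :=
  isStep_layer isOddWeight_oddWeight' im_oddWeight'
    (fun z hz => by simpa using inDom_of_ne_top hp hz) fun _ hz => norm_layer_le_one hp e hz

theorem norm_half_smul_le {z : lp (fun _ : ι => ℂ) p} {C : ℝ} (hz : ‖z‖ ≤ C) :
    ‖((1 / 2 : ℝ) : ℂ) • z‖ ≤ 1 / 2 * C := by
  rw [norm_smul, Complex.norm_real, Real.norm_eq_abs, abs_of_pos (by norm_num)]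
  linarith

theorem norm_layer_le_half_mul (e : Finset ι ↪ ι) {z : lp (fun _ : ι => ℂ) p} (hz : ‖z‖ ≤ 1) :
    ‖layer p e imWeight' 2 (1 / 2) z‖ ≤ 1 / 2 * ‖z‖ := by
  have h := norm_lpMonom_le_half_mul isOddWeight_imWeight' (by simp [imWeight'])
    (z := ((1 / 2 : ℝ) : ℂ) • z) (by simpa using norm_half_smul_le hz)
  have h2 := norm_half_smul_le (le_refl ‖z‖)
  rw [layer, norm_smul, LinearIsometry.norm_map, Complex.norm_real]
  norm_num at h h2 ⊢
  linarith

theorem isStep_layer_im (e : Finset ι ↪ ι) :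
    IsStep (layer p e imWeight' 2 (1 / 2)) :=
  isStep_layer isOddWeight_imWeight' im_imWeight'
    (fun z hz => ⟨(norm_half_smul_le hz).trans (by norm_num), fun _ =>
      (norm_half_smul_le hz).trans (by norm_num)⟩) fun z hz =>
      (norm_layer_le_half_mul e hz).trans (by linarith)

variable {T : lp (fun _ : ι => ℂ) p → lp (fun _ : ι => ℂ) p}

namespace IsStep

theorem iterate_norm_le (hT : IsStep T) {z : lp (fun _ : ι => ℂ) p} (hz : ‖z‖ ≤ 1) (j : ℕ) :
    ‖T^[j] z‖ ≤ 1 := by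
  induction j with
  | zero => exact hz
  | succ j ih => rw [Function.iterate_succ_apply']; exact hT.norm_le _ ih

theorem iterate_real (hT : IsStep T) {z : lp (fun _ : ι => ℂ) p} (hz : ‖z‖ ≤ 1)
    (hr : IsRealSeq z) (j : ℕ) : IsRealSeq (T^[j] z) := by
  induction j with
  | zero => exact hr
  | succ j ih =>
    rw [Function.iterate_succ_apply']
    exact hT.real _ (hT.iterate_norm_le hz j) ih

theorem iterate_neg (hT : IsStep T) {z : lp (fun _ : ι => ℂ) p} (hz : ‖z‖ ≤ 1) (j : ℕ) :
    T^[j] (-z) = -T^[j] z := by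
  induction j with
  | zero => rfl
  | succ j ih =>
    rw [Function.iterate_succ_apply', Function.iterate_succ_apply', ih,
      hT.neg _ (hT.iterate_norm_le hz j)]

theorem iterate_continuousOn (hT : IsStep T) (j : ℕ) : ContinuousOn T^[j] {z | ‖z‖ ≤ 1} :=
  hT.continuousOn.iterate (fun z hz => hT.norm_le z hz) j

/-- Each coordinate of an iterate is zero or a monomial in finitely many coordinates of the previous
one, so coordinatewise continuity is inherited without any norm continuity. This is what makes the
weak topology tractable. -/
theorem continuous_iterate_apply (hT : IsStep T) {X : Type*} [TopologicalSpace X]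
    {u : X → lp (fun _ : ι => ℂ) p} (hu : ∀ ξ, ‖u ξ‖ ≤ 1) (hc : ∀ i, Continuous fun ξ => u ξ i)
    (j : ℕ) (i : ι) : Continuous fun ξ => T^[j] (u ξ) i := by
  induction j generalizing i with
  | zero => exact hc i
  | succ j ih =>
    simp only [Function.iterate_succ_apply']
    rcases hT.apply i with h | ⟨c, b, F, h⟩
    · simpa only [h] using continuous_const
    · simp only [h _ (hT.iterate_norm_le (hu _) j)]
      exact continuous_const.mul (continuous_finsetProd _ fun k _ => continuous_const.mul (ih k))

end IsStep

end Layers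

/-! ### Re-indexing by an infinite set. -/

section Embeddings

variable (A : Type*) [Infinite A]

theorem nonempty_finset_equiv : Nonempty (Finset A ≃ A) :=
  Cardinal.eq.1 (Cardinal.mk_finset_of_infinite A)

theorem nonempty_nat_prod_equiv : Nonempty (ℕ × A ≃ A) := by
  refine Cardinal.eq.1 ?_
  rw [Cardinal.mk_prod, Cardinal.mk_nat, Cardinal.lift_aleph0, Cardinal.lift_uzero]
  exact Cardinal.aleph0_mul_eq (Cardinal.aleph0_le_mk A)

/-- An embedding of the finite subsets of an infinite set into the set. -/
def finsetEmb : Finset A ↪ A := (Classical.choice (nonempty_finset_equiv A)).toEmbedding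

variable {A} in
/-- Embeddings of an infinite set into itself with disjoint ranges. -/
def layerEmb (j : ℕ) : A ↪ A :=
  ⟨fun α => Classical.choice (nonempty_nat_prod_equiv A) (j, α), fun α β h => by simpa using h⟩

variable {A}

theorem layerEmb_eq_iff {j k : ℕ} {α β : A} : layerEmb j α = layerEmb k β ↔ j = k ∧ α = β := by
  change Classical.choice (nonempty_nat_prod_equiv A) (j, α) =
    Classical.choice (nonempty_nat_prod_equiv A) (k, β) ↔ _
  rw [EmbeddingLike.apply_eq_iff_eq, Prod.mk.injEq]

theorem map_layerEmb_eq {j k : ℕ} (hjk : j ≠ k) {F G : Finset A}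
    (h : F.map (layerEmb j) = G.map (layerEmb k)) : F = ∅ := by
  refine Finset.eq_empty_of_forall_notMem fun α hα => ?_
  have h1 : layerEmb j α ∈ G.map (layerEmb k) := h ▸ Finset.mem_map_of_mem _ hα
  obtain ⟨β, _, hβ⟩ := Finset.mem_map.1 h1
  exact hjk (layerEmb_eq_iff.1 hβ).1.symm

end Embeddings

/-! ### Real and imaginary parts of sequences. -/

section ComplexParts

variable {ι : Type*} {p : ℝ≥0∞} [Fact (1 ≤ p)]

/-- The coordinatewise real part. -/
def reSeq (x : lp (fun _ : ι => ℂ) p) : lp (fun _ : ι => ℂ) p := (1 / 2 : ℂ) • (x + star x)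

/-- The coordinatewise imaginary part. -/
def imSeq (x : lp (fun _ : ι => ℂ) p) : lp (fun _ : ι => ℂ) p :=
  (-Complex.I / 2) • (x - star x)

omit [Fact (1 ≤ p)] in
theorem reSeq_apply (x : lp (fun _ : ι => ℂ) p) (i : ι) : reSeq x i = ((x i).re : ℂ) := by
  change (1 / 2 : ℂ) * (x i + star (x i)) = _
  apply Complex.ext <;> (simp; try ring)

omit [Fact (1 ≤ p)] in
theorem imSeq_apply (x : lp (fun _ : ι => ℂ) p) (i : ι) : imSeq x i = ((x i).im : ℂ) := by
  change (-Complex.I / 2 : ℂ) * (x i - star (x i)) = _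
  apply Complex.ext <;> (simp; try ring)

theorem norm_reSeq_le (x : lp (fun _ : ι => ℂ) p) : ‖reSeq x‖ ≤ ‖x‖ := by
  rw [reSeq, norm_smul]
  have := norm_add_le x (star x)
  rw [norm_star] at this
  norm_num
  linarith

theorem norm_imSeq_le (x : lp (fun _ : ι => ℂ) p) : ‖imSeq x‖ ≤ ‖x‖ := by
  rw [imSeq, norm_smul]
  have := norm_sub_le x (star x)
  rw [norm_star] at this
  norm_num
  linarith

omit [Fact (1 ≤ p)] in
theorem isRealSeq_reSeq (x : lp (fun _ : ι => ℂ) p) : IsRealSeq (reSeq x) := fun i => by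
  rw [reSeq_apply, Complex.ofReal_im]

omit [Fact (1 ≤ p)] in
theorem isRealSeq_imSeq (x : lp (fun _ : ι => ℂ) p) : IsRealSeq (imSeq x) := fun i => by
  rw [imSeq_apply, Complex.ofReal_im]

omit [Fact (1 ≤ p)] in
theorem reSeq_neg (x : lp (fun _ : ι => ℂ) p) : reSeq (-x) = -reSeq x := by
  ext i; simp [reSeq_apply]

omit [Fact (1 ≤ p)] in
theorem imSeq_neg (x : lp (fun _ : ι => ℂ) p) : imSeq (-x) = -imSeq x := by
  ext i; simp [imSeq_apply]

theorem continuous_reSeq : Continuous (reSeq (ι := ι) (p := p)) :=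
  (continuous_id.add continuous_star).const_smul (1 / 2 : ℂ)

theorem continuous_imSeq : Continuous (imSeq (ι := ι) (p := p)) :=
  (continuous_id.sub continuous_star).const_smul (-Complex.I / 2)

end ComplexParts

/-! ### Walsh transforms built from the layers. -/

section Coefficients

variable {A : Type*} [Infinite A] {p : ℝ≥0∞} [Fact (1 ≤ p)]

theorem hasSum_lp_apply {ι J : Type*} {f : J → lp (fun _ : ι => ℂ) p} {a : lp (fun _ : ι => ℂ) p}
    (h : HasSum f a) (i : ι) : HasSum (fun j => f j i) (a i) :=
  h.mapL (lp.evalCLM ℂ (fun _ : ι => ℂ) p i)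

/-- The unimodular factor that makes the parity of layers alternate when `p = 2`. -/
def twist (p : ℝ≥0∞) : ℂ := if p = 2 then Complex.I else 1

theorem norm_twist (p : ℝ≥0∞) : ‖twist p‖ = 1 := by
  unfold twist; split_ifs <;> simp

/-- The passage from one layer to the next for `p ≤ 2`. -/
abbrev fnStep (A : Type*) [Infinite A] (p : ℝ≥0∞) [Fact (1 ≤ p)] :
    lp (fun _ : A => ℂ) p → lp (fun _ : A => ℂ) p :=
  layer p (finsetEmb A) oddWeight' (ratio p)⁻¹ 1

/-- The term of index `j` in the transform attached to a real sequence for `p ≤ 2`. -/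
def fnTerm (x : lp (fun _ : A => ℂ) p) (j : ℕ) : lp (fun _ : Finset A => ℂ) p :=
  lpExt (Finset.mapEmbedding (layerEmb j)).toEmbedding (lpMonom p imWeight ((fnStep A p)^[j] x))

/-- The coefficient of the layer of index `j`. -/
def fnCoef (p : ℝ≥0∞) (j : ℕ) : ℂ := (twist p * ratio p) ^ j

theorem norm_fnCoef (p : ℝ≥0∞) (j : ℕ) : ‖fnCoef p j‖ = ratio p ^ j := by
  rw [fnCoef, norm_pow, norm_mul, norm_twist, one_mul, Complex.norm_real, Real.norm_eq_abs,
    abs_of_pos (ratio_pos p)]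

/-- The Walsh transform attached to a real sequence for `p ≤ 2`. -/
def fnHat (x : lp (fun _ : A => ℂ) p) : lp (fun _ : Finset A => ℂ) p :=
  ∑' j, fnCoef p j • fnTerm x j

theorem norm_lpMonom_rpow_le_sinh_one {ι : Type*} {w : ℕ → ℂ} (hp : p ≠ ∞) (hw : IsOddWeight w)
    {z : lp (fun _ : ι => ℂ) p} (hz : ‖z‖ ≤ 1) :
    ‖lpMonom p w z‖ ^ p.toReal ≤ Real.sinh 1 := by
  have hr := one_le_toReal hp
  refine (norm_lpMonom_rpow_le hp hw (inDom_of_ne_top hp hz)).trans (Real.sinh_le_sinh.2 ?_)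
  exact Real.rpow_le_one (norm_nonneg _) hz (by linarith)

theorem norm_lpMonom_le_sqrt_exp {ι : Type*} {w : ℕ → ℂ} (hp : p ≠ ∞) (hw : IsOddWeight w)
    {z : lp (fun _ : ι => ℂ) p} (hz : ‖z‖ ≤ 1) : ‖lpMonom p w z‖ ≤ √(Real.exp 1) := by
  have hr := one_le_toReal hp
  refine le_trans ?_ sinh_one_le_sqrt_exp
  have h := norm_lpMonom_rpow_le_sinh_one hp hw hz
  by_contra! hlt
  have h1 : 1 ≤ ‖lpMonom p w z‖ := sinh_one_bounds.1.le.trans hlt.le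
  have h2 := Real.rpow_le_rpow_of_exponent_le h1 hr
  rw [Real.rpow_one] at h2
  linarith

theorem hasSum_ratio (hp : p ≠ ∞) (C : ℝ) : HasSum (fun j => ratio p ^ j * C) (C / (1 - ratio p)) := by
  have := (hasSum_geometric_of_lt_one (ratio_pos p).le (ratio_lt_one hp)).mul_right C
  rwa [inv_mul_eq_div] at this

variable {x : lp (fun _ : A => ℂ) p}

theorem norm_fnTerm_le (hp : p ≠ ∞) (hx : ‖x‖ ≤ 1) (j : ℕ) :
    ‖fnCoef p j • fnTerm x j‖ ≤ ratio p ^ j * √(Real.exp 1) := by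
  rw [norm_smul, norm_fnCoef, fnTerm, LinearIsometry.norm_map]
  exact mul_le_mul_of_nonneg_left (norm_lpMonom_le_sqrt_exp hp isOddWeight_imWeight
    ((isStep_layer_odd hp _).iterate_norm_le hx j)) (pow_nonneg (ratio_pos p).le j)

theorem hasSum_fnHat (hp : p ≠ ∞) (hx : ‖x‖ ≤ 1) :
    HasSum (fun j => fnCoef p j • fnTerm x j) (fnHat x) :=
  (Summable.of_norm_bounded (hasSum_ratio hp _).summable (norm_fnTerm_le hp hx)).hasSum

theorem norm_fnHat_le (hp : p ≠ ∞) (hx : ‖x‖ ≤ 1) :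
    ‖fnHat x‖ ≤ √(Real.exp 1) / (1 - ratio p) :=
  tsum_of_norm_bounded (hasSum_ratio hp _) (norm_fnTerm_le hp hx)

theorem fnTerm_neg (hp : p ≠ ∞) (hx : ‖x‖ ≤ 1) (j : ℕ) : fnTerm (-x) j = -fnTerm x j := by
  have hT := isStep_layer_odd (p := p) hp (finsetEmb A)
  rw [fnTerm, hT.iterate_neg hx, lpMonom_neg isOddWeight_imWeight
    (inDom_of_ne_top hp (hT.iterate_norm_le hx j)), map_neg]
  rfl

theorem fnHat_neg (hp : p ≠ ∞) (hx : ‖x‖ ≤ 1) : fnHat (-x) = -fnHat x := by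
  simp only [fnHat, fnTerm_neg hp hx, smul_neg, tsum_neg]

theorem continuousOn_fnHat (hp : p ≠ ∞) :
    ContinuousOn (fnHat (A := A) (p := p)) {x | ‖x‖ ≤ 1} := by
  have hT := isStep_layer_odd (p := p) hp (finsetEmb A)
  refine continuousOn_tsum (fun j => ?_) (hasSum_ratio hp _).summable
    fun j x hx => norm_fnTerm_le hp hx j
  refine ContinuousOn.const_smul ?_ (fnCoef p j)
  refine (LinearIsometry.continuous _).comp_continuousOn ?_
  exact (continuousOn_lpMonom isOddWeight_imWeight).comp (hT.iterate_continuousOn j)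
    fun x hx => inDom_of_ne_top hp (hT.iterate_norm_le hx j)

theorem fnTerm_apply_map (hp : p ≠ ∞) (hx : ‖x‖ ≤ 1) (j : ℕ) (F : Finset A) :
    fnTerm x j (F.map (layerEmb j)) = monom imWeight ((fnStep A p)^[j] x) F := by
  have hT := isStep_layer_odd (p := p) hp (finsetEmb A)
  rw [← lpMonom_apply isOddWeight_imWeight (inDom_of_ne_top hp (hT.iterate_norm_le hx j))]
  exact lpExt_apply (Finset.mapEmbedding (layerEmb j)).toEmbedding _ F

theorem monom_empty {ι : Type*} {w : ℕ → ℂ} (hw : IsOddWeight w) (z : ι → ℂ) :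
    monom w z ∅ = 0 := by
  simp [monom, hw.eq_zero 0 (by simp)]

/-- Two layers share only the empty set, and odd weights vanish there. -/
theorem fnTerm_apply_map_of_ne (hp : p ≠ ∞) (hx : ‖x‖ ≤ 1) {j k : ℕ} (hjk : j ≠ k)
    (F : Finset A) : fnTerm x j (F.map (layerEmb k)) = 0 := by
  by_cases h : ∃ G : Finset A, (Finset.mapEmbedding (layerEmb j)).toEmbedding G =
      F.map (layerEmb k)
  · obtain ⟨G, hG⟩ := h
    have hG0 := map_layerEmb_eq hjk (show G.map (layerEmb j) = _ from hG)
    rw [← hG, hG0]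
    exact (fnTerm_apply_map hp hx j ∅).trans (monom_empty isOddWeight_imWeight _)
  · exact lpExt_apply_of_notMem _ _ h

theorem fnHat_apply_map (hp : p ≠ ∞) (hx : ‖x‖ ≤ 1) (j : ℕ) (F : Finset A) :
    fnHat x (F.map (layerEmb j)) = fnCoef p j * monom imWeight ((fnStep A p)^[j] x) F := by
  have h := hasSum_lp_apply (hasSum_fnHat hp hx) (F.map (layerEmb j))
  rw [← fnTerm_apply_map hp hx j F]
  refine h.unique (hasSum_single j fun k hk => ?_)
  rw [lp.coeFn_smul, Pi.smul_apply, fnTerm_apply_map_of_ne hp hx hk, smul_zero]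

/-- The geometric bound is uniform in ξ, which reduces the claim to one layer; there the coefficient
is a monomial in the coordinates of an iterate, or zero. -/
theorem continuous_fnHat_apply (hp : p ≠ ∞) {X : Type*} [TopologicalSpace X]
    {u : X → lp (fun _ : A => ℂ) p} (hu : ∀ ξ, ‖u ξ‖ ≤ 1) (hc : ∀ i, Continuous fun ξ => u ξ i)
    (F : Finset A) : Continuous fun ξ => fnHat (u ξ) F := by
  have hT := isStep_layer_odd (p := p) hp (finsetEmb A)
  have h (ξ : X) : fnHat (u ξ) F = ∑' j, (fnCoef p j • fnTerm (u ξ) j) F :=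
    (hasSum_lp_apply (hasSum_fnHat hp (hu ξ)) F).tsum_eq.symm
  simp only [h]
  refine continuous_tsum (fun j => ?_) (hasSum_ratio hp √(Real.exp 1)).summable fun j ξ =>
    (norm_apply_le _ F).trans (norm_fnTerm_le hp (hu ξ) j)
  refine Continuous.const_smul (g := fun ξ => fnTerm (u ξ) j F) ?_ (fnCoef p j)
  by_cases h : ∃ G : Finset A, G.map (layerEmb j) = F
  · obtain ⟨G, rfl⟩ := h
    simp only [fnTerm_apply_map hp (hu _)]
    exact continuous_const.mul (continuous_finsetProd _ fun i _ =>
      hT.continuous_iterate_apply hu hc j i)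
  · have (ξ : X) : fnTerm (u ξ) j F = 0 := lpExt_apply_of_notMem _ _ h
    simpa only [this] using continuous_const

/-- The passage from one layer to the next for `p > 2`. -/
abbrev measStep (A : Type*) [Infinite A] (p : ℝ≥0∞) [Fact (1 ≤ p)] :
    lp (fun _ : A => ℂ) p → lp (fun _ : A => ℂ) p :=
  layer p (finsetEmb A) imWeight' 2 (1 / 2)

/-- Half the superposition of the layers for `p > 2`. -/
def measSeq (x : lp (fun _ : A => ℂ) p) : lp (fun _ : A => ℂ) p :=
  (1 / 2 : ℂ) • ∑' j, lpExt (layerEmb j) ((measStep A p)^[j] x)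

theorem norm_measStep_iterate_le (hx : ‖x‖ ≤ 1) (j : ℕ) :
    ‖(measStep A p)^[j] x‖ ≤ (1 / 2) ^ j := by
  have hT := isStep_layer_im (p := p) (finsetEmb A)
  induction j with
  | zero => simpa using hx
  | succ j ih =>
    rw [Function.iterate_succ_apply', pow_succ]
    have := norm_layer_le_half_mul (finsetEmb A) (hT.iterate_norm_le hx j)
    linarith

theorem norm_measTerm_le (hx : ‖x‖ ≤ 1) (j : ℕ) :
    ‖lpExt (layerEmb j) ((measStep A p)^[j] x)‖ ≤ (1 / 2) ^ j := by
  rw [LinearIsometry.norm_map]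
  exact norm_measStep_iterate_le hx j

theorem hasSum_measTerm (hx : ‖x‖ ≤ 1) :
    HasSum (fun j => lpExt (layerEmb j) ((measStep A p)^[j] x))
      (∑' j, lpExt (layerEmb j) ((measStep A p)^[j] x)) :=
  (Summable.of_norm_bounded summable_geometric_two (norm_measTerm_le hx)).hasSum

theorem measSeq_apply (hx : ‖x‖ ≤ 1) (j : ℕ) (α : A) :
    measSeq x (layerEmb j α) = 1 / 2 * (measStep A p)^[j] x α := by
  rw [measSeq, lp.coeFn_smul, Pi.smul_apply, smul_eq_mul]
  congr 1
  refine (hasSum_lp_apply (hasSum_measTerm hx) _).unique ?_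
  rw [← lpExt_apply (layerEmb j) ((measStep A p)^[j] x)]
  refine hasSum_single j fun k hk => lpExt_apply_of_notMem _ _ ?_
  rintro ⟨β, hβ⟩
  exact hk (layerEmb_eq_iff.1 hβ).1

theorem measSeq_apply_of_notMem (hx : ‖x‖ ≤ 1) {β : A} (h : ∀ j α, layerEmb j α ≠ β) :
    measSeq x β = 0 := by
  rw [measSeq, lp.coeFn_smul, Pi.smul_apply, smul_eq_mul]
  refine mul_eq_zero_of_right _ ((hasSum_lp_apply (hasSum_measTerm hx) _).unique ?_)
  have (j : ℕ) : lpExt (layerEmb j) ((measStep A p)^[j] x) β = 0 :=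
    lpExt_apply_of_notMem _ _ fun ⟨α, hα⟩ => h j α hα
  simpa only [this] using hasSum_zero

theorem norm_measSeq_apply_le (hx : ‖x‖ ≤ 1) (β : A) : ‖measSeq x β‖ ≤ 1 / 2 := by
  by_cases h : ∃ j α, layerEmb j α = β
  · obtain ⟨j, α, rfl⟩ := h
    rw [measSeq_apply hx, norm_mul]
    have := (norm_apply_le ((measStep A p)^[j] x) α).trans
      ((isStep_layer_im (p := p) (finsetEmb A)).iterate_norm_le hx j)
    norm_num
    linarith
  · push Not at h
    rw [measSeq_apply_of_notMem hx h, norm_zero]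
    norm_num

/-- The factor 1/2 in `measSeq` cancels Σ 2^(-j) = 2. For p = ∞ the triangle inequality would only
give 1; the value 1/2 comes from the disjointness of the layers. -/
theorem inDom_measSeq (hx : ‖x‖ ≤ 1) : InDom (measSeq x) := by
  constructor
  · have := tsum_of_norm_bounded hasSum_geometric_two (norm_measTerm_le hx)
    rw [measSeq, norm_smul]
    norm_num at this ⊢
    linarith
  · rintro rfl
    exact lp.norm_le_of_forall_le (by norm_num) (norm_measSeq_apply_le hx)

theorem measSeq_neg (hx : ‖x‖ ≤ 1) : measSeq (-x) = -measSeq x := by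
  simp only [measSeq, (isStep_layer_im (p := p) (finsetEmb A)).iterate_neg hx, map_neg, tsum_neg,
    smul_neg]

theorem continuousOn_measSeq : ContinuousOn (measSeq (A := A) (p := p)) {x | ‖x‖ ≤ 1} := by
  refine ContinuousOn.const_smul ?_ (1 / 2 : ℂ)
  refine continuousOn_tsum (fun j => ?_) summable_geometric_two fun j x hx => norm_measTerm_le hx j
  exact (LinearIsometry.continuous _).comp_continuousOn
    ((isStep_layer_im (finsetEmb A)).iterate_continuousOn j)

theorem isRealSeq_measSeq (hx : ‖x‖ ≤ 1) (hr : IsRealSeq x) : IsRealSeq (measSeq x) := by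
  intro β
  by_cases h : ∃ j α, layerEmb j α = β
  · obtain ⟨j, α, rfl⟩ := h
    have := (isStep_layer_im (p := p) (finsetEmb A)).iterate_real hx hr j α
    rw [measSeq_apply hx, Complex.mul_im, this]
    simp
  · push Not at h
    rw [measSeq_apply_of_notMem hx h, Complex.zero_im]

theorem continuous_measSeq_apply {X : Type*} [TopologicalSpace X]
    {u : X → lp (fun _ : A => ℂ) p} (hu : ∀ ξ, ‖u ξ‖ ≤ 1) (hc : ∀ i, Continuous fun ξ => u ξ i)
    (β : A) : Continuous fun ξ => measSeq (u ξ) β := by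
  by_cases h : ∃ j α, layerEmb j α = β
  · obtain ⟨j, α, rfl⟩ := h
    simp only [measSeq_apply (hu _)]
    exact continuous_const.mul
      ((isStep_layer_im (p := p) (finsetEmb A)).continuous_iterate_apply hu hc j α)
  · push Not at h
    simpa only [measSeq_apply_of_notMem (hu _) h] using continuous_const

/-- The Walsh transform attached to a real sequence for `p > 2`. -/
def measHat (x : lp (fun _ : A => ℂ) p) : lp (fun _ : Finset A => ℂ) p :=
  (2 : ℂ) • lpMonom p oddWeight (measSeq x)

theorem measHat_apply (hx : ‖x‖ ≤ 1) (F : Finset A) :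
    measHat x F = 2 * monom oddWeight (measSeq x) F := by
  rw [measHat, lp.coeFn_smul, Pi.smul_apply, lpMonom_apply isOddWeight_oddWeight
    (inDom_measSeq hx), smul_eq_mul]

theorem continuousOn_measHat : ContinuousOn (measHat (A := A) (p := p)) {x | ‖x‖ ≤ 1} :=
  ((continuousOn_lpMonom isOddWeight_oddWeight).comp continuousOn_measSeq
    fun _ hx => inDom_measSeq hx).const_smul (2 : ℂ)

theorem norm_measHat_le (hx : ‖x‖ ≤ 1) :
    ‖measHat x‖ ≤ 2 * Real.sinh 1 ^ (1 / p).toReal := by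
  rw [measHat, norm_smul]
  have hD := inDom_measSeq hx
  have h2 : ‖(2 : ℂ)‖ = 2 := by norm_num
  rw [h2]
  refine mul_le_mul_of_nonneg_left ?_ zero_le_two
  by_cases hp : p = ∞
  · subst hp
    refine lp.norm_le_of_forall_le (by positivity) fun F => ?_
    rw [lpMonom_apply isOddWeight_oddWeight hD]
    refine (norm_monom_le_half isOddWeight_oddWeight (norm_measSeq_apply_le hx) F).trans ?_
    norm_num
  · have hr := one_le_toReal hp
    have h := norm_lpMonom_rpow_le_sinh_one hp isOddWeight_oddWeight hD.1
    have h3 := Real.rpow_le_rpow (by positivity) h (show 0 ≤ 1 / p.toReal by positivity)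
    rwa [← Real.rpow_mul (norm_nonneg _), mul_one_div_cancel (by linarith), Real.rpow_one,
      show 1 / p.toReal = (1 / p).toReal by rw [ENNReal.toReal_div]; rfl] at h3

end Coefficients

/-! ### Bilinear pairing of l^p and l^q, and the telescoping sum. -/

section Pairing

theorem HasSum.congr_fun {J E : Type*} [AddCommMonoid E] [TopologicalSpace E] {f g : J → E} {a : E}
    (h : HasSum f a) (hfg : ∀ j, f j = g j) : HasSum g a :=
  (funext hfg : f = g) ▸ h

variable {ι κ : Type*} {p q : ℝ≥0∞} [Fact (1 ≤ p)] [Fact (1 ≤ q)] [p.HolderConjugate q]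

theorem norm_mul_clm_le : ‖ContinuousLinearMap.mul ℂ ℂ‖ ≤ ((1 : NNReal) : ℝ) := by simp

/-- The bilinear pairing of `l^p` and `l^q`. -/
def lpPair (ι : Type*) (p q : ℝ≥0∞) [Fact (1 ≤ p)] [Fact (1 ≤ q)] [p.HolderConjugate q] :
    lp (fun _ : ι => ℂ) p →L[ℂ] lp (fun _ : ι => ℂ) q →L[ℂ] ℂ :=
  lp.dualPairing p q (fun _ : ι => ContinuousLinearMap.mul ℂ ℂ) fun _ => norm_mul_clm_le

theorem lpPair_apply (f : lp (fun _ : ι => ℂ) p) (g : lp (fun _ : ι => ℂ) q) :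
    lpPair ι p q f g = ∑' i, f i * g i := rfl

omit [Fact (1 ≤ p)] [Fact (1 ≤ q)] in
theorem summable_mul (f : lp (fun _ : ι => ℂ) p) (g : lp (fun _ : ι => ℂ) q) :
    Summable fun i => f i * g i :=
  ((lp.memℓp f).holder 1 (lp.memℓp g) (fun _ => ContinuousLinearMap.mul ℂ ℂ)
    fun _ => norm_mul_clm_le).summable_of_one

theorem hasSum_lpPair (f : lp (fun _ : ι => ℂ) p) (g : lp (fun _ : ι => ℂ) q) :
    HasSum (fun i => f i * g i) (lpPair ι p q f g) :=
  (summable_mul f g).hasSum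

theorem norm_lpPair_le (f : lp (fun _ : ι => ℂ) p) (g : lp (fun _ : ι => ℂ) q) :
    ‖lpPair ι p q f g‖ ≤ ‖f‖ * ‖g‖ := by
  refine (ContinuousLinearMap.le_opNorm₂ _ f g).trans ?_
  have : ‖lpPair ι p q‖ ≤ 1 :=
    lp.norm_dualPairing (fun _ : ι => ContinuousLinearMap.mul ℂ ℂ) fun _ => norm_mul_clm_le
  calc ‖lpPair ι p q‖ * ‖f‖ * ‖g‖ ≤ 1 * ‖f‖ * ‖g‖ := by gcongr
    _ = _ := by ring

theorem lpPair_lpExt (e : ι ↪ κ) (f : lp (fun _ : ι => ℂ) p) (g : lp (fun _ : κ => ℂ) q) :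
    lpPair κ p q (lpExt e f) g = ∑' i, f i * g (e i) := by
  rw [lpPair_apply]
  exact tsum_lpExt_mul e f g

/-- The n-th partial sum is D 0 - ρ^n D n, and its last term tends to 0. -/
theorem hasSum_telescope {D E : ℕ → ℂ} {ρ : ℂ} (hρ : ‖ρ‖ < 1) (hD : ∀ j, ‖D j‖ ≤ 1)
    (hE : ∀ j, E j = D j - ρ * D (j + 1)) (hs : Summable fun j => ρ ^ j * E j) :
    ∑' j, ρ ^ j * E j = D 0 := by
  have h1 (n : ℕ) : ∑ j ∈ Finset.range n, ρ ^ j * E j = D 0 - ρ ^ n * D n := by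
    induction n with
    | zero => simp
    | succ n ih => rw [Finset.sum_range_succ, ih, hE]; ring
  have h2 : Filter.Tendsto (fun n => ρ ^ n * D n) Filter.atTop (𝓝 0) := by
    refine squeeze_zero_norm (fun n => ?_)
      (tendsto_pow_atTop_nhds_zero_of_lt_one (norm_nonneg ρ) hρ)
    rw [norm_mul, norm_pow]
    exact mul_le_of_le_one_right (by positivity) (hD n)
  refine tendsto_nhds_unique hs.hasSum.tendsto_sum_nat ?_
  simp only [h1]
  simpa using tendsto_const_nhds.sub h2

/-- Singletons will carry the inner product to be represented, the other sets the error passed to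
the next layer. -/
theorem tsum_finset_split {h : Finset ι → ℂ} (hs : Summable h) :
    ∑' F, h F = ∑' i, h {i} + ∑' F : Finset ι, if F.card = 1 then 0 else h F := by
  classical
  have e1 : h = fun F => (if F.card = 1 then h F else 0) + if F.card = 1 then 0 else h F := by
    funext F; split_ifs <;> simp
  have e2 : ∑' i, h {i} = ∑' F : Finset ι, if F.card = 1 then h F else 0 := by
    rw [← (Finset.singleton_injective (α := ι)).tsum_eq
      (f := fun F : Finset ι => if F.card = 1 then h F else 0)]
    · simp
    · intro F hF
      have : F.card = 1 := by
        by_contra h1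
        simp [h1] at hF
      obtain ⟨i, rfl⟩ := Finset.card_eq_one.1 this
      exact ⟨i, rfl⟩
  have s1 : Summable fun F : Finset ι => if F.card = 1 then h F else 0 := by
    refine (hs.indicator {F | F.card = 1}).congr fun F => ?_
    simp [Set.indicator]
  have s2 : Summable fun F : Finset ι => if F.card = 1 then 0 else h F := by
    refine (hs.indicator {F | F.card ≠ 1}).congr fun F => ?_
    simp [Set.indicator]
  rw [e2, ← s1.tsum_add s2, ← e1]

end Pairing

/-! ### The Parseval formula for real transforms. -/

section Parseval

variable {A : Type*} [Infinite A] {p q : ℝ≥0∞} [Fact (1 ≤ p)] [Fact (1 ≤ q)]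
  [p.HolderConjugate q]

omit [Infinite A] in
theorem tsum_layer_mul {e : Finset A ↪ A} (he : Function.Surjective e) {w v : ℕ → ℂ}
    {a b c d : ℝ} (hw : IsOddWeight w) (hv : IsOddWeight v) {x : lp (fun _ : A => ℂ) p}
    {y : lp (fun _ : A => ℂ) q} (hx : InDom ((b : ℂ) • x)) (hy : InDom ((d : ℂ) • y)) :
    lpPair A p q (layer p e w a b x) (layer q e v c d y) =
      ∑' F : Finset A, (a * (w F.card * ∏ i ∈ F, (b : ℂ) * x i)) *
        (c * (v F.card * ∏ i ∈ F, (d : ℂ) * y i)) := by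
  rw [lpPair_apply, ← (Equiv.ofBijective e ⟨e.injective, he⟩).tsum_eq]
  refine tsum_congr fun F => ?_
  rw [← layer_apply hw hx F, ← layer_apply hv hy F]
  rfl

theorem finsetEmb_surjective (A : Type*) [Infinite A] : Function.Surjective (finsetEmb A) :=
  (Classical.choice (nonempty_finset_equiv A)).surjective

/-- Singletons give the pairing of x and y. On larger odd sets the sign -Im(i^|F|) is assigned to
the measure step and ρ⁻¹ to the function step, so the remainder is -ρ times the pairing of the next
iterates. -/
theorem pair_fnTerm_meas (hp : p ≠ ∞) {x : lp (fun _ : A => ℂ) p} {y : lp (fun _ : A => ℂ) q}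
    (hx : ‖x‖ ≤ 1) (hy : ‖y‖ ≤ 1) (hs : Summable fun F : Finset A =>
      monom imWeight x F * (2 * monom oddWeight (fun i => 1 / 2 * y i) F)) :
    ∑' F : Finset A, monom imWeight x F * (2 * monom oddWeight (fun i => 1 / 2 * y i) F) =
      lpPair A p q x y - ratio p * lpPair A p q (fnStep A p x) (measStep A q y) := by
  have hdx : InDom (((1 : ℝ) : ℂ) • x) := by simpa using inDom_of_ne_top hp hx
  have hdy : InDom (((1 / 2 : ℝ) : ℂ) • y) :=
    ⟨(norm_half_smul_le hy).trans (by norm_num), fun _ =>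
      (norm_half_smul_le hy).trans (by norm_num)⟩
  rw [tsum_finset_split hs, sub_eq_add_neg]
  congr 1
  · rw [lpPair_apply]
    refine tsum_congr fun α => ?_
    simp only [monom, Finset.card_singleton, imWeight_one, Finset.prod_singleton, oddWeight,
      odd_one, if_true]
    ring
  · rw [tsum_layer_mul (finsetEmb_surjective A) isOddWeight_oddWeight' isOddWeight_imWeight' hdx hdy,
      ← tsum_mul_left, ← tsum_neg]
    refine tsum_congr fun F => ?_
    have hρ : (ratio p : ℂ) ≠ 0 := Complex.ofReal_ne_zero.2 (ratio_pos p).ne'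
    by_cases h1 : F.card = 1
    · simp [h1, oddWeight']
    · by_cases h2 : Odd F.card
      · simp only [monom, h1, if_false, oddWeight, h2, if_true, oddWeight', imWeight']
        push_cast
        simp only [one_mul, one_div, ne_eq, h1, not_false_eq_true, and_self, if_true]
        field_simp
      · simp [monom, h1, oddWeight, h2, oddWeight']

/-- Both factors carry Im(i^|F|), whose square is 1 at odd sets. The error therefore enters with a
plus sign, and the telescoping ratio has to be -ρ². -/
theorem pair_fnTerm_fn {x y : lp (fun _ : A => ℂ) 2}
    (hx : ‖x‖ ≤ 1) (hy : ‖y‖ ≤ 1) (hs : Summable fun F : Finset A =>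
      monom imWeight x F * monom imWeight y F) :
    ∑' F : Finset A, monom imWeight x F * monom imWeight y F =
      lpPair A 2 2 x y - (-(ratio 2 : ℂ) ^ 2) * lpPair A 2 2 (fnStep A 2 x) (fnStep A 2 y) := by
  have hd {z : lp (fun _ : A => ℂ) 2} (hz : ‖z‖ ≤ 1) : InDom (((1 : ℝ) : ℂ) • z) := by
    simpa using inDom_of_ne_top ENNReal.ofNat_ne_top hz
  rw [tsum_finset_split hs, sub_eq_add_neg]
  congr 1
  · rw [lpPair_apply]
    refine tsum_congr fun α => ?_
    simp [monom, imWeight_one]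
  · rw [tsum_layer_mul (finsetEmb_surjective A) isOddWeight_oddWeight' isOddWeight_oddWeight'
      (hd hx) (hd hy), ← tsum_mul_left, ← tsum_neg]
    refine tsum_congr fun F => ?_
    have hρ : (ratio 2 : ℂ) ≠ 0 := Complex.ofReal_ne_zero.2 (ratio_pos 2).ne'
    by_cases h1 : F.card = 1
    · simp [h1, oddWeight']
    · by_cases h2 : Odd F.card
      · have := imWeight_sq h2
        simp only [monom, h1, if_false, h2, oddWeight']
        push_cast
        simp only [one_mul, ne_eq, h1, not_false_eq_true, and_self, if_true]
        field_simp
        linear_combination (∏ i ∈ F, x i) * (∏ i ∈ F, y i) * this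
      · simp [monom, h1, imWeight_of_not_odd h2, oddWeight', h2]

variable {x : lp (fun _ : A => ℂ) p}

/-- The left factor is a sum of pieces supported on single layers, so only the values of m on such
sets matter, not those on sets that mix layers. -/
theorem pair_fnHat (hp : p ≠ ∞) (hx : ‖x‖ ≤ 1) (m : lp (fun _ : Finset A => ℂ) q) :
    HasSum (fun j => fnCoef p j * ∑' F : Finset A, monom imWeight ((fnStep A p)^[j] x) F *
      m (F.map (layerEmb j))) (lpPair (Finset A) p q (fnHat x) m) := by
  have h := (hasSum_fnHat hp hx).mapL ((lpPair (Finset A) p q).flip m)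
  have hT := isStep_layer_odd (p := p) hp (finsetEmb A)
  refine HasSum.congr_fun h fun j => ?_
  rw [ContinuousLinearMap.flip_apply, map_smul, smul_apply, smul_eq_mul, fnTerm, lpPair_lpExt]
  congr 1
  refine tsum_congr fun F => ?_
  rw [lpMonom_apply isOddWeight_imWeight (inDom_of_ne_top hp (hT.iterate_norm_le hx j))]
  rfl

theorem measHat_apply_map {y : lp (fun _ : A => ℂ) q} (hy : ‖y‖ ≤ 1) (j : ℕ) (F : Finset A) :
    measHat y (F.map (layerEmb j)) =
      2 * monom oddWeight (fun i => 1 / 2 * (measStep A q)^[j] y i) F := by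
  rw [measHat_apply hy, monom, monom, Finset.card_map, Finset.prod_map]
  simp only [measSeq_apply hy]

theorem lpPair_fnHat_measHat (hp : p ≠ ∞) (hp2 : p ≠ 2) (hx : ‖x‖ ≤ 1)
    {y : lp (fun _ : A => ℂ) q} (hy : ‖y‖ ≤ 1) :
    lpPair (Finset A) p q (fnHat x) (measHat y) = lpPair A p q x y := by
  have hT := isStep_layer_odd (p := p) hp (finsetEmb A)
  have hS := isStep_layer_im (p := q) (finsetEmb A)
  have hco (j : ℕ) : fnCoef p j = (ratio p : ℂ) ^ j := by rw [fnCoef, twist, if_neg hp2, one_mul]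
  have h := pair_fnHat hp hx (measHat y)
  simp only [hco] at h
  rw [← h.tsum_eq]
  refine hasSum_telescope (D := fun j => lpPair A p q ((fnStep A p)^[j] x) ((measStep A q)^[j] y))
    ?_ (fun j => ?_) (fun j => ?_) h.summable
  · rw [Complex.norm_real, Real.norm_eq_abs, abs_of_pos (ratio_pos p)]
    exact ratio_lt_one hp
  · refine (norm_lpPair_le _ _).trans ?_
    have := hT.iterate_norm_le hx j
    have := hS.iterate_norm_le hy j
    nlinarith [norm_nonneg ((fnStep A p)^[j] x), norm_nonneg ((measStep A q)^[j] y)]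
  · simp only [measHat_apply_map hy, Function.iterate_succ_apply']
    have hxj := hT.iterate_norm_le hx j
    have hyj := hS.iterate_norm_le hy j
    refine pair_fnTerm_meas hp hxj hyj ?_
    have hdy : InDom (((1 / 2 : ℝ) : ℂ) • (measStep A q)^[j] y) :=
      ⟨(norm_half_smul_le hyj).trans (by norm_num), fun _ =>
        (norm_half_smul_le hyj).trans (by norm_num)⟩
    refine (summable_mul (lpMonom p imWeight ((fnStep A p)^[j] x))
      ((2 : ℂ) • lpMonom q oddWeight (((1 / 2 : ℝ) : ℂ) • (measStep A q)^[j] y))).congr fun F => ?_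
    rw [lp.coeFn_smul, Pi.smul_apply, smul_eq_mul,
      lpMonom_apply isOddWeight_imWeight (inDom_of_ne_top hp hxj),
      lpMonom_apply isOddWeight_oddWeight hdy]
    have : ⇑(((1 / 2 : ℝ) : ℂ) • (measStep A q)^[j] y) =
        fun i => 1 / 2 * (measStep A q)^[j] y i := by
      funext i
      rw [lp.coeFn_smul, Pi.smul_apply, smul_eq_mul]
      push_cast
      rfl
    rw [this]

theorem lpPair_fnHat_fnHat {x y : lp (fun _ : A => ℂ) 2} (hx : ‖x‖ ≤ 1) (hy : ‖y‖ ≤ 1) :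
    lpPair (Finset A) 2 2 (fnHat x) (fnHat y) = lpPair A 2 2 x y := by
  have hp : (2 : ℝ≥0∞) ≠ ∞ := ENNReal.ofNat_ne_top
  have hT := isStep_layer_odd (p := 2) hp (finsetEmb A)
  have h := pair_fnHat hp hx (fnHat y)
  simp only [fnHat_apply_map hp hy, mul_left_comm _ (fnCoef 2 _), tsum_mul_left] at h
  simp only [← mul_assoc] at h
  -- Here the twist is used: (iρ)^(2j) = (-ρ²)^j, the ratio which `pair_fnTerm_fn` requires.
  have hco (j : ℕ) : fnCoef 2 j * fnCoef 2 j = (-(ratio 2 : ℂ) ^ 2) ^ j := by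
    rw [fnCoef, twist, if_pos rfl, ← mul_pow]
    congr 1
    linear_combination (ratio 2 : ℂ) ^ 2 * Complex.I_mul_I
  simp only [hco] at h
  rw [← h.tsum_eq]
  refine hasSum_telescope (D := fun j => lpPair A 2 2 ((fnStep A 2)^[j] x) ((fnStep A 2)^[j] y))
    ?_ (fun j => ?_) (fun j => ?_) h.summable
  · rw [norm_neg, norm_pow, Complex.norm_real, Real.norm_eq_abs, abs_of_pos (ratio_pos 2)]
    exact pow_lt_one₀ (ratio_pos 2).le (ratio_lt_one hp) two_ne_zero
  · refine (norm_lpPair_le _ _).trans ?_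
    have := hT.iterate_norm_le hx j
    have := hT.iterate_norm_le hy j
    nlinarith [norm_nonneg ((fnStep A 2)^[j] x), norm_nonneg ((fnStep A 2)^[j] y)]
  · simp only [Function.iterate_succ_apply']
    have hxj := hT.iterate_norm_le hx j
    have hyj := hT.iterate_norm_le hy j
    refine pair_fnTerm_fn hxj hyj ?_
    refine (summable_mul (lpMonom 2 imWeight ((fnStep A 2)^[j] x))
      (lpMonom 2 imWeight ((fnStep A 2)^[j] y))).congr fun F => ?_
    rw [lpMonom_apply isOddWeight_imWeight (inDom_of_ne_top hp hxj),
      lpMonom_apply isOddWeight_imWeight (inDom_of_ne_top hp hyj)]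

end Parseval

/-! ### Passage to complex sequences. -/

section ComplexTransforms

variable {A : Type*} [Infinite A] {p q : ℝ≥0∞} [Fact (1 ≤ p)] [Fact (1 ≤ q)]

omit [Fact (1 ≤ p)] in
theorem re_add_im_seq {ι : Type*} (x : lp (fun _ : ι => ℂ) p) :
    reSeq x + Complex.I • imSeq x = x := by
  ext i
  rw [lp.coeFn_add, Pi.add_apply, lp.coeFn_smul, Pi.smul_apply, reSeq_apply, imSeq_apply,
    smul_eq_mul, mul_comm]
  exact Complex.re_add_im (x i)

/-- The Walsh transform attached to a complex sequence for `p ≤ 2`. -/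
def fnHatC (x : lp (fun _ : A => ℂ) p) : lp (fun _ : Finset A => ℂ) p :=
  fnHat (reSeq x) + Complex.I • fnHat (imSeq x)

/-- The Walsh transform attached to a complex sequence for `p > 2`. -/
def measHatC (x : lp (fun _ : A => ℂ) p) : lp (fun _ : Finset A => ℂ) p :=
  measHat (reSeq x) + Complex.I • measHat (imSeq x)

/-- The maps f and g are not linear; the bilinearity of the pairing alone combines the four
identities between parts. -/
theorem lpPair_complex {ι κ : Type*} [p.HolderConjugate q]
    {f : lp (fun _ : ι => ℂ) p → lp (fun _ : κ => ℂ) p}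
    {g : lp (fun _ : ι => ℂ) q → lp (fun _ : κ => ℂ) q}
    (h : ∀ x y, ‖x‖ ≤ 1 → ‖y‖ ≤ 1 → lpPair κ p q (f x) (g y) = lpPair ι p q x y)
    {x : lp (fun _ : ι => ℂ) p} {y : lp (fun _ : ι => ℂ) q} (hx : ‖x‖ ≤ 1) (hy : ‖y‖ ≤ 1) :
    lpPair κ p q (f (reSeq x) + Complex.I • f (imSeq x)) (g (reSeq y) + Complex.I • g (imSeq y)) =
      lpPair ι p q x y := by
  have h1 := (norm_reSeq_le x).trans hx
  have h2 := (norm_imSeq_le x).trans hx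
  have h3 := (norm_reSeq_le y).trans hy
  have h4 := (norm_imSeq_le y).trans hy
  conv_rhs => rw [← re_add_im_seq x, ← re_add_im_seq y]
  simp only [map_add, map_smul, add_apply, smul_apply,
    h _ _ h1 h3, h _ _ h1 h4, h _ _ h2 h3, h _ _ h2 h4]

theorem lpPair_fnHatC_measHatC [p.HolderConjugate q] (hp : p ≠ ∞) (hp2 : p ≠ 2)
    {x : lp (fun _ : A => ℂ) p} {y : lp (fun _ : A => ℂ) q} (hx : ‖x‖ ≤ 1) (hy : ‖y‖ ≤ 1) :
    lpPair (Finset A) p q (fnHatC x) (measHatC y) = lpPair A p q x y :=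
  lpPair_complex (fun _ _ h1 h2 => lpPair_fnHat_measHat hp hp2 h1 h2) hx hy

theorem lpPair_fnHatC_fnHatC {x y : lp (fun _ : A => ℂ) 2} (hx : ‖x‖ ≤ 1) (hy : ‖y‖ ≤ 1) :
    lpPair (Finset A) 2 2 (fnHatC x) (fnHatC y) = lpPair A 2 2 x y :=
  lpPair_complex (fun _ _ h1 h2 => lpPair_fnHat_fnHat h1 h2) hx hy

variable {x : lp (fun _ : A => ℂ) p}

theorem norm_add_I_smul_le {E : Type*} [NormedAddCommGroup E] [NormedSpace ℂ E] {u v : E} {C : ℝ}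
    (hu : ‖u‖ ≤ C) (hv : ‖v‖ ≤ C) : ‖u + Complex.I • v‖ ≤ 2 * C := by
  refine (norm_add_le _ _).trans ?_
  rw [norm_smul, Complex.norm_I]
  linarith

theorem norm_fnHatC_le (hp : p ≠ ∞) (hx : ‖x‖ ≤ 1) :
    ‖fnHatC x‖ ≤ 2 * (√(Real.exp 1) / (1 - ratio p)) :=
  norm_add_I_smul_le (norm_fnHat_le hp ((norm_reSeq_le x).trans hx))
    (norm_fnHat_le hp ((norm_imSeq_le x).trans hx))

theorem norm_measHatC_le (hx : ‖x‖ ≤ 1) :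
    ‖measHatC x‖ ≤ 2 * (2 * Real.sinh 1 ^ (1 / p).toReal) :=
  norm_add_I_smul_le (norm_measHat_le ((norm_reSeq_le x).trans hx))
    (norm_measHat_le ((norm_imSeq_le x).trans hx))

theorem fnHatC_neg (hp : p ≠ ∞) (hx : ‖x‖ ≤ 1) : fnHatC (-x) = -fnHatC x := by
  rw [fnHatC, reSeq_neg, imSeq_neg, fnHat_neg hp ((norm_reSeq_le x).trans hx),
    fnHat_neg hp ((norm_imSeq_le x).trans hx), fnHatC, smul_neg, neg_add]

theorem continuousOn_fnHatC (hp : p ≠ ∞) :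
    ContinuousOn (fnHatC (A := A) (p := p)) {x | ‖x‖ ≤ 1} := by
  refine ContinuousOn.add ?_ (ContinuousOn.const_smul ?_ Complex.I)
  · exact (continuousOn_fnHat hp).comp continuous_reSeq.continuousOn
      fun x hx => (norm_reSeq_le x).trans hx
  · exact (continuousOn_fnHat hp).comp continuous_imSeq.continuousOn
      fun x hx => (norm_imSeq_le x).trans hx

theorem continuousOn_measHatC : ContinuousOn (measHatC (A := A) (p := p)) {x | ‖x‖ ≤ 1} := by
  refine ContinuousOn.add ?_ (ContinuousOn.const_smul ?_ Complex.I)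
  · exact continuousOn_measHat.comp continuous_reSeq.continuousOn
      fun x hx => (norm_reSeq_le x).trans hx
  · exact continuousOn_measHat.comp continuous_imSeq.continuousOn
      fun x hx => (norm_imSeq_le x).trans hx

theorem continuous_fnHatC_apply (hp : p ≠ ∞) {X : Type*} [TopologicalSpace X]
    {u : X → lp (fun _ : A => ℂ) p} (hu : ∀ ξ, ‖u ξ‖ ≤ 1) (hc : ∀ i, Continuous fun ξ => u ξ i)
    (F : Finset A) : Continuous fun ξ => fnHatC (u ξ) F := by
  refine Continuous.add (f := fun ξ => fnHat (reSeq (u ξ)) F) ?_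
    (Continuous.const_smul (g := fun ξ => fnHat (imSeq (u ξ)) F) ?_ Complex.I)
  · refine continuous_fnHat_apply hp (fun ξ => (norm_reSeq_le _).trans (hu ξ)) (fun i => ?_) F
    simp only [reSeq_apply]
    exact Complex.continuous_ofReal.comp (Complex.continuous_re.comp (hc i))
  · refine continuous_fnHat_apply hp (fun ξ => (norm_imSeq_le _).trans (hu ξ)) (fun i => ?_) F
    simp only [imSeq_apply]
    exact Complex.continuous_ofReal.comp (Complex.continuous_im.comp (hc i))

/-- The singletons of layer 0 recover the sequence, which yields injectivity. -/
theorem fnHatC_apply_singleton (hp : p ≠ ∞) (hx : ‖x‖ ≤ 1) (α : A) :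
    fnHatC x {layerEmb 0 α} = x α := by
  have h {z : lp (fun _ : A => ℂ) p} (hz : ‖z‖ ≤ 1) : fnHat z {layerEmb 0 α} = z α := by
    have := fnHat_apply_map hp hz 0 {α}
    rw [Finset.map_singleton] at this
    simpa [fnCoef, monom, imWeight_one] using this
  rw [fnHatC, lp.coeFn_add, Pi.add_apply, lp.coeFn_smul, Pi.smul_apply,
    h ((norm_reSeq_le x).trans hx), h ((norm_imSeq_le x).trans hx), reSeq_apply, imSeq_apply,
    smul_eq_mul, mul_comm]
  exact Complex.re_add_im (x α)

theorem measHatC_apply_singleton (hx : ‖x‖ ≤ 1) (α : A) :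
    measHatC x {layerEmb 0 α} = x α := by
  have h {z : lp (fun _ : A => ℂ) p} (hz : ‖z‖ ≤ 1) : measHat z {layerEmb 0 α} = z α := by
    have := measHat_apply_map hz 0 {α}
    rw [Finset.map_singleton] at this
    simpa [monom, oddWeight] using this
  rw [measHatC, lp.coeFn_add, Pi.add_apply, lp.coeFn_smul, Pi.smul_apply,
    h ((norm_reSeq_le x).trans hx), h ((norm_imSeq_le x).trans hx), reSeq_apply, imSeq_apply,
    smul_eq_mul, mul_comm]
  exact Complex.re_add_im (x α)

end ComplexTransforms

/-! ### Regularity of measures on the cylinder σ-field. -/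

section Regularity

variable {A : Type*}

theorem isClopen_of_mem_measurableCylinders {E : Set (Omega A)}
    (hE : E ∈ measurableCylinders fun _ : A => ℤˣ) : IsClopen E := by
  obtain ⟨s, S, _, rfl⟩ := (mem_measurableCylinders _).1 hE
  exact (isClopen_discrete S).preimage (Finset.continuous_restrict s)

/-- Cylinder sets are clopen and approximate themselves; the property then passes to the generated
σ-field. -/
theorem exists_isClosed_isOpen_measure_diff_lt (ρ : Measure (Omega A)) [IsFiniteMeasure ρ]
    {E : Set (Omega A)} (hE : MeasurableSet E) :
    ∀ ε : ℝ≥0∞, 0 < ε → ∃ K U : Set (Omega A), IsClosed K ∧ MeasurableSet K ∧ IsOpen U ∧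
      MeasurableSet U ∧ K ⊆ E ∧ E ⊆ U ∧ ρ (U \ K) < ε := by
  have hgen : (MeasurableSpace.pi : MeasurableSpace (Omega A)) =
      MeasurableSpace.generateFrom (measurableCylinders fun _ : A => ℤˣ) :=
    generateFrom_measurableCylinders.symm
  rw [hgen] at hE
  induction E, hE using MeasurableSpace.generateFrom_induction with
  | hC E hE _ =>
    intro ε hε
    have hc := isClopen_of_mem_measurableCylinders hE
    have hm := MeasurableSet.of_mem_measurableCylinders hE
    exact ⟨E, E, hc.1, hm, hc.2, hm, subset_rfl, subset_rfl, by simpa using hε⟩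
  | empty =>
    intro ε hε
    exact ⟨∅, ∅, isClosed_empty, .empty, isOpen_empty, .empty, subset_rfl, subset_rfl,
      by simpa using hε⟩
  | compl E _ ih =>
    intro ε hε
    obtain ⟨K, U, hK, hKm, hU, hUm, hKE, hEU, h⟩ := ih ε hε
    refine ⟨Uᶜ, Kᶜ, hU.isClosed_compl, hUm.compl, hK.isOpen_compl, hKm.compl,
      compl_subset_compl.2 hEU, compl_subset_compl.2 hKE, ?_⟩
    rwa [show Kᶜ \ Uᶜ = U \ K by ext; simp [and_comm]]
  | iUnion E _ ih =>
    intro ε hε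
    obtain ⟨ε', hε', hsum⟩ := ENNReal.exists_pos_sum_of_countable' hε.ne' ℕ
    choose K U hK hKm hU hUm hKE hEU h using fun n => ih n (ε' n) (hε' n)
    have hlim : ρ ((⋃ n, U n) \ ⋃ n, K n) < ε := by
      refine lt_of_le_of_lt (measure_mono (t := ⋃ n, U n \ K n) ?_) ?_
      · rintro ω ⟨h1, h2⟩
        obtain ⟨n, hn⟩ := mem_iUnion.1 h1
        exact mem_iUnion.2 ⟨n, hn, fun h3 => h2 (mem_iUnion.2 ⟨n, h3⟩)⟩
      · exact (measure_iUnion_le _).trans_lt ((ENNReal.tsum_le_tsum fun n => (h n).le).trans_lt hsum)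
    -- An infinite union of closed sets need not be closed. Continuity from above allows it to be
    -- replaced by a finite subunion.
    have htend := tendsto_measure_iInter_atTop (μ := ρ)
      (s := fun N => (⋃ n, U n) \ ⋃ n ∈ Finset.range N, K n)
      (fun N => ((MeasurableSet.iUnion hUm).diff
        (Finset.measurableSet_biUnion _ fun n _ => hKm n)).nullMeasurableSet)
      (fun M N hMN => sdiff_subset_sdiff_right (biUnion_subset_biUnion_left
        (Finset.range_mono hMN))) ⟨0, measure_ne_top _ _⟩
    have heq : ⋂ N, (⋃ n, U n) \ ⋃ n ∈ Finset.range N, K n = (⋃ n, U n) \ ⋃ n, K n := by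
      rw [← sdiff_iUnion]
      congr 1
      ext ω
      simp only [mem_iUnion, Finset.mem_range]
      exact ⟨fun ⟨_, n, _, h⟩ => ⟨n, h⟩, fun ⟨n, h⟩ => ⟨n + 1, n, n.lt_succ_self, h⟩⟩
    rw [heq] at htend
    obtain ⟨N, hN⟩ := (htend.eventually_lt_const hlim).exists
    exact ⟨⋃ n ∈ Finset.range N, K n, ⋃ n, U n,
      Set.Finite.isClosed_biUnion (Finset.range N).finite_toSet fun n _ => hK n,
      Finset.measurableSet_biUnion _ fun n _ => hKm n, isOpen_iUnion hU, .iUnion hUm,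
      iUnion₂_subset fun n _ => (hKE n).trans (subset_iUnion E n), iUnion_mono hEU, hN⟩

theorem isRegular_of_variation_le {μ : ComplexMeasure (Omega A)} {ρ : Measure (Omega A)}
    [IsFiniteMeasure ρ] (h : μ.variation ≤ ρ) : IsRegular μ := by
  intro E hE ε hε
  obtain ⟨K, U, hK, hKm, hU, hUm, hKE, hEU, hlt⟩ :=
    exists_isClosed_isOpen_measure_diff_lt ρ hE ε hε
  exact ⟨K, U, hK.isCompact, hKm, hU, hUm, hKE, hEU, (h _).trans_lt hlt⟩

end Regularity

/-! ### Complex multiples of finite measures. -/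

section ComplexMultiples

variable {X : Type*} [MeasurableSpace X]

/-- The complex measure `c ρ`. -/
def complexMul (c : ℂ) (ρ : Measure X) [IsFiniteMeasure ρ] : ComplexMeasure X :=
  ρ.toSignedMeasure.mapRange (LinearMap.toSpanSingleton ℝ ℂ c).toAddMonoidHom
    (LinearMap.toSpanSingleton ℝ ℂ c).continuous_of_finiteDimensional

variable {ρ : Measure X} [IsFiniteMeasure ρ]

theorem complexMul_apply (c : ℂ) {E : Set X} (hE : MeasurableSet E) :
    complexMul c ρ E = ρ.real E * c := by
  rw [← Measure.toSignedMeasure_apply_measurable hE, ← Complex.real_smul]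
  rfl

theorem complexMul_neg (c : ℂ) : complexMul (-c) ρ = -complexMul c ρ := by
  ext E hE
  rw [neg_apply, complexMul_apply c hE, complexMul_apply (-c) hE]
  ring

theorem variation_complexMul_le (c : ℂ) : (complexMul c ρ).variation ≤ ‖c‖₊ • ρ := by
  refine VectorMeasure.variation_le_of_forall_enorm_le fun E hE => ?_
  rw [complexMul_apply c hE, enorm_mul, Measure.smul_apply, mul_comm]
  refine le_of_eq ?_
  rw [ENNReal.smul_def, smul_eq_mul]
  congr 1
  rw [← ofReal_norm, Complex.norm_real, Real.norm_of_nonneg measureReal_nonneg, measureReal_def,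
    ENNReal.ofReal_toReal (measure_ne_top ρ E)]

theorem integrable_variation_complexMul (c : ℂ) {f : X → ℂ} (hf : Integrable f ρ) :
    Integrable f (complexMul c ρ).variation :=
  Integrable.of_measure_le_smul (c := (‖c‖₊ : ℝ≥0∞)) ENNReal.coe_ne_top
    (variation_complexMul_le c) hf

theorem integral_complexMul (c : ℂ) {f : X → ℂ} (hf : Integrable f ρ) :
    VectorMeasure.integral (complexMul c ρ) f (ContinuousLinearMap.mul ℝ ℂ) =
      c * ∫ x, f x ∂ρ := by
  set B := ContinuousLinearMap.mul ℝ ℂ with hB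
  have hT0 := dominatedFinMeasAdditive_cbmApplyMeasure (complexMul c ρ) B
  have hT : DominatedFinMeasAdditive ρ ((complexMul c ρ).transpose B) (‖c‖ * ‖B‖) := by
    refine ⟨fun s t hs ht _ _ hd => cbmApplyMeasure_union _ B hs ht hd, fun s hs _ => ?_⟩
    refine (norm_cbmApplyMeasure_le (complexMul c ρ) B s).trans_eq ?_
    rw [complexMul_apply c hs, norm_mul, Complex.norm_real,
      Real.norm_of_nonneg measureReal_nonneg]
    ring
  -- Computing the integral relative to ρ instead of the variation makes induction over ρ-integrable
  -- functions available.
  rw [VectorMeasure.integral_eq_setToFun, ← setToFun_congr_measure_of_integrable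
    (‖c‖₊ : ℝ≥0∞) ENNReal.coe_ne_top (variation_complexMul_le c) hT hT0 f hf]
  refine Integrable.induction (μ := ρ) (fun f => setToFun ρ ((complexMul c ρ).transpose B) hT f =
    c * ∫ x, f x ∂ρ) (fun d s hs hμ => ?_) (fun f g _ hf hg h1 h2 => ?_) ?_ (fun f g h _ h1 => ?_) hf
  · rw [setToFun_indicator_const hT hs hμ.ne, integral_indicator_const _ hs]
    change d * complexMul c ρ _ = _
    rw [complexMul_apply c hs, Complex.real_smul]
    ring
  · rw [setToFun_add hT hf hg, h1, h2, integral_add' hf hg, mul_add]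
  · exact isClosed_eq (continuous_setToFun hT) (continuous_const.mul continuous_integral)
  · rw [← setToFun_congr_ae hT h, h1, integral_congr_ae h]

end ComplexMultiples

/-! ### Algebra and integrals of Walsh characters. -/

section WalshCharacters

variable {A : Type*}

theorem continuous_walshChar (F : Finset A) : Continuous (walshChar F) :=
  continuous_finsetProd _ fun α _ =>
    (continuous_of_discreteTopology (f := fun u : ℤˣ => ((u : ℤ) : ℂ))).comp (continuous_apply α)

theorem measurable_walshChar (F : Finset A) : Measurable (walshChar F) :=
  Finset.measurable_fun_prod _ fun α _ =>
    (Measurable.of_discrete (f := fun u : ℤˣ => ((u : ℤ) : ℂ))).comp (measurable_pi_apply α)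

theorem norm_unit_cast (u : ℤˣ) : ‖((u : ℤ) : ℂ)‖ = 1 := by
  rcases Int.units_eq_one_or u with rfl | rfl <;> simp

theorem unit_cast_mul_self (u : ℤˣ) : ((u : ℤ) : ℂ) * ((u : ℤ) : ℂ) = 1 := by
  rcases Int.units_eq_one_or u with rfl | rfl <;> simp

theorem norm_walshChar (F : Finset A) (ω : Omega A) : ‖walshChar F ω‖ = 1 := by
  rw [walshChar, norm_prod]
  exact Finset.prod_eq_one fun α _ => norm_unit_cast _

theorem star_walshChar (F : Finset A) (ω : Omega A) :
    starRingEnd ℂ (walshChar F ω) = walshChar F ω := by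
  simp [walshChar, map_prod]

theorem walshChar_mul_inv (F : Finset A) (ω ω' : Omega A) :
    walshChar F (ω * ω'⁻¹) = walshChar F ω * walshChar F ω' := by
  simp [walshChar, Finset.prod_mul_distrib, Int.units_inv_eq_self]

theorem walshChar_one (F : Finset A) : walshChar F 1 = 1 := by
  simp [walshChar]

theorem walshChar_mul [DecidableEq A] (F G : Finset A) (ω : Omega A) :
    walshChar F ω * walshChar G ω = walshChar (symmDiff F G) ω := by
  have hd : Disjoint (F \ G) (G \ F) := disjoint_sdiff_sdiff
  have hsq : (∏ α ∈ F ∩ G, (((ω α : ℤˣ) : ℤ) : ℂ)) * ∏ α ∈ F ∩ G, (((ω α : ℤˣ) : ℤ) : ℂ) = 1 := by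
    rw [← Finset.prod_mul_distrib]
    exact Finset.prod_eq_one fun α _ => unit_cast_mul_self _
  have h1 := Finset.prod_inter_mul_prod_sdiff F G fun α => (((ω α : ℤˣ) : ℤ) : ℂ)
  have h2 := Finset.prod_inter_mul_prod_sdiff G F fun α => (((ω α : ℤˣ) : ℤ) : ℂ)
  rw [Finset.inter_comm G F] at h2
  have h3 : symmDiff F G = F \ G ∪ G \ F := rfl
  rw [h3, walshChar, walshChar, walshChar, Finset.prod_union hd, ← h1, ← h2]
  linear_combination (∏ α ∈ F \ G, (((ω α : ℤˣ) : ℤ) : ℂ)) *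
    (∏ α ∈ G \ F, (((ω α : ℤˣ) : ℤ) : ℂ)) * hsq

theorem integrable_walshChar (F : Finset A) (ρ : Measure (Omega A)) [IsFiniteMeasure ρ] :
    Integrable (walshChar F) ρ :=
  Integrable.of_bound (measurable_walshChar F).aestronglyMeasurable 1
    (Filter.Eventually.of_forall fun ω => (norm_walshChar F ω).le)

theorem integral_walshChar_infinitePi (ν : A → Measure ℤˣ) [∀ α, IsProbabilityMeasure (ν α)]
    (F : Finset A) :
    ∫ ω, walshChar F ω ∂Measure.infinitePi ν = ∏ α ∈ F, ∫ u, ((u : ℤ) : ℂ) ∂ν α := by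
  have h (ω : Omega A) : walshChar F ω =
      (fun y : (∀ _ : F, ℤˣ) => ∏ α : F, ((y α : ℤ) : ℂ)) (F.restrict ω) :=
    (Finset.prod_coe_sort F fun α => (((ω α : ℤˣ) : ℤ) : ℂ)).symm
  simp only [h]
  rw [integral_restrict_infinitePi (μ := ν)
    (f := fun y : (∀ _ : F, ℤˣ) => ∏ α : F, ((y α : ℤ) : ℂ)) (Measurable.of_discrete).aestronglyMeasurable,
    integral_fintype_prod_eq_prod (fun (α : F) (u : ℤˣ) => ((u : ℤ) : ℂ)),
    Finset.prod_coe_sort F fun α => ∫ u, ((u : ℤ) : ℂ) ∂ν α]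

theorem integral_walshChar_haarP [DecidableEq A] (F : Finset A) :
    ∫ ω, walshChar F ω ∂haarP A = if F = ∅ then 1 else 0 := by
  rw [haarP, integral_walshChar_infinitePi]
  have h : ∫ u : ℤˣ, ((u : ℤ) : ℂ) ∂(PMF.uniformOfFintype ℤˣ).toMeasure = 0 := by
    rw [PMF.integral_eq_sum]
    simp
  rw [h, Finset.prod_const]
  split_ifs with hF
  · simp [hF]
  · rw [zero_pow (Finset.card_ne_zero.2 (Finset.nonempty_iff_ne_empty.2 hF))]

end WalshCharacters

/-! ### Riesz products as products of Bernoulli measures. -/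

section RieszProducts

variable {A : Type*}

/-- The distribution on `{-1, 1}` with mean `max (-1) (min 1 t)`. -/
def bern (t : ℝ) : Measure ℤˣ :=
  ENNReal.ofReal ((1 + max (-1) (min 1 t)) / 2) • Measure.dirac 1 +
    ENNReal.ofReal ((1 - max (-1) (min 1 t)) / 2) • Measure.dirac (-1)

theorem clip_bounds (t : ℝ) :
    0 ≤ (1 + max (-1) (min 1 t)) / 2 ∧ 0 ≤ (1 - max (-1) (min 1 t)) / 2 := by
  have h1 : -1 ≤ max (-1) (min 1 t) := le_max_left _ _
  have h2 : max (-1) (min 1 t) ≤ 1 := max_le (by norm_num) (min_le_left _ _)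
  constructor <;> linarith

instance (t : ℝ) : IsProbabilityMeasure (bern t) := by
  constructor
  rw [bern, Measure.add_apply, Measure.smul_apply, Measure.smul_apply, measure_univ, measure_univ,
    smul_eq_mul, smul_eq_mul, mul_one, mul_one,
    ← ENNReal.ofReal_add (clip_bounds t).1 (clip_bounds t).2]
  rw [show (1 + max (-1) (min 1 t)) / 2 + (1 - max (-1) (min 1 t)) / 2 = 1 by ring]
  exact ENNReal.ofReal_one

theorem integral_bern {t : ℝ} (ht : |t| ≤ 1) : ∫ u, ((u : ℤ) : ℂ) ∂bern t = t := by
  obtain ⟨h1, h2⟩ := abs_le.1 ht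
  have hc := clip_bounds t
  have hcl : max (-1) (min 1 t) = t := by rw [min_eq_right h2, max_eq_right h1]
  rw [hcl] at hc
  rw [bern, hcl, integral_add_measure (Integrable.of_finite.smul_measure ENNReal.ofReal_ne_top)
    (Integrable.of_finite.smul_measure ENNReal.ofReal_ne_top),
    integral_smul_measure, integral_smul_measure, integral_dirac, integral_dirac,
    ENNReal.toReal_ofReal hc.1, ENNReal.toReal_ofReal hc.2]
  apply Complex.ext <;> simp
  ring

/-- The Riesz product `∏ (1 + t_α r_α)`, a product of Bernoulli measures. -/
def riesz (t : A → ℝ) : Measure (Omega A) := Measure.infinitePi fun α => bern (t α)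

instance (t : A → ℝ) : IsProbabilityMeasure (riesz t) := by unfold riesz; infer_instance

theorem integral_walshChar_riesz {t : A → ℝ} (ht : ∀ α, |t α| ≤ 1) (F : Finset A) :
    ∫ ω, walshChar F ω ∂riesz t = ∏ α ∈ F, (t α : ℂ) := by
  rw [riesz, integral_walshChar_infinitePi]
  exact Finset.prod_congr rfl fun α _ => integral_bern (ht α)

end RieszProducts

/-! ### Density of Walsh polynomials in C(Ω). -/

section Density

variable {A : Type*}

/-- The Walsh characters as continuous functions. -/
def walshC (F : Finset A) : C(Omega A, ℂ) := ⟨walshChar F, continuous_walshChar F⟩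

theorem walshC_mul [DecidableEq A] (F G : Finset A) :
    walshC F * walshC G = walshC (symmDiff F G) := by
  ext ω
  exact walshChar_mul F G ω

theorem mul_mem_span_walshC {f g : C(Omega A, ℂ)}
    (hf : f ∈ Submodule.span ℂ (Set.range (walshC (A := A))))
    (hg : g ∈ Submodule.span ℂ (Set.range (walshC (A := A)))) :
    f * g ∈ Submodule.span ℂ (Set.range (walshC (A := A))) := by
  classical
  have h := Submodule.mul_mem_mul hf hg
  rw [Submodule.span_mul_span] at h
  refine Submodule.span_mono ?_ h
  rintro _ ⟨_, ⟨F, rfl⟩, _, ⟨G, rfl⟩, rfl⟩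
  exact ⟨symmDiff F G, (walshC_mul F G).symm⟩

/-- The algebra of Walsh polynomials. -/
def walshAlg (A : Type*) : StarSubalgebra ℂ C(Omega A, ℂ) where
  toSubalgebra := (Submodule.span ℂ (Set.range (walshC (A := A)))).toSubalgebra
    (Submodule.subset_span ⟨∅, by ext ω; simp [walshC, walshChar]⟩)
    fun _ _ hf hg => mul_mem_span_walshC hf hg
  star_mem' := by
    intro f hf
    change f ∈ Submodule.span ℂ (Set.range (walshC (A := A))) at hf
    change star f ∈ Submodule.span ℂ (Set.range (walshC (A := A)))
    induction hf using Submodule.span_induction with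
    | mem f hf =>
      obtain ⟨F, rfl⟩ := hf
      have : star (walshC F) = walshC F := by
        ext ω
        exact star_walshChar F ω
      rw [this]
      exact Submodule.subset_span ⟨F, rfl⟩
    | zero => simp
    | add f g _ _ h1 h2 => rw [star_add]; exact add_mem h1 h2
    | smul c f _ h => rw [star_smul]; exact Submodule.smul_mem _ _ h

theorem mem_closure_span_walshC (g : C(Omega A, ℂ)) :
    g ∈ closure (Submodule.span ℂ (Set.range (walshC (A := A))) : Set C(Omega A, ℂ)) := by
  have hsep : (walshAlg A).SeparatesPoints := by
    intro ω ω' hne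
    obtain ⟨α, hα⟩ := Function.ne_iff.1 hne
    refine ⟨walshC {α}, ⟨walshC {α}, Submodule.subset_span ⟨{α}, rfl⟩, rfl⟩, ?_⟩
    simpa [walshC, walshChar, Units.ext_iff] using hα
  have h := ContinuousMap.starSubalgebra_topologicalClosure_eq_top_of_separatesPoints _ hsep
  have hg : g ∈ (walshAlg A).topologicalClosure := h ▸ StarSubalgebra.mem_top
  exact hg

/-- For uncountable A the cylinder σ-field is smaller than the Borel one, so continuity alone does
not suffice. A continuous function is a limit of Walsh polynomials, which depend on finitely many
coordinates. -/
theorem measurable_continuousMap (g : C(Omega A, ℂ)) : Measurable g := by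
  obtain ⟨u, hu, hlim⟩ := mem_closure_iff_seq_limit.1 (mem_closure_span_walshC g)
  refine measurable_of_tendsto_metrizable (f := fun n => ⇑(u n)) (fun n => ?_)
    (tendsto_pi_nhds.2 fun ω => ((continuous_eval_const ω).tendsto g).comp hlim)
  have hn := hu n
  generalize u n = f at hn
  induction hn using Submodule.span_induction with
  | mem f hf => obtain ⟨F, rfl⟩ := hf; exact measurable_walshChar F
  | zero => exact measurable_const
  | add f g _ _ h1 h2 => exact h1.add h2
  | smul c f _ h => exact h.const_mul c

theorem integrable_continuousMap (g : C(Omega A, ℂ)) (ρ : Measure (Omega A)) [IsFiniteMeasure ρ] :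
    Integrable g ρ :=
  Integrable.of_bound (measurable_continuousMap g).aestronglyMeasurable ‖g‖
    (Filter.Eventually.of_forall fun ω => g.norm_coe_le_norm ω)

/-- A Lipschitz bound uniform in ξ turns convergence of test vectors into uniform convergence of
functions of ξ. All density arguments for weak* continuity go through this. -/
theorem isClosed_setOf_continuous {X E : Type*} [TopologicalSpace X] [SeminormedAddCommGroup E]
    {ψ : X → E → ℂ} {C : ℝ} (hψ : ∀ ξ g h, ‖ψ ξ g - ψ ξ h‖ ≤ C * ‖g - h‖) :
    IsClosed {g | Continuous fun ξ => ψ ξ g} := by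
  refine isClosed_of_closure_subset fun g hg => ?_
  refine continuous_of_uniform_approx_of_continuous fun u hu => ?_
  obtain ⟨ε, hε, hu⟩ := Metric.mem_uniformity_dist.1 hu
  have hC : 0 < |C| + 1 := by positivity
  obtain ⟨h, hh, hgh⟩ := Metric.mem_closure_iff.1 hg (ε / (|C| + 1)) (by positivity)
  refine ⟨fun ξ => ψ ξ h, hh, fun ξ => hu ?_⟩
  rw [dist_eq_norm] at hgh ⊢
  rw [lt_div_iff₀ hC] at hgh
  refine (hψ ξ g h).trans_lt ?_
  nlinarith [le_abs_self C, norm_nonneg (g - h)]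

theorem continuous_integral_riesz {X : Type*} [TopologicalSpace X] {t : X → A → ℝ}
    (ht : ∀ ξ α, |t ξ α| ≤ 1) (hc : ∀ α, Continuous fun ξ => t ξ α) (g : C(Omega A, ℂ)) :
    Continuous fun ξ => ∫ ω, g ω ∂riesz (t ξ) := by
  have hcl : IsClosed {g : C(Omega A, ℂ) | Continuous fun ξ => ∫ ω, g ω ∂riesz (t ξ)} := by
    refine isClosed_setOf_continuous (C := 1) fun ξ g h => ?_
    rw [← integral_sub (integrable_continuousMap g _) (integrable_continuousMap h _), one_mul]
    refine (norm_integral_le_of_norm_le_const (C := ‖g - h‖)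
      (Filter.Eventually.of_forall fun ω => (g - h).norm_coe_le_norm ω)).trans ?_
    simp
  refine closure_minimal (fun f hf => ?_) hcl (mem_closure_span_walshC g)
  induction hf using Submodule.span_induction with
  | mem f hf =>
    obtain ⟨F, rfl⟩ := hf
    change Continuous fun ξ => ∫ ω, walshChar F ω ∂riesz (t ξ)
    simp only [integral_walshChar_riesz (ht _)]
    exact continuous_finsetProd _ fun α _ => Complex.continuous_ofReal.comp (hc α)
  | zero => simpa using continuous_const
  | add f g _ _ h1 h2 =>
    change Continuous fun ξ => ∫ ω, f ω + g ω ∂riesz (t ξ)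
    simp only [integral_add (integrable_continuousMap f _) (integrable_continuousMap g _)]
    exact h1.add h2
  | smul c f _ h =>
    change Continuous fun ξ => ∫ ω, c • f ω ∂riesz (t ξ)
    simp only [integral_smul]
    exact h.const_smul c

end Density

/-! ### Synthesis in L² and sup-norm bounds. -/

section WalshSeries

variable {A : Type*}

theorem memLp_walshChar (F : Finset A) (r : ℝ≥0∞) : MemLp (walshChar F) r (haarP A) :=
  MemLp.of_bound (measurable_walshChar F).aestronglyMeasurable 1
    (Filter.Eventually.of_forall fun ω => (norm_walshChar F ω).le)

/-- The Walsh characters as elements of `L^2`. -/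
def walshL2 (F : Finset A) : Lp ℂ 2 (haarP A) := (memLp_walshChar F 2).toLp _

theorem coeFn_walshL2 (F : Finset A) : walshL2 F =ᵐ[haarP A] walshChar F := MemLp.coeFn_toLp _

theorem orthonormal_walshL2 (A : Type*) : Orthonormal ℂ (walshL2 (A := A)) := by
  classical
  rw [orthonormal_iff_ite]
  intro F G
  rw [L2.inner_def]
  have h : ∫ ω, inner ℂ (walshL2 F ω) (walshL2 G ω) ∂haarP A =
      ∫ ω, walshChar (symmDiff G F) ω ∂haarP A := by
    refine integral_congr_ae ?_
    filter_upwards [coeFn_walshL2 F, coeFn_walshL2 G] with ω h1 h2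
    rw [h1, h2, RCLike.inner_apply, star_walshChar, walshChar_mul]
  rw [h, integral_walshChar_haarP]
  have h2 : symmDiff G F = ∅ ↔ F = G := by
    rw [← Finset.bot_eq_empty, symmDiff_eq_bot, eq_comm]
  simp only [h2]

/-- The synthesis operator `l^2(W_A) → L^2`. -/
def walshIso (A : Type*) : lp (fun _ : Finset A => ℂ) 2 →ₗᵢ[ℂ] Lp ℂ 2 (haarP A) :=
  (orthonormal_walshL2 A).orthogonalFamily.linearIsometry

theorem hasSum_walshIso (b : lp (fun _ : Finset A => ℂ) 2) :
    HasSum (fun F => b F • walshL2 F) (walshIso A b) :=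
  (orthonormal_walshL2 A).orthogonalFamily.hasSum_linearIsometry b

/-- The inclusion of `l^p` in `l^r` for `p ≤ r`. -/
def lpIncl (ι : Type*) {p r : ℝ≥0∞} [Fact (1 ≤ p)] [Fact (1 ≤ r)] (h : p ≤ r) :
    lp (fun _ : ι => ℂ) p →L[ℂ] lp (fun _ : ι => ℂ) r where
  toLinearMap := lp.linearMapOfLE ℂ _ h
  cont := by
    -- Convergence in either norm implies coordinatewise convergence, so the two limits agree and
    -- the closed graph theorem applies.
    refine LinearMap.continuous_of_seq_closed_graph _ fun u x y hu hTu => ?_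
    ext i
    have h1 : Filter.Tendsto (fun n => u n i) Filter.atTop (𝓝 (x i)) :=
      ((lp.evalCLM ℂ (fun _ : ι => ℂ) p i).continuous.tendsto x).comp hu
    have h2 : Filter.Tendsto (fun n => lp.linearMapOfLE ℂ (fun _ : ι => ℂ) h (u n) i)
        Filter.atTop (𝓝 (y i)) :=
      ((lp.evalCLM ℂ (fun _ : ι => ℂ) r i).continuous.tendsto y).comp hTu
    simp only [lp.coe_linearMapOfLE_apply] at h2 ⊢
    exact tendsto_nhds_unique h2 h1

variable {p : ℝ≥0∞} [Fact (1 ≤ p)]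

/-- The synthesis operator `l^p(W_A) → L^2` for `p ≤ 2`. -/
def walshSum (A : Type*) (h : p ≤ 2) : lp (fun _ : Finset A => ℂ) p →L[ℂ] Lp ℂ 2 (haarP A) :=
  (walshIso A).toContinuousLinearMap ∘L lpIncl _ h

theorem hasSum_walshSum (h : p ≤ 2) (b : lp (fun _ : Finset A => ℂ) p) :
    HasSum (fun F => b F • walshL2 F) (walshSum A h b) :=
  hasSum_walshIso (lpIncl _ h b)

/-- The elements of `L^2` bounded by `C`. -/
def bddSet (A : Type*) (C : ℝ) : Set (Lp ℂ 2 (haarP A)) := {h | ∀ᵐ ω ∂haarP A, ‖h ω‖ ≤ C}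

/-- An L²-convergent sequence has an a.e. convergent subsequence, along which the pointwise bound
persists. -/
theorem isClosed_bddSet (C : ℝ) : IsClosed (bddSet A C) := by
  refine isClosed_of_closure_subset fun h hh => ?_
  obtain ⟨u, hu, hlim⟩ := mem_closure_iff_seq_limit.1 hh
  obtain ⟨ns, -, hns⟩ := (tendstoInMeasure_of_tendsto_Lp hlim).exists_seq_tendsto_ae
  filter_upwards [hns, ae_all_iff.2 hu] with ω h1 h2
  exact le_of_tendsto h1.norm (Filter.Eventually.of_forall fun n => h2 _)

theorem add_mem_bddSet {C D : ℝ} {g h : Lp ℂ 2 (haarP A)} (hg : g ∈ bddSet A C)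
    (hh : h ∈ bddSet A D) : g + h ∈ bddSet A (C + D) := by
  filter_upwards [hg, hh, Lp.coeFn_add g h] with ω h1 h2 h3
  rw [h3]
  exact (norm_add_le _ _).trans (add_le_add h1 h2)

theorem smul_mem_bddSet {C : ℝ} {h : Lp ℂ 2 (haarP A)} (hh : h ∈ bddSet A C) (c : ℂ) :
    c • h ∈ bddSet A (‖c‖ * C) := by
  filter_upwards [hh, Lp.coeFn_smul c h] with ω h1 h2
  rw [h2, Pi.smul_apply, norm_smul]
  gcongr

theorem mem_bddSet_of_hasSum {f : ℕ → Lp ℂ 2 (haarP A)} {h : Lp ℂ 2 (haarP A)} {a : ℕ → ℝ} {C : ℝ}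
    (hf : ∀ j, f j ∈ bddSet A (a j)) (ha : HasSum a C) (ha0 : ∀ j, 0 ≤ a j) (hs : HasSum f h) :
    h ∈ bddSet A C := by
  refine (isClosed_bddSet C).mem_of_tendsto hs.tendsto_sum_nat (Filter.Eventually.of_forall fun n => ?_)
  have h1 : ∑ j ∈ Finset.range n, f j ∈ bddSet A (∑ j ∈ Finset.range n, a j) := by
    induction n with
    | zero =>
      change ∀ᵐ ω ∂haarP A, _
      filter_upwards [Lp.coeFn_zero ℂ 2 (haarP A)] with ω h0
      rw [Finset.sum_range_zero, Finset.sum_range_zero, h0, Pi.zero_apply, norm_zero]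
    | succ n ih =>
      rw [Finset.sum_range_succ, Finset.sum_range_succ]
      exact add_mem_bddSet ih (hf n)
  change ∀ᵐ ω ∂haarP A, _
  filter_upwards [h1] with ω hω
  exact hω.trans (sum_le_hasSum _ (fun j _ => ha0 j) ha)

theorem coeFn_sum_walshL2 {J : Type*} (S : Finset J) (c : J → ℂ) (e : J → Finset A) :
    ((∑ i ∈ S, c i • walshL2 (e i) : Lp ℂ 2 (haarP A)) : Omega A → ℂ) =ᵐ[haarP A]
      fun ω => ∑ i ∈ S, c i * walshChar (e i) ω := by
  classical
  induction S using Finset.induction_on with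
  | empty => simp only [Finset.sum_empty]; exact Lp.coeFn_zero ℂ 2 (haarP A)
  | insert i S hi ih =>
    rw [Finset.sum_insert hi]
    filter_upwards [Lp.coeFn_add (c i • walshL2 (e i)) (∑ i ∈ S, c i • walshL2 (e i)), ih,
      Lp.coeFn_smul (c i) (walshL2 (e i)), coeFn_walshL2 (e i)] with ω h1 h2 h3 h4
    rw [h1, Pi.add_apply, h2, h3, Pi.smul_apply, h4, Finset.sum_insert hi, smul_eq_mul]

theorem sum_monom_imWeight_powerset {t : A → ℝ} (S : Finset A) :
    ∑ F ∈ S.powerset, monom imWeight (fun α => (t α : ℂ)) F =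
      ((∏ α ∈ S, (1 + Complex.I * t α)).im : ℂ) := by
  classical
  rw [Finset.prod_one_add, Complex.im_sum, Complex.ofReal_sum]
  refine Finset.sum_congr rfl fun F _ => ?_
  rw [monom, imWeight, Finset.prod_mul_distrib, Finset.prod_const, ← Complex.ofReal_prod, Complex.im_mul_ofReal, Complex.ofReal_mul]

/-- The source of √e: |1 + it|² = 1 + t² ≤ exp(t²). -/
theorem norm_prod_one_add_I_mul_le (t : A → ℝ) (S : Finset A) (h : ∑ α ∈ S, t α ^ 2 ≤ 1) :
    ‖∏ α ∈ S, (1 + Complex.I * t α)‖ ≤ √(Real.exp 1) := by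
  rw [norm_prod]
  refine Real.le_sqrt_of_sq_le ?_
  rw [← Finset.prod_pow]
  calc ∏ α ∈ S, ‖1 + Complex.I * (t α : ℂ)‖ ^ 2
      ≤ ∏ α ∈ S, Real.exp (t α ^ 2) := by
        refine Finset.prod_le_prod (fun α _ => sq_nonneg _) fun α _ => ?_
        have : ‖1 + Complex.I * (t α : ℂ)‖ ^ 2 = t α ^ 2 + 1 := by
          rw [← Complex.normSq_eq_norm_sq, Complex.normSq_apply]
          simp
          ring
        rw [this]
        exact Real.add_one_le_exp _
    _ = Real.exp (∑ α ∈ S, t α ^ 2) := (Real.exp_sum _ _).symm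
    _ ≤ Real.exp 1 := Real.exp_le_exp.2 h

/-- Here p ≤ 2 provides the l²-bound which makes the products ∏(1 + i t_α) bounded. -/
theorem sum_sq_le_one (h : p ≤ 2) {ι : Type*} {z : lp (fun _ : ι => ℂ) p} (hz : ‖z‖ ≤ 1)
    (S : Finset ι) : ∑ i ∈ S, ‖z i‖ ^ 2 ≤ 1 := by
  have hp : p ≠ ∞ := ne_top_of_le_ne_top (by simp) h
  have h1 := one_le_toReal hp
  have h2 : p.toReal ≤ 2 := by simpa using ENNReal.toReal_mono (by simp) h
  calc ∑ i ∈ S, ‖z i‖ ^ 2 ≤ ∑ i ∈ S, ‖z i‖ ^ p.toReal := by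
        refine Finset.sum_le_sum fun i _ => ?_
        rw [← Real.rpow_two]
        exact Real.rpow_le_rpow_of_exponent_ge' (norm_nonneg _) ((norm_apply_le z i).trans hz)
          (by linarith) h2
    _ ≤ ‖z‖ ^ p.toReal := lp.sum_rpow_le_norm_rpow (by linarith) z S
    _ ≤ 1 := Real.rpow_le_one (norm_nonneg _) hz (by linarith)

theorem walshChar_map {ι : Type*} (e : ι ↪ A) (F : Finset ι) (ω : Omega A) :
    walshChar (F.map e) ω = ∏ i ∈ F, (((ω (e i) : ℤˣ) : ℤ) : ℂ) := by
  rw [walshChar, Finset.prod_map]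

theorem walshSum_lpMonom_mem_bddSet (h : p ≤ 2) (e : A ↪ A) {z : lp (fun _ : A => ℂ) p}
    (hz : ‖z‖ ≤ 1) (hr : IsRealSeq z) :
    walshSum A h (lpExt (Finset.mapEmbedding e).toEmbedding (lpMonom p imWeight z)) ∈
      bddSet A √(Real.exp 1) := by
  classical
  have hp : p ≠ ∞ := ne_top_of_le_ne_top (by simp) h
  have hs : HasSum (fun F => monom imWeight z F • walshL2 (F.map e))
      (walshSum A h (lpExt (Finset.mapEmbedding e).toEmbedding (lpMonom p imWeight z))) := by
    have h1 := hasSum_walshSum h (lpExt (Finset.mapEmbedding e).toEmbedding (lpMonom p imWeight z))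
    rw [← (Finset.mapEmbedding e).toEmbedding.injective.hasSum_iff] at h1
    · refine h1.congr_fun fun F => ?_
      rw [Function.comp_apply, lpExt_apply, lpMonom_apply isOddWeight_imWeight
        (inDom_of_ne_top hp hz)]
      rfl
    · intro G hG
      rw [lpExt_apply_of_notMem _ _ hG, zero_smul]
  -- Powersets of finite sets are cofinal among finite families, and a partial sum over a powerset
  -- is the imaginary part of a finite product with parameters t_α = z(α)ω(e α).
  refine (isClosed_bddSet _).mem_of_tendsto
    (hs.comp (Filter.tendsto_finset_powerset_atTop_atTop (α := A))) (Filter.Eventually.of_forall fun S => ?_)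
  filter_upwards [coeFn_sum_walshL2 S.powerset (monom imWeight z) fun F => F.map e] with ω hω
  rw [Function.comp_apply, hω]
  set t : A → ℝ := fun α => (z α).re * ((ω (e α) : ℤˣ) : ℤ) with ht
  have h2 : ∑ F ∈ S.powerset, monom imWeight z F * walshChar (F.map e) ω =
      ∑ F ∈ S.powerset, monom imWeight (fun α => (t α : ℂ)) F := by
    refine Finset.sum_congr rfl fun F _ => ?_
    rw [walshChar_map, monom, monom, mul_assoc, ← Finset.prod_mul_distrib]
    congr 1
    refine Finset.prod_congr rfl fun α _ => ?_
    have : z α = ((z α).re : ℂ) := Complex.ext rfl (hr α)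
    rw [ht, this]
    simp
  rw [h2, sum_monom_imWeight_powerset, Complex.norm_real]
  refine (Complex.abs_im_le_norm _).trans (norm_prod_one_add_I_mul_le t S ?_)
  refine le_trans (Finset.sum_le_sum fun α _ => ?_) (sum_sq_le_one h hz S)
  have h3 : ((((ω (e α) : ℤˣ) : ℤ) : ℝ)) ^ 2 = 1 := by
    rcases Int.units_eq_one_or (ω (e α)) with h | h <;> simp [h]
  rw [ht, mul_pow, h3, mul_one, ← sq_abs]
  gcongr
  exact Complex.abs_re_le_norm _

variable [Infinite A]

theorem walshSum_fnHat_mem_bddSet (h : p ≤ 2) {x : lp (fun _ : A => ℂ) p} (hx : ‖x‖ ≤ 1)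
    (hr : IsRealSeq x) :
    walshSum A h (fnHat x) ∈ bddSet A (√(Real.exp 1) / (1 - ratio p)) := by
  have hp : p ≠ ∞ := ne_top_of_le_ne_top (by simp) h
  have hT := isStep_layer_odd (p := p) hp (finsetEmb A)
  refine mem_bddSet_of_hasSum (fun j => ?_) (hasSum_ratio hp _)
    (fun j => mul_nonneg (pow_nonneg (ratio_pos p).le j) (Real.sqrt_nonneg _))
    ((walshSum A h).hasSum (hasSum_fnHat hp hx))
  rw [map_smul, ← norm_fnCoef]
  exact smul_mem_bddSet (walshSum_lpMonom_mem_bddSet h _ (hT.iterate_norm_le hx j)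
    (hT.iterate_real hx hr j)) _

theorem walshSum_fnHatC_mem_bddSet (h : p ≤ 2) {x : lp (fun _ : A => ℂ) p} (hx : ‖x‖ ≤ 1) :
    walshSum A h (fnHatC x) ∈ bddSet A (2 * √(Real.exp 1) / (1 - ratio p)) := by
  rw [fnHatC, map_add, map_smul]
  have h1 := walshSum_fnHat_mem_bddSet h ((norm_reSeq_le x).trans hx) (isRealSeq_reSeq x)
  have h2 := walshSum_fnHat_mem_bddSet h ((norm_imSeq_le x).trans hx) (isRealSeq_imSeq x)
  have h3 := add_mem_bddSet h1 (smul_mem_bddSet h2 Complex.I)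
  rw [Complex.norm_I, one_mul, ← two_mul, ← mul_div_assoc] at h3
  exact h3

end WalshSeries

/-! ### Walsh coefficients and weak* continuity in L^∞. -/

section Duality

variable {A : Type*} {p : ℝ≥0∞} [Fact (1 ≤ p)]

/-- The functional `h ↦ ∫ h g` on `L^2`. -/
def pairL2 {g : Omega A → ℂ} (hg : MemLp g 2 (haarP A)) : Lp ℂ 2 (haarP A) →L[ℂ] ℂ :=
  innerSL ℂ (hg.star.toLp (star g))

theorem pairL2_apply {g : Omega A → ℂ} (hg : MemLp g 2 (haarP A)) (h : Lp ℂ 2 (haarP A)) :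
    pairL2 hg h = ∫ ω, h ω * g ω ∂haarP A := by
  rw [pairL2, innerSL_apply_apply, L2.inner_def]
  refine integral_congr_ae ?_
  filter_upwards [hg.star.coeFn_toLp] with ω hω
  rw [hω, RCLike.inner_apply, Pi.star_apply, starRingEnd_apply, star_star]

theorem hasSum_integral_walshSum (h : p ≤ 2) (b : lp (fun _ : Finset A => ℂ) p) {g : Omega A → ℂ}
    (hg : MemLp g 2 (haarP A)) :
    HasSum (fun F => b F * ∫ ω, walshChar F ω * g ω ∂haarP A)
      (∫ ω, walshSum A h b ω * g ω ∂haarP A) := by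
  have h1 := (pairL2 hg).hasSum (hasSum_walshSum h b)
  rw [pairL2_apply] at h1
  refine h1.congr_fun fun F => ?_
  rw [map_smul, pairL2_apply, smul_eq_mul]
  congr 1
  refine integral_congr_ae ?_
  filter_upwards [coeFn_walshL2 F] with ω hω
  rw [hω]

theorem integral_walshChar_mul_walshSum (h : p ≤ 2) (b : lp (fun _ : Finset A => ℂ) p)
    (F : Finset A) : ∫ ω, walshChar F ω * walshSum A h b ω ∂haarP A = b F := by
  classical
  have h1 := hasSum_integral_walshSum h b (memLp_walshChar F 2)
  simp only [mul_comm (walshChar F _)]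
  refine h1.unique ((hasSum_ite_eq F (b F)).congr_fun fun G => ?_)
  simp only [walshChar_mul, integral_walshChar_haarP]
  have h2 : symmDiff G F = ∅ ↔ G = F := by rw [← Finset.bot_eq_empty, symmDiff_eq_bot]
  simp only [h2]
  split_ifs with hG <;> simp [hG]

/-- On bounded sets of l², coordinatewise continuity implies weak continuity: the representing
vector is approximated by finitely supported ones. -/
theorem continuous_clm_of_apply {ι X : Type*} [TopologicalSpace X]
    {b : X → lp (fun _ : ι => ℂ) 2} {C : ℝ} (hb : ∀ ξ, ‖b ξ‖ ≤ C)
    (hc : ∀ i, Continuous fun ξ => b ξ i) (Λ : lp (fun _ : ι => ℂ) 2 →L[ℂ] ℂ) :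
    Continuous fun ξ => Λ (b ξ) := by
  classical
  obtain ⟨a, rfl⟩ := (InnerProductSpace.toDual ℂ (lp (fun _ : ι => ℂ) 2)).surjective Λ
  simp only [InnerProductSpace.toDual_apply_apply]
  have hcl : IsClosed {a : lp (fun _ : ι => ℂ) 2 | Continuous fun ξ => inner ℂ a (b ξ)} := by
    refine isClosed_setOf_continuous (C := C) fun ξ g h => ?_
    rw [← inner_sub_left, mul_comm]
    exact (norm_inner_le_norm _ _).trans (mul_le_mul_of_nonneg_left (hb ξ) (norm_nonneg _))
  refine hcl.mem_of_tendsto (lp.hasSum_single (by simp) a) (Filter.Eventually.of_forall fun S => ?_)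
  change Continuous fun ξ => inner ℂ (∑ i ∈ S, lp.single 2 i (a i)) (b ξ)
  simp only [sum_inner, lp.inner_single_left]
  exact continuous_finsetSum _ fun i _ => continuous_const.inner (hc i)

theorem continuous_integral_walshSum {X : Type*} [TopologicalSpace X] (h : p ≤ 2)
    {b : X → lp (fun _ : Finset A => ℂ) p} {B : ℝ} (hb : ∀ ξ, ‖b ξ‖ ≤ B)
    (hc : ∀ F, Continuous fun ξ => b ξ F) {g : Omega A → ℂ} (hg : MemLp g 2 (haarP A)) :
    Continuous fun ξ => ∫ ω, walshSum A h (b ξ) ω * g ω ∂haarP A := by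
  simp only [← pairL2_apply hg]
  exact continuous_clm_of_apply (b := fun ξ => lpIncl (Finset A) h (b ξ))
    (fun ξ => ((lpIncl _ h).le_opNorm _).trans (mul_le_mul_of_nonneg_left (hb ξ) (norm_nonneg _)))
    hc (pairL2 hg ∘L (walshIso A).toContinuousLinearMap)

theorem integrable_mul_of_norm_le {f : Omega A → ℂ} (hf : AEStronglyMeasurable f (haarP A)) {C : ℝ}
    (hC : ∀ᵐ ω ∂haarP A, ‖f ω‖ ≤ C) (g : Lp ℂ 1 (haarP A)) :
    Integrable (fun ω => f ω * g ω) (haarP A) :=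
  (L1.integrable_coeFn g).bdd_mul hf hC

/-- The uniform bound C permits passing from L² test functions to their L¹-closure. -/
theorem continuous_integral_of_bddSet {X : Type*} [TopologicalSpace X] {f : X → Omega A → ℂ}
    (hf : ∀ ξ, AEStronglyMeasurable (f ξ) (haarP A)) {C : ℝ}
    (hC : ∀ ξ, ∀ᵐ ω ∂haarP A, ‖f ξ ω‖ ≤ C)
    (h2 : ∀ g : Omega A → ℂ, MemLp g 2 (haarP A) → Continuous fun ξ => ∫ ω, f ξ ω * g ω ∂haarP A)
    (g : Lp ℂ 1 (haarP A)) : Continuous fun ξ => ∫ ω, f ξ ω * g ω ∂haarP A := by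
  induction g using Lp.induction ENNReal.one_ne_top with
  | indicatorConst c hs hμs =>
    refine (h2 _ (memLp_indicator_const 2 hs c (Or.inr hμs.ne))).congr fun ξ => ?_
    refine integral_congr_ae ?_
    have h3 := Lp.simpleFunc.coe_indicatorConst (p := 1) hs hμs.ne c
    filter_upwards [indicatorConstLp_coeFn (p := 1) (hs := hs) (hμs := hμs.ne) (c := c)] with ω hω
    rw [h3, hω]
  | @add u v hu hv hd h1 h2 =>
    refine (h1.add h2).congr fun ξ => ?_
    rw [Pi.add_apply, ← integral_add (integrable_mul_of_norm_le (hf ξ) (hC ξ) _)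
      (integrable_mul_of_norm_le (hf ξ) (hC ξ) _)]
    refine integral_congr_ae ?_
    filter_upwards [Lp.coeFn_add (hu.toLp u) (hv.toLp v)] with ω hω
    rw [hω, Pi.add_apply, mul_add]
  | isClosed =>
    refine isClosed_setOf_continuous (C := C) fun ξ g h => ?_
    have h3 : ∫ ω, f ξ ω * g ω ∂haarP A - ∫ ω, f ξ ω * h ω ∂haarP A =
        ∫ ω, f ξ ω * (g - h) ω ∂haarP A := by
      rw [← integral_sub (integrable_mul_of_norm_le (hf ξ) (hC ξ) _)
        (integrable_mul_of_norm_le (hf ξ) (hC ξ) _)]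
      refine integral_congr_ae ?_
      filter_upwards [Lp.coeFn_sub g h] with ω hω
      rw [hω, Pi.sub_apply, mul_sub]
    rw [h3, L1.norm_eq_integral_norm, ← integral_const_mul]
    refine norm_integral_le_of_norm_le ((L1.integrable_coeFn _).norm.const_mul C) ?_
    filter_upwards [hC ξ] with ω hω
    rw [norm_mul]
    gcongr

end Duality

theorem Ball.norm_le {A : Type*} {p : ℝ≥0∞} [Fact (1 ≤ p)] (x : Ball A p) : ‖x.1‖ ≤ 1 :=
  mem_closedBall_zero_iff.1 x.2

theorem ne_top_of_le_two {p : ℝ≥0∞} (h : p ≤ 2) : p ≠ ∞ := ne_top_of_le_ne_top (by simp) h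

/-! ### The map Φ for p ≤ 2. -/

section BoundedFunctions

variable {A : Type*} [Infinite A] {p : ℝ≥0∞} [Fact (1 ≤ p)]

theorem memLp_walshSum_fnHatC (h : p ≤ 2) (x : Ball A p) :
    MemLp (walshSum A h (fnHatC x.1)) ∞ (haarP A) :=
  memLp_top_of_bound (Lp.aestronglyMeasurable _) _ (walshSum_fnHatC_mem_bddSet h x.norm_le)

/-- The bounded function attached to an element of the ball of `l^p` for `p ≤ 2`. -/
def phiFun (h : p ≤ 2) (x : Ball A p) : Lp ℂ ∞ (haarP A) := (memLp_walshSum_fnHatC h x).toLp _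

theorem coeFn_phiFun (h : p ≤ 2) (x : Ball A p) :
    phiFun h x =ᵐ[haarP A] walshSum A h (fnHatC x.1) := MemLp.coeFn_toLp _

theorem walshL_phiFun (h : p ≤ 2) (x : Ball A p) : walshL (phiFun h x) = fnHatC x.1 := by
  funext F
  rw [← integral_walshChar_mul_walshSum h (fnHatC x.1) F, walshL]
  refine integral_congr_ae ?_
  filter_upwards [coeFn_phiFun h x] with ω hω
  rw [hω]

theorem norm_phiFun_le (h : p ≤ 2) (x : Ball A p) :
    ‖phiFun h x‖ ≤ 2 * √(Real.exp 1) / (1 - ratio p) := by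
  refine Lp.norm_le_of_ae_bound (C := 2 * √(Real.exp 1) / (1 - ratio p)) ?_ ?_ |>.trans_eq (by simp)
  · exact div_nonneg (by positivity) (by linarith [ratio_lt_one (ne_top_of_le_two h)])
  · filter_upwards [coeFn_phiFun h x, walshSum_fnHatC_mem_bddSet h x.norm_le] with ω h1 h2
    rw [h1]
    exact h2

/-- The map `Φ` for `p ≤ 2`. -/
def phi (p : ℝ≥0∞) [Fact (1 ≤ p)] (h : p ≤ 2) (x : Ball A p) : LinfP A p :=
  ⟨phiFun h x, by rw [walshL_phiFun]; exact lp.memℓp _⟩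

theorem hat_phi (h : p ≤ 2) (x : Ball A p) : (phi p h x).hat = fnHatC x.1 :=
  Subtype.ext (walshL_phiFun h x)

theorem injective_phi (h : p ≤ 2) : Function.Injective (phi (A := A) p h) := by
  intro x y hxy
  have h1 := congrArg LinfP.hat hxy
  rw [hat_phi, hat_phi] at h1
  refine Subtype.ext (lp.ext (funext fun α => ?_))
  rw [← fnHatC_apply_singleton (ne_top_of_le_two h) x.norm_le,
    ← fnHatC_apply_singleton (ne_top_of_le_two h) y.norm_le, h1]

theorem nrm_phi_le (h : p ≤ 2) (x : Ball A p) :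
    (phi p h x).nrm ≤ 2 * √(Real.exp 1) / (1 - delta ^ (2 / p).toReal) := by
  refine max_le (norm_phiFun_le h x) ?_
  rw [hat_phi]
  exact (norm_fnHatC_le (ne_top_of_le_two h) x.norm_le).trans_eq (mul_div_assoc _ _ _).symm

theorem phi_neg (h : p ≤ 2) (x : Ball A p) : (phi p h (-x)).1 = -(phi p h x).1 := by
  refine Lp.ext ?_
  have h1 : walshSum A h (fnHatC (-x).1) = -walshSum A h (fnHatC x.1) := by
    rw [← map_neg, ← fnHatC_neg (ne_top_of_le_two h) x.norm_le]
    rfl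
  filter_upwards [coeFn_phiFun h (-x), coeFn_phiFun h x, Lp.coeFn_neg (phiFun h x),
    Lp.coeFn_neg (walshSum A h (fnHatC x.1))] with ω h2 h3 h4 h5
  change phiFun h (-x) ω = (-phiFun h x : Lp ℂ ∞ (haarP A)) ω
  rw [h2, h1, h5, h4, Pi.neg_apply, Pi.neg_apply, h3]

theorem continuous_hat_phi (h : p ≤ 2) : Continuous fun x : Ball A p => (phi p h x).hat := by
  simp only [hat_phi]
  exact (continuousOn_fnHatC (ne_top_of_le_two h)).comp_continuous continuous_subtype_val
    fun x => x.norm_le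

theorem continuous_weak_apply (A : Type*) (p : ℝ≥0∞) [Fact (1 ≤ p)] (α : A) :
    @Continuous _ _ (Ball.weak A p) _ fun x : Ball A p => x.1 α := by
  let _ := Ball.weak A p
  have h1 : Continuous fun x : Ball A p => toWeakSpace ℂ (lp (fun _ : A => ℂ) p) x.1 :=
    continuous_induced_dom
  exact (WeakBilin.eval_continuous (topDualPairing ℂ (lp (fun _ : A => ℂ) p)).flip
    (lp.evalCLM ℂ (fun _ : A => ℂ) p α)).comp h1

theorem continuous_phi (h : p ≤ 2) :
    @Continuous _ _ (Ball.weak A p) (LinfP.weakStar A p) (phi p h) := by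
  refine continuous_iInf_rng.2 fun g => continuous_induced_rng.2 ?_
  have hp := ne_top_of_le_two h
  refine @continuous_integral_of_bddSet A (Ball A p) (Ball.weak A p) (fun x => phiFun h x)
    (fun x => Lp.aestronglyMeasurable _) (2 * √(Real.exp 1) / (1 - ratio p)) (fun x => ?_)
    (fun g hg => ?_) g
  · filter_upwards [coeFn_phiFun h x, walshSum_fnHatC_mem_bddSet h x.norm_le] with ω h1 h2
    rw [h1]
    exact h2
  · let _ := Ball.weak A p
    refine (continuous_integral_walshSum h (b := fun x : Ball A p => fnHatC x.1)
      (fun x => norm_fnHatC_le hp x.norm_le) (continuous_fnHatC_apply hp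
      (u := fun x : Ball A p => x.1) (fun x => x.norm_le) (continuous_weak_apply A p)) hg).congr
      fun x => ?_
    refine integral_congr_ae ?_
    filter_upwards [coeFn_phiFun h x] with ω hω
    rw [hω]

theorem hasSum_integral_phi (x y : Ball A 2) :
    HasSum (fun F => (phi 2 le_rfl x).hat F * (phi 2 le_rfl y).hat F)
      (∫ ω, (phi 2 le_rfl x).1 ω * (phi 2 le_rfl y).1 ω ∂haarP A) := by
  have h2 : MemLp (phiFun le_rfl y) 2 (haarP A) := (Lp.memLp (phiFun le_rfl y)).mono_exponent le_top
  have h1 := hasSum_integral_walshSum le_rfl (fnHatC x.1) h2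
  have h3 : ∫ ω, walshSum A le_rfl (fnHatC x.1) ω * phiFun le_rfl y ω ∂haarP A =
      ∫ ω, (phi 2 le_rfl x).1 ω * (phi 2 le_rfl y).1 ω ∂haarP A := by
    refine integral_congr_ae ?_
    filter_upwards [coeFn_phiFun le_rfl x] with ω hω
    rw [← hω]
    rfl
  rw [h3] at h1
  refine h1.congr_fun fun F => ?_
  rw [hat_phi]
  rfl

end BoundedFunctions

/-! ### Translation invariance and an almost-everywhere criterion. -/

section Translation

variable {A : Type*}

theorem measurable_mul_inv_pair : Measurable fun z : Omega A × Omega A => z.1 * z.2⁻¹ := by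
  refine measurable_pi_iff.2 fun α => ?_
  have h : Measurable fun u : ℤˣ × ℤˣ => u.1 * u.2⁻¹ := Measurable.of_discrete
  exact h.comp (f := fun z : Omega A × Omega A => (z.1 α, z.2 α))
    (((measurable_pi_apply α).comp measurable_fst).prodMk
      ((measurable_pi_apply α).comp measurable_snd))

theorem measurable_mul_inv_left (c : Omega A) : Measurable fun ω : Omega A => ω * c⁻¹ :=
  measurable_mul_inv_pair.comp (measurable_id.prodMk measurable_const)

theorem measurable_mul_inv_right (c : Omega A) : Measurable fun ω : Omega A => c * ω⁻¹ :=
  measurable_mul_inv_pair.comp (measurable_const.prodMk measurable_id)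

theorem map_mul_inv_haarP (c : Omega A) : (haarP A).map (fun ω => ω * c⁻¹) = haarP A := by
  rw [haarP]
  have h := Measure.infinitePi_map_pi (μ := fun _ : A => (PMF.uniformOfFintype ℤˣ).toMeasure)
    (f := fun α (u : ℤˣ) => u * (c α)⁻¹) fun α => Measurable.of_discrete
  refine h.trans ?_
  congr 1
  funext α
  refine Measure.ext_of_singleton fun u => ?_
  have h2 : (fun u : ℤˣ => u * (c α)⁻¹) ⁻¹' {u} = {u * c α} := by
    ext v
    simp
  rw [Measure.map_apply Measurable.of_discrete (measurableSet_singleton _), h2,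
    PMF.toMeasure_apply_singleton _ _ (measurableSet_singleton _),
    PMF.toMeasure_apply_singleton _ _ (measurableSet_singleton _)]
  simp

/-- Tonelli and invariance of `haarP`. An L¹-small error in f thus stays small on average after
convolution, even with a singular measure. -/
theorem lintegral_lintegral_mul_inv (ν : Measure (Omega A)) [IsFiniteMeasure ν]
    {φ : Omega A → ℝ≥0∞} (hφ : Measurable φ) :
    ∫⁻ ω, ∫⁻ ω', φ (ω * ω'⁻¹) ∂ν ∂haarP A = (∫⁻ ω, φ ω ∂haarP A) * ν univ := by
  rw [lintegral_lintegral_swap (f := fun ω ω' => φ (ω * ω'⁻¹))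
    (hφ.comp measurable_mul_inv_pair).aemeasurable]
  have h (ω' : Omega A) : ∫⁻ ω, φ (ω * ω'⁻¹) ∂haarP A = ∫⁻ ω, φ ω ∂haarP A := by
    conv_rhs => rw [← map_mul_inv_haarP ω']
    rw [lintegral_map hφ (measurable_mul_inv_left ω')]
  simp only [h, lintegral_const]

/-- The infimum of the dominating functions for ε = 1/(n+1) is measurable with integral zero, so no
measurability of u is needed. -/
theorem ae_eq_zero_of_forall_exists_bound {X : Type*} [MeasurableSpace X] {P : Measure X}
    {u : X → ℂ} {K : ℝ≥0∞} (hK : K ≠ ∞)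
    (h : ∀ ε : ℝ, 0 < ε → ∃ β : X → ℝ≥0∞, Measurable β ∧ ∫⁻ ω, β ω ∂P ≤ ENNReal.ofReal ε * K ∧
      ∀ᵐ ω ∂P, ‖u ω‖ₑ ≤ β ω) : ∀ᵐ ω ∂P, u ω = 0 := by
  choose β hβ hint hle using fun n : ℕ => h (1 / (n + 1)) Nat.one_div_pos_of_nat
  have h0 : ∫⁻ ω, ⨅ n, β n ω ∂P = 0 := by
    have h1 := ENNReal.tendsto_ofReal (tendsto_one_div_add_atTop_nhds_zero_nat (𝕜 := ℝ))
    have h2 := ENNReal.Tendsto.mul_const (b := K) h1 (Or.inr hK)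
    rw [ENNReal.ofReal_zero, zero_mul] at h2
    exact le_antisymm (ge_of_tendsto' h2
      fun n => (lintegral_mono fun ω => iInf_le _ n).trans (hint n)) zero_le
  rw [lintegral_eq_zero_iff (Measurable.iInf hβ)] at h0
  filter_upwards [h0, ae_all_iff.2 hle] with ω h1 h2
  have h3 : ‖u ω‖ₑ ≤ ⨅ n, β n ω := le_iInf h2
  rw [h1, Pi.zero_apply] at h3
  simpa using h3

end Translation

/-! ### The continuous version of f ⋆ μ. -/

section Convolution

variable {A : Type*} {μ : ComplexMeasure (Omega A)}

theorem cintegral_const_mul (c : ℂ) (f : Omega A → ℂ) :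
    cintegral (fun ω => c * f ω) μ = c * cintegral f μ := by
  simp only [cintegral, VectorMeasure.integral_eq_setToFun]
  refine setToFun_smul _ (fun c s x => ?_) c f
  change (c * x) * μ s = c * (x * μ s)
  ring

variable [IsFiniteMeasure μ.variation]

theorem cintegral_walsh_polynomial (S : Finset (Finset A)) (b : Finset A → ℂ) (ω : Omega A) :
    cintegral (fun ω' => ∑ F ∈ S, b F * walshChar F (ω * ω'⁻¹)) μ =
      ∑ F ∈ S, b F * walshM μ F * walshChar F ω := by
  rw [cintegral, VectorMeasure.integral_finsetSum]
  · refine Finset.sum_congr rfl fun F _ => ?_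
    simp only [walshChar_mul_inv, ← mul_assoc]
    refine (cintegral_const_mul _ _).trans ?_
    rw [walshM]
    ring
  · intro F _
    simp only [walshChar_mul_inv]
    exact ((integrable_walshChar F _).const_mul _).const_mul _

theorem ae_integrable_mul_inv {f : Omega A → ℂ} (hf : Measurable f) (hf1 : Integrable f (haarP A)) :
    ∀ᵐ ω ∂haarP A, Integrable (fun ω' => f (ω * ω'⁻¹)) μ.variation := by
  have h1 := lintegral_lintegral_mul_inv μ.variation hf.enorm
  have h2 : ∫⁻ ω, ∫⁻ ω', ‖f (ω * ω'⁻¹)‖ₑ ∂μ.variation ∂haarP A ≠ ∞ := by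
    rw [h1]
    exact ENNReal.mul_ne_top hf1.2.ne (measure_ne_top _ _)
  have h3 : Measurable fun ω : Omega A => ∫⁻ ω', ‖f (ω * ω'⁻¹)‖ₑ ∂μ.variation :=
    (hf.enorm.comp measurable_mul_inv_pair).lintegral_prod_right'
  filter_upwards [ae_lt_top h3 h2] with ω hω
  exact ⟨(hf.comp (measurable_mul_inv_right ω)).aestronglyMeasurable, hω⟩

theorem norm_walshC_le (F : Finset A) : ‖walshC F‖ ≤ 1 :=
  (ContinuousMap.norm_le _ zero_le_one).2 fun ω => (norm_walshChar F ω).le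

/-- Absolute convergence of the coefficients makes Σ f̂ μ̂ w a continuous function g, with value c
at the identity. The partial sums are the convolutions of μ with Walsh polynomials tending to f in
L², which identifies g with f ⋆ μ almost everywhere. -/
theorem hasIntegral_of_hasSum {f : Lp ℂ ∞ (haarP A)} {p : ℝ≥0∞} [Fact (1 ≤ p)] (h : p ≤ 2)
    {b : lp (fun _ : Finset A => ℂ) p} (hfb : f =ᵐ[haarP A] walshSum A h b) {c : ℂ}
    (hc : HasSum (fun F => b F * walshM μ F) c) : HasIntegral f μ c := by
  have hsum : Summable fun F => (b F * walshM μ F) • walshC F := by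
    refine Summable.of_norm_bounded hc.summable.norm fun F => ?_
    rw [norm_smul]
    exact mul_le_of_le_one_right (norm_nonneg _) (norm_walshC_le F)
  obtain ⟨g, hg⟩ := hsum
  have hgω (S : Finset (Finset A)) (ω : Omega A) :
      (∑ F ∈ S, (b F * walshM μ F) • walshC F) ω = ∑ F ∈ S, b F * walshM μ F * walshChar F ω := by
    rw [ContinuousMap.sum_apply]
    rfl
  have hf : Measurable f := (Lp.stronglyMeasurable f).measurable
  have hf1 : Integrable f (haarP A) := (Lp.memLp f).integrable le_top
  refine ⟨g, ?_, ?_⟩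
  · have key : ∀ᵐ ω ∂haarP A, conv f μ ω - g ω = 0 := by
      -- The variation accounts for the error in f averaged over translates, the summand 1 for the
      -- uniform error in g.
      refine ae_eq_zero_of_forall_exists_bound (K := μ.variation univ + 1)
        (ENNReal.add_ne_top.2 ⟨measure_ne_top _ _, ENNReal.one_ne_top⟩) fun ε hε => ?_
      have e1 := Metric.tendsto_nhds.1 (hasSum_walshSum h b) ε hε
      have e2 := Metric.tendsto_nhds.1 hg ε hε
      -- One finite set S serves both the L²-approximation of f and the uniform approximation of g.
      obtain ⟨S, hS1, hS2⟩ := (e1.and e2).exists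
      set k : Omega A → ℂ := fun ω => f ω - ∑ F ∈ S, b F * walshChar F ω with hk
      have hkm : Measurable k := hf.sub
        (Finset.measurable_fun_sum _ fun F _ => (measurable_walshChar F).const_mul _)
      have hk1 : ∫⁻ ω, ‖k ω‖ₑ ∂haarP A ≤ ENNReal.ofReal ε := by
        rw [← eLpNorm_one_eq_lintegral_enorm]
        refine (eLpNorm_le_eLpNorm_of_exponent_le one_le_two hkm.aestronglyMeasurable).trans ?_
        have h2 : k =ᵐ[haarP A]
            (walshSum A h b - ∑ F ∈ S, b F • walshL2 F : Lp ℂ 2 (haarP A)) := by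
          filter_upwards [hfb, coeFn_sum_walshL2 S b fun F => F,
            Lp.coeFn_sub (walshSum A h b) (∑ F ∈ S, b F • walshL2 F)] with ω h1 h2 h3
          rw [h3, Pi.sub_apply, h2, ← h1]
        rw [eLpNorm_congr_ae h2, ← Lp.enorm_def, ← ofReal_norm, ← dist_eq_norm, dist_comm]
        exact ENNReal.ofReal_le_ofReal hS1.le
      refine ⟨fun ω => ∫⁻ ω', ‖k (ω * ω'⁻¹)‖ₑ ∂μ.variation + ENNReal.ofReal ε, ?_, ?_, ?_⟩
      · exact ((hkm.enorm.comp measurable_mul_inv_pair).lintegral_prod_right').add_const _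
      · rw [lintegral_add_right _ measurable_const, lintegral_lintegral_mul_inv _ hkm.enorm,
          lintegral_const, measure_univ (μ := haarP A), mul_add]
        gcongr
      · filter_upwards [ae_integrable_mul_inv (μ := μ) hf hf1] with ω hω
        have hpoly : Integrable (fun ω' => ∑ F ∈ S, b F * walshChar F (ω * ω'⁻¹)) μ.variation := by
          refine integrable_finsetSum _ fun F _ => ?_
          simp only [walshChar_mul_inv]
          exact ((integrable_walshChar F _).const_mul _).const_mul _
        have h1 : conv f μ ω - (∑ F ∈ S, (b F * walshM μ F) • walshC F) ω =
            cintegral (fun ω' => k (ω * ω'⁻¹)) μ := by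
          rw [hgω, ← cintegral_walsh_polynomial, conv, cintegral, cintegral, cintegral,
            ← VectorMeasure.integral_fun_sub hω hpoly]
        have h2 : conv f μ ω - g ω = cintegral (fun ω' => k (ω * ω'⁻¹)) μ +
            (∑ F ∈ S, (b F * walshM μ F) • walshC F - g) ω := by
          rw [← h1, ContinuousMap.sub_apply]
          ring
        rw [h2]
        refine (enorm_add_le _ _).trans (add_le_add ?_ ?_)
        · refine VectorMeasure.enorm_integral_le_lintegral_enorm.trans ?_
          refine mul_le_of_le_one_left zero_le ?_
          rw [← ofReal_norm, ContinuousLinearMap.opNorm_mul]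
          simp
        · rw [← ofReal_norm]
          refine ENNReal.ofReal_le_ofReal ((ContinuousMap.norm_coe_le_norm _ ω).trans ?_)
          rw [← dist_eq_norm]
          exact hS2.le
    filter_upwards [key] with ω hω
    exact (sub_eq_zero.1 hω).symm
  · have h1 : HasSum (fun F => ((b F * walshM μ F) • walshC F) 1) (g 1) :=
      hg.map (ContinuousMap.evalCLM ℂ (1 : Omega A)) (ContinuousMap.evalCLM ℂ (1 : Omega A)).continuous
    refine h1.unique (hc.congr_fun fun F => ?_)
    change b F * walshM μ F * walshChar F 1 = _
    rw [walshChar_one, mul_one]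

end Convolution

/-! ### Odd parts of Riesz products. -/

section OddRieszProducts

variable {A : Type*}

/-- The odd part of a Riesz product, with the scalar factor `2 c`. -/
def oddRiesz (t : A → ℝ) (c : ℂ) : ComplexMeasure (Omega A) :=
  complexMul c (riesz t) + complexMul (-c) (riesz (-t))

theorem oddRiesz_neg (t : A → ℝ) (c : ℂ) : oddRiesz (-t) c = -oddRiesz t c := by
  simp only [oddRiesz, neg_neg, complexMul_neg, neg_add]
  exact add_comm _ _

theorem variation_complexMul_le_of_norm_one {ρ : Measure (Omega A)} [IsFiniteMeasure ρ] {c : ℂ}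
    (hc : ‖c‖ = 1) : (complexMul c ρ).variation ≤ ρ := by
  refine (variation_complexMul_le c).trans_eq ?_
  rw [show ‖c‖₊ = 1 from NNReal.eq hc, one_smul]

theorem variation_oddRiesz_le (t : A → ℝ) {c : ℂ} (hc : ‖c‖ = 1) :
    (oddRiesz t c).variation ≤ riesz t + riesz (-t) :=
  (VectorMeasure.variation_add_le).trans (add_le_add (variation_complexMul_le_of_norm_one hc)
    (variation_complexMul_le_of_norm_one (by rwa [norm_neg])))

theorem integrable_variation_oddRiesz (t : A → ℝ) (c : ℂ) (g : C(Omega A, ℂ)) :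
    Integrable g (oddRiesz t c).variation :=
  Integrable.mono_measure ((integrable_variation_complexMul c (integrable_continuousMap g _)).add_measure
    (integrable_variation_complexMul (-c) (integrable_continuousMap g _)))
    VectorMeasure.variation_add_le

theorem cintegral_oddRiesz (t : A → ℝ) (c : ℂ) (g : C(Omega A, ℂ)) :
    cintegral g (oddRiesz t c) = c * (∫ ω, g ω ∂riesz t - ∫ ω, g ω ∂riesz (-t)) := by
  rw [cintegral, oddRiesz, VectorMeasure.integral_add_vectorMeasure
    (integrable_variation_complexMul c (integrable_continuousMap g _))
    (integrable_variation_complexMul (-c) (integrable_continuousMap g _)),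
    integral_complexMul c (integrable_continuousMap g _),
    integral_complexMul (-c) (integrable_continuousMap g _)]
  ring

/-- Changing the sign of t multiplies the coefficient at F by (-1)^|F|, so the difference doubles
odd sets and cancels even ones. -/
theorem prod_sub_prod_neg (t : A → ℝ) (F : Finset A) :
    ∏ α ∈ F, (t α : ℂ) - ∏ α ∈ F, ((-t) α : ℂ) = 2 * monom oddWeight (fun α => (t α : ℂ)) F := by
  have h : ∏ α ∈ F, ((-t) α : ℂ) = (-1) ^ F.card * ∏ α ∈ F, (t α : ℂ) := by
    simp only [Pi.neg_apply, Complex.ofReal_neg, Finset.prod_neg]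
  rw [h, monom, oddWeight]
  split_ifs with hF
  · rw [hF.neg_one_pow]; ring
  · rw [(Nat.not_odd_iff_even.1 hF).neg_one_pow]; ring

theorem walshM_oddRiesz {t : A → ℝ} (ht : ∀ α, |t α| ≤ 1) (c : ℂ) (F : Finset A) :
    walshM (oddRiesz t c) F = c * (2 * monom oddWeight (fun α => (t α : ℂ)) F) := by
  refine (cintegral_oddRiesz t c (walshC F)).trans ?_
  rw [← prod_sub_prod_neg]
  congr 2
  · exact integral_walshChar_riesz ht F
  · exact integral_walshChar_riesz (t := -t) (fun α => by rw [Pi.neg_apply, abs_neg]; exact ht α) F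

theorem continuous_cintegral_oddRiesz {X : Type*} [TopologicalSpace X] {t : X → A → ℝ}
    (ht : ∀ ξ α, |t ξ α| ≤ 1) (hc : ∀ α, Continuous fun ξ => t ξ α) (c : ℂ) (g : C(Omega A, ℂ)) :
    Continuous fun ξ => cintegral g (oddRiesz (t ξ) c) := by
  simp only [cintegral_oddRiesz]
  refine continuous_const.mul ((continuous_integral_riesz ht hc g).sub ?_)
  exact continuous_integral_riesz (t := fun ξ => -t ξ)
    (fun ξ α => by rw [Pi.neg_apply, abs_neg]; exact ht ξ α) (fun α => (hc α).neg) g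

end OddRieszProducts

/-! ### The map Φ for p > 2. -/

section Measures

variable {A : Type*} [Infinite A] {p : ℝ≥0∞} [Fact (1 ≤ p)]

/-- The parameters of the Riesz product attached to a real sequence. -/
def rieszSeq (x : lp (fun _ : A => ℂ) p) (α : A) : ℝ := (measSeq x α).re

theorem abs_rieszSeq_le {x : lp (fun _ : A => ℂ) p} (hx : ‖x‖ ≤ 1) (α : A) :
    |rieszSeq x α| ≤ 1 := by
  have h1 := norm_measSeq_apply_le hx α
  have h2 := Complex.abs_re_le_norm (measSeq x α)
  rw [rieszSeq]
  linarith

theorem ofReal_rieszSeq {x : lp (fun _ : A => ℂ) p} (hx : ‖x‖ ≤ 1) (hr : IsRealSeq x) :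
    (fun α => (rieszSeq x α : ℂ)) = measSeq x :=
  funext fun α => Complex.ext rfl (isRealSeq_measSeq hx hr α).symm

theorem rieszSeq_neg {x : lp (fun _ : A => ℂ) p} (hx : ‖x‖ ≤ 1) : rieszSeq (-x) = -rieszSeq x := by
  funext α
  rw [rieszSeq, measSeq_neg hx]
  exact Complex.neg_re _

theorem continuous_rieszSeq {X : Type*} [TopologicalSpace X] {u : X → lp (fun _ : A => ℂ) p}
    (hu : ∀ ξ, ‖u ξ‖ ≤ 1) (hc : ∀ i, Continuous fun ξ => u ξ i) (α : A) :
    Continuous fun ξ => rieszSeq (u ξ) α :=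
  Complex.continuous_re.comp (continuous_measSeq_apply hu hc α)

/-- The measure attached to an element of the ball of `l^p` for `p > 2`. -/
def psiMeas (x : Ball A p) : ComplexMeasure (Omega A) :=
  oddRiesz (rieszSeq (reSeq x.1)) 1 + oddRiesz (rieszSeq (imSeq x.1)) Complex.I

/-- A sum of four Riesz products which dominates `psiMeas x`. -/
def psiBound (x : Ball A p) : Measure (Omega A) :=
  (riesz (rieszSeq (reSeq x.1)) + riesz (-rieszSeq (reSeq x.1))) +
    (riesz (rieszSeq (imSeq x.1)) + riesz (-rieszSeq (imSeq x.1)))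

instance (x : Ball A p) : IsFiniteMeasure (psiBound x) := by unfold psiBound; infer_instance

theorem psiBound_univ (x : Ball A p) : psiBound x univ = 4 := by
  rw [psiBound, Measure.add_apply, Measure.add_apply, Measure.add_apply]
  simp only [measure_univ]
  norm_num

theorem variation_psiMeas_le (x : Ball A p) : (psiMeas x).variation ≤ psiBound x :=
  (VectorMeasure.variation_add_le).trans (add_le_add (variation_oddRiesz_le _ norm_one)
    (variation_oddRiesz_le _ Complex.norm_I))

instance (x : Ball A p) : IsFiniteMeasure (psiMeas x).variation :=
  isFiniteMeasure_of_le _ (variation_psiMeas_le x)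

theorem cintegral_psiMeas (x : Ball A p) (g : C(Omega A, ℂ)) :
    cintegral g (psiMeas x) = cintegral g (oddRiesz (rieszSeq (reSeq x.1)) 1) +
      cintegral g (oddRiesz (rieszSeq (imSeq x.1)) Complex.I) :=
  VectorMeasure.integral_add_vectorMeasure (integrable_variation_oddRiesz _ _ g)
    (integrable_variation_oddRiesz _ _ g)

theorem walshM_psiMeas (x : Ball A p) : walshM (psiMeas x) = measHatC x.1 := by
  funext F
  have h1 := (norm_reSeq_le x.1).trans x.norm_le
  have h2 := (norm_imSeq_le x.1).trans x.norm_le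
  refine (cintegral_psiMeas x (walshC F)).trans ?_
  rw [measHatC, lp.coeFn_add, Pi.add_apply, lp.coeFn_smul, Pi.smul_apply, measHat_apply h1,
    measHat_apply h2, smul_eq_mul, ← ofReal_rieszSeq h1 (isRealSeq_reSeq _),
    ← ofReal_rieszSeq h2 (isRealSeq_imSeq _)]
  refine congrArg₂ _ ((walshM_oddRiesz (abs_rieszSeq_le h1) 1 F).trans (one_mul _)) ?_
  exact walshM_oddRiesz (abs_rieszSeq_le h2) Complex.I F

/-- The map `Φ` for `p > 2`. -/
def psi (p : ℝ≥0∞) [Fact (1 ≤ p)] (x : Ball A p) : MeasP A p :=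
  ⟨psiMeas x, isRegular_of_variation_le (variation_psiMeas_le x),
    by rw [walshM_psiMeas]; exact lp.memℓp _⟩

theorem hat_psi (x : Ball A p) : (psi p x).hat = measHatC x.1 := Subtype.ext (walshM_psiMeas x)

theorem injective_psi : Function.Injective (psi (A := A) p) := by
  intro x y hxy
  have h1 := congrArg MeasP.hat hxy
  rw [hat_psi, hat_psi] at h1
  refine Subtype.ext (lp.ext (funext fun α => ?_))
  rw [← measHatC_apply_singleton x.norm_le, ← measHatC_apply_singleton y.norm_le, h1]

/-- Since sinh 1 = 1 + δ², the construction yields 4(1 + δ²)^(1/p) for the transform and 4 for the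
variation; both lie below the required bound. -/
theorem one_add_delta_sq_div : 1 ≤ (1 + delta ^ 2) / (1 - delta ^ 2) ∧
    Real.sinh 1 ≤ (1 + delta ^ 2) / (1 - delta ^ 2) := by
  have h1 := sinh_one_bounds
  rw [delta_sq, le_div_iff₀ (by linarith), le_div_iff₀ (by linarith)]
  constructor <;> nlinarith

theorem nrm_psi_le (x : Ball A p) : (psi p x).nrm ≤
    ENNReal.ofReal (4 * ((1 + delta ^ 2) / (1 - delta ^ 2)) ^ (1 / p).toReal) := by
  obtain ⟨h1, h2⟩ := one_add_delta_sq_div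
  refine max_le ?_ (ENNReal.ofReal_le_ofReal ?_)
  · refine (variation_psiMeas_le x univ).trans ?_
    rw [psiBound_univ]
    have h3 := Real.one_le_rpow h1 (ENNReal.toReal_nonneg (a := 1 / p))
    calc (4 : ℝ≥0∞) = ENNReal.ofReal 4 := by norm_num
      _ ≤ _ := ENNReal.ofReal_le_ofReal (by linarith)
  · rw [hat_psi]
    refine (norm_measHatC_le x.norm_le).trans ?_
    have h3 := Real.rpow_le_rpow (by linarith [sinh_one_bounds.1]) h2
      (ENNReal.toReal_nonneg (a := 1 / p))
    linarith

theorem psi_neg (x : Ball A p) : (psi p (-x)).1 = -(psi p x).1 := by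
  change oddRiesz (rieszSeq (reSeq (-x.1))) 1 + oddRiesz (rieszSeq (imSeq (-x.1))) Complex.I =
    -(oddRiesz (rieszSeq (reSeq x.1)) 1 + oddRiesz (rieszSeq (imSeq x.1)) Complex.I)
  rw [reSeq_neg, imSeq_neg, rieszSeq_neg ((norm_reSeq_le x.1).trans x.norm_le),
    rieszSeq_neg ((norm_imSeq_le x.1).trans x.norm_le), oddRiesz_neg, oddRiesz_neg, neg_add]

theorem continuous_hat_psi : Continuous fun x : Ball A p => (psi p x).hat := by
  simp only [hat_psi]
  exact continuousOn_measHatC.comp_continuous continuous_subtype_val fun x => x.norm_le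

theorem continuous_psi : @Continuous _ _ (Ball.weak A p) (MeasP.weakStar A p) (psi p) := by
  refine continuous_iInf_rng.2 fun g => continuous_induced_rng.2 ?_
  let _ := Ball.weak A p
  have hx (α : A) : Continuous fun x : Ball A p => x.1 α := continuous_weak_apply A p α
  change Continuous fun x : Ball A p => cintegral g (psiMeas x)
  simp only [cintegral_psiMeas]
  have h1 (x : Ball A p) := (norm_reSeq_le x.1).trans x.norm_le
  have h2 (x : Ball A p) := (norm_imSeq_le x.1).trans x.norm_le
  refine Continuous.add ?_ ?_
  · refine continuous_cintegral_oddRiesz (fun x => abs_rieszSeq_le (h1 x))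
      (continuous_rieszSeq h1 fun i => ?_) 1 g
    simp only [reSeq_apply]
    exact Complex.continuous_ofReal.comp (Complex.continuous_re.comp (hx i))
  · refine continuous_cintegral_oddRiesz (fun x => abs_rieszSeq_le (h2 x))
      (continuous_rieszSeq h2 fun i => ?_) Complex.I g
    simp only [imSeq_apply]
    exact Complex.continuous_ofReal.comp (Complex.continuous_im.comp (hx i))

end Measures

/-- Excluding p = 2 makes the twist trivial, so the layers carry the weights ρ^j which fit the
measure side. -/
theorem ne_two_of_conjugate {p q : ℝ≥0∞} (hpq : 1 / p + 1 / q = 1) (hq : 2 < q) : p ≠ 2 := by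
  rintro rfl
  have h : q⁻¹ < 2⁻¹ := ENNReal.inv_lt_inv.2 hq
  have h2 : (2⁻¹ : ℝ≥0∞) + q⁻¹ < 2⁻¹ + 2⁻¹ := ENNReal.add_lt_add_left (by simp) h
  rw [ENNReal.inv_two_add_inv_two, ← one_div, ← one_div, hpq] at h2
  exact h2.false

theorem hasSum_mul_conj {A : Type*} {p q : ℝ≥0∞} [Fact (1 ≤ p)] [Fact (1 ≤ q)]
    [p.HolderConjugate q] (x : Ball A p) (y : Ball A q) :
    HasSum (fun α => x.1 α * starRingEnd ℂ (y.1 α)) (lpPair A p q x.1 y.conj.1) :=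
  hasSum_lpPair x.1 y.conj.1

end WalshParseval

end

open WalshParseval in
theorem mainTheorem5 (A : Type*) [Infinite A] :
    ∃ (Φ : ∀ (p : ℝ≥0∞) [Fact (1 ≤ p)], p ≤ 2 → Ball A p → LinfP A p)
      (Ψ : ∀ (p : ℝ≥0∞) [Fact (1 ≤ p)], 2 < p → Ball A p → MeasP A p),
      -- the case `1 ≤ p ≤ 2`
      (∀ (p : ℝ≥0∞) [Fact (1 ≤ p)] (hp : p ≤ 2),
        Function.Injective (Φ p hp) ∧
        (∀ x, (Φ p hp x).nrm ≤ 2 * Real.sqrt (Real.exp 1) / (1 - delta ^ (2 / p).toReal)) ∧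
        (∀ x, (Φ p hp (-x)).1 = -(Φ p hp x).1) ∧
        Continuous[Ball.weak A p, LinfP.weakStar A p] (Φ p hp) ∧
        Continuous (fun x => (Φ p hp x).hat)) ∧
      -- the case `2 < p ≤ ∞`
      (∀ (p : ℝ≥0∞) [Fact (1 ≤ p)] (hp : 2 < p),
        Function.Injective (Ψ p hp) ∧
        (∀ x, (Ψ p hp x).nrm ≤
          ENNReal.ofReal (4 * ((1 + delta ^ 2) / (1 - delta ^ 2)) ^ (1 / p).toReal)) ∧
        (∀ x, (Ψ p hp (-x)).1 = -(Ψ p hp x).1) ∧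
        Continuous[Ball.weak A p, MeasP.weakStar A p] (Ψ p hp) ∧
        Continuous (fun x => (Ψ p hp x).hat)) ∧
      -- the Parseval-like formula, for conjugate `1 ≤ p < 2 < q ≤ ∞`
      (∀ (p q : ℝ≥0∞) [Fact (1 ≤ p)] [Fact (1 ≤ q)] (hp : p ≤ 2) (hq : 2 < q), 1 / p + 1 / q = 1 →
        ∀ (x : Ball A p) (y : Ball A q), ∃ c : ℂ,
          HasSum (fun α => x.1 α * starRingEnd ℂ (y.1 α)) c ∧
          HasIntegral (Φ p hp x).1 (Ψ q hq y.conj).1 c ∧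
          HasSum (fun w => (Φ p hp x).hat w * (Ψ q hq y.conj).hat w) c) ∧
      -- the Parseval-like formula, for `p = q = 2`
      (∀ x y : Ball A 2, ∃ c : ℂ,
          HasSum (fun α => x.1 α * starRingEnd ℂ (y.1 α)) c ∧
          c = ∫ ω, (Φ 2 le_rfl x).1 ω * (Φ 2 le_rfl y.conj).1 ω ∂(haarP A) ∧
          HasSum (fun w => (Φ 2 le_rfl x).hat w * (Φ 2 le_rfl y.conj).hat w) c) := by
  refine ⟨fun p _ h => phi p h, fun p _ _ => psi p, fun p _ h => ⟨injective_phi h, nrm_phi_le h,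
    phi_neg h, continuous_phi h, continuous_hat_phi h⟩, fun p _ _ => ⟨injective_psi, nrm_psi_le,
    psi_neg, continuous_psi, continuous_hat_psi⟩, ?_, ?_⟩
  · intro p q _ _ hp hq hpq x y
    have hc : p.HolderConjugate q := by
      rw [ENNReal.holderConjugate_iff]
      simpa only [one_div] using hpq
    have h1 : HasSum (fun w => (phi p hp x).hat w * (psi q y.conj).hat w)
        (lpPair A p q x.1 y.conj.1) := by
      rw [← lpPair_fnHatC_measHatC (ne_top_of_le_two hp) (ne_two_of_conjugate hpq hq) x.norm_le
        y.conj.norm_le, hat_phi, hat_psi]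
      exact hasSum_lpPair _ _
    have h2 : HasIntegral (phi p hp x).1 (psiMeas y.conj) (lpPair A p q x.1 y.conj.1) := by
      refine hasIntegral_of_hasSum hp (coeFn_phiFun hp x) ?_
      rwa [hat_phi] at h1
    exact ⟨_, hasSum_mul_conj x y, h2, h1⟩
  · intro x y
    have h1 : HasSum (fun w => (phi 2 le_rfl x).hat w * (phi 2 le_rfl y.conj).hat w)
        (lpPair A 2 2 x.1 y.conj.1) := by
      rw [← lpPair_fnHatC_fnHatC x.norm_le y.conj.norm_le, hat_phi, hat_phi]
      exact hasSum_lpPair _ _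
    exact ⟨_, hasSum_mul_conj x y, h1.unique (hasSum_integral_phi x y.conj), h1⟩
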